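/- For a metric space $(X,d)$ and $s>0$, a collection $\mathcal U$ of subsets of $X$ is *$s$-disjoint* if $\inf\{d(x,x') : x\in U, x'\in U'\}\ge s$ for all distinct $U,U'\in\mathcal U$, and *$(n+1,s)$-disjoint* if it is a union of $n+1$ subcollections each of which is $s$-disjoint. The *asymptotic dimension* $\mathrm{asdim}(X)$ is the smallest $n$ such that for every $s>0$ there is an $(n+1,s)$-disjoint cover $\mathcal U$ of $X$ with $\sup_{U\in\mathcal U}\mathrm{diam}(U)<\infty$. The *Assouad–Nagata dimension* $\mathrm{ANdim}(X)$ is the smallest $n$ for which there is $c\in\mathbb R$ such that for every $s>0$ there is an $(n+1,s)$-disjoint cover $\mathcal U$ of $X$ with $\sup_{U\in\mathcal U}\mathrm{diam}(U)<cs$. A graph is regarded as the metric space formed by its vertices with the graph distance; it is *planar* if, viewed as a 1-complex, it is homeomorphic to a subset of $\mathbb R^2$. For every integer $n\ge 1$ let $H_n$ be the $n\times n$ square grid, i.e. the Cartesian product with itself of the path of length $n$ (with $n+1$ vertices), and let $G_n$ be obtained from $H_n$ by subdividing each edge $n$ times, i.e. by replacing each edge with a path with $n$ new inner vertices. Let $G$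 be any graph obtained from the disjoint union of the graphs $G_n$, $n\ge1$, by joining, for every $n\geq 1$, an arbitrary vertex $a_n$ of $G_n$ with an arbitrary vertex $b_{n+1}$ of $G_{n+1}$ by a path of length $n$ (with new inner vertices). Then, for every choice of the vertices $a_n$, $b_{n+1}$, the graph $G$ is planar, $\mathrm{asdim}(G)=1$ and $\mathrm{ANdim}(G)=2$. In particular, there is a planar graph whose asymptotic dimension and Assouad–Nagata dimension differ. -/

import Mathlib

open scoped ENNReal

/-! ### Asymptotic dimension and Assouad–Nagata dimension -/

section Dimension

variable {X : Type*} [PseudoEMetricSpace X]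

/-- A collection of subsets is `s`-disjoint if distinct members have distance at least `s`. -/
def IsSDisjoint (s : ℝ) (𝒰 : Set (Set X)) : Prop :=
  ∀ U ∈ 𝒰, ∀ U' ∈ 𝒰, U ≠ U' → ENNReal.ofReal s ≤ ⨅ x ∈ U, ⨅ x' ∈ U', edist x x'

/-- `IsColourDisjoint m s 𝒰`: the collection `𝒰` is `(m, s)`-disjoint, that is, a union of `m`
subcollections each of which is `s`-disjoint. -/
def IsColourDisjoint (m : ℕ) (s : ℝ) (𝒰 : Set (Set X)) : Prop :=
  ∃ 𝒱 : Fin m → Set (Set X), 𝒰 = (⋃ i, 𝒱 i) ∧ ∀ i, IsSDisjoint s (𝒱 i)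

variable (X)

/-- The asymptotic dimension (`⊤` if there is no suitable `n`). -/
noncomputable def asdim : ℕ∞ :=
  sInf {k : ℕ∞ | ∃ n : ℕ, k = n ∧ ∀ s : ℝ, 0 < s → ∃ 𝒰 : Set (Set X),
    ⋃₀ 𝒰 = Set.univ ∧ IsColourDisjoint (n + 1) s 𝒰 ∧ (⨆ U ∈ 𝒰, Metric.ediam U) < ⊤}

/-- The Assouad–Nagata dimension (`⊤` if there is no suitable `n`). -/
noncomputable def ANdim : ℕ∞ :=
  sInf {k : ℕ∞ | ∃ n : ℕ, k = n ∧ ∃ c : ℝ, ∀ s : ℝ, 0 < s → ∃ 𝒰 : Set (Set X),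
    ⋃₀ 𝒰 = Set.univ ∧ IsColourDisjoint (n + 1) s 𝒰 ∧
      (⨆ U ∈ 𝒰, Metric.ediam U) < ENNReal.ofReal (c * s)}

end Dimension

namespace SimpleGraph

/-! ### Graphs as metric spaces -/

/-- The vertex set of a graph with the graph distance (`⊤` between different components). -/
noncomputable abbrev graphEMetric {V : Type*} (G : SimpleGraph V) : EMetricSpace V where
  edist u v := (G.edist u v : ℝ≥0∞)
  edist_self u := by simp
  edist_comm u v := by rw [edist_comm]
  edist_triangle u v w := by exact_mod_cast G.edist_triangle
  eq_of_edist_eq_zero := by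
    intro u v h
    simpa using h

/-- The asymptotic dimension of a graph, with respect to the graph distance. -/
noncomputable def graphAsdim {V : Type*} (G : SimpleGraph V) : ℕ∞ :=
  letI := G.graphEMetric
  asdim V

/-- The Assouad–Nagata dimension of a graph, with respect to the graph distance. -/
noncomputable def graphANdim {V : Type*} (G : SimpleGraph V) : ℕ∞ :=
  letI := G.graphEMetric
  ANdim V

/-! ### Planar graphs -/

/-- The gluing of the 1-complex of `G`: one copy of the unit interval for every oriented edge, its
ends glued to the ends of the edge, and the two orientations of an edge glued to each other. -/
inductive RealizationRel {V : Type*} (G : SimpleGraph V) :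
    V ⊕ (G.Dart × unitInterval) → V ⊕ (G.Dart × unitInterval) → Prop
  | source (d : G.Dart) : RealizationRel G (Sum.inr (d, 0)) (Sum.inl d.fst)
  | target (d : G.Dart) : RealizationRel G (Sum.inr (d, 1)) (Sum.inl d.snd)
  | flip (d : G.Dart) (t : unitInterval) :
      RealizationRel G (Sum.inr (d, t)) (Sum.inr (d.symm, unitInterval.symm t))

/-- The graph `G` viewed as a 1-complex. -/
def Realization {V : Type*} (G : SimpleGraph V) : Type _ := Quot G.RealizationRel

/-- The topology of a 1-complex: the quotient topology, where the set of vertices and the set of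
oriented edges are discrete. -/
instance {V : Type*} (G : SimpleGraph V) : TopologicalSpace G.Realization :=
  letI : TopologicalSpace V := ⊥
  letI : TopologicalSpace G.Dart := ⊥
  TopologicalSpace.coinduced (Quot.mk G.RealizationRel) inferInstance

/-- A graph is planar if, as a 1-complex, it is homeomorphic to a subset of the plane. -/
def IsPlanar {V : Type*} (G : SimpleGraph V) : Prop :=
  ∃ f : G.Realization → EuclideanSpace ℝ (Fin 2), Topology.IsEmbedding f

/-! ### Subdivisions and chains of graphs -/

/-- The `i`-th vertex, `0 ≤ i ≤ k + 1`, of the path that replaces the edge `e` when every edge of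
`H` is subdivided `k` times. (The orientation of `e` is arbitrary.) -/
noncomputable def subdividePoint {V : Type*} (H : SimpleGraph V) (k : ℕ) (e : H.edgeSet) (i : ℕ) :
    V ⊕ (H.edgeSet × Fin k) :=
  if i = 0 then Sum.inl (Quot.out e.1).1
  else if h : i - 1 < k then Sum.inr (e, ⟨i - 1, h⟩)
  else Sum.inl (Quot.out e.1).2

/-- The graph obtained from `H` by subdividing each edge `k` times, that is, by replacing it with
a path that has `k` new inner vertices. -/
noncomputable def subdivide {V : Type*} (H : SimpleGraph V) (k : ℕ) :
    SimpleGraph (V ⊕ (H.edgeSet × Fin k)) :=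
  SimpleGraph.fromRel fun x y => ∃ e : H.edgeSet, ∃ i ≤ k,
    x = H.subdividePoint k e i ∧ y = H.subdividePoint k e (i + 1)

/-- The `i`-th vertex, `0 ≤ i ≤ m j + 1`, of the path with `m j` inner vertices that joins the
vertex `a j` of the `j`-th graph with the vertex `b j` of the `(j + 1)`-st graph. -/
def linkPoint {W : ℕ → Type*} (m : ℕ → ℕ) (a : ∀ j, W j) (b : ∀ j, W (j + 1)) (j i : ℕ) :
    (Σ j, W j) ⊕ (Σ j, Fin (m j)) :=
  if i = 0 then Sum.inl ⟨j, a j⟩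
  else if h : i - 1 < m j then Sum.inr ⟨j, ⟨i - 1, h⟩⟩
  else Sum.inl ⟨j + 1, b j⟩

/-- The graph obtained from the disjoint union of the graphs `G j` by joining, for every `j`, the
vertex `a j` of `G j` with the vertex `b j` of `G (j + 1)` by a path with `m j` new inner
vertices, that is, of length `m j + 1`. -/
def chain {W : ℕ → Type*} (G : ∀ j, SimpleGraph (W j)) (m : ℕ → ℕ)
    (a : ∀ j, W j) (b : ∀ j, W (j + 1)) : SimpleGraph ((Σ j, W j) ⊕ (Σ j, Fin (m j))) :=
  SimpleGraph.fromRel fun x y =>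
    (∃ j u v, (G j).Adj u v ∧ x = Sum.inl ⟨j, u⟩ ∧ y = Sum.inl ⟨j, v⟩) ∨
    (∃ j, ∃ i ≤ m j, x = linkPoint m a b j i ∧ y = linkPoint m a b j (i + 1))

/-- The `n × n` square grid: the Cartesian product of the path of length `n` (so with `n + 1`
vertices) with itself. -/
def squareGrid (n : ℕ) : SimpleGraph (Fin (n + 1) × Fin (n + 1)) :=
  pathGraph (n + 1) □ pathGraph (n + 1)

/-- The vertices of the `n × n` grid with every edge subdivided `n` times. -/
abbrev SubdividedGridVertex (n : ℕ) : Type :=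
  (Fin (n + 1) × Fin (n + 1)) ⊕ ((squareGrid n).edgeSet × Fin n)

/-- The `n × n` grid with every edge subdivided `n` times. -/
noncomputable def subdividedGrid (n : ℕ) : SimpleGraph (SubdividedGridVertex n) :=
  (squareGrid n).subdivide n

/-- The chain of the subdivided grids with `n = 1, 2, 3, …`, where the grid with `n = j + 1` is
joined to the next one by a path of length `j + 1` from `a j` to `b j`. -/
noncomputable def gridChain (a : ∀ j : ℕ, SubdividedGridVertex (j + 1))
    (b : ∀ j : ℕ, SubdividedGridVertex (j + 2)) :
    SimpleGraph ((Σ j : ℕ, SubdividedGridVertex (j + 1)) ⊕ (Σ j : ℕ, Fin j)) :=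
  chain (fun j => subdividedGrid (j + 1)) (fun j => j) a b

end SimpleGraph

/-! Upper bounds. Suppose that `k` functions are 1-Lipschitz on a graph and that every walk on which
all of them oscillate by at most `(k + 2) R` has ends at distance at most `D`. Cutting the line into
blocks of length `R` and giving a vertex a colour `i ≤ k` that is not the residue modulo `k + 1` of
any of its `k` block numbers yields a cover with `k + 1` colours and diameters at most `D`
(`hasCover_of_lipschitz`). The chain carries two such functions. In each grid `height` is `±x ± y`
up to a constant, with signs chosen so that it gains the full ℓ¹-distance from entry to exit; along
the spine it therefore measures distance up to a factor 3. The other is `abscissa`. Together they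
control both coordinates linearly, whence ANdim ≤ 2. For asdim ≤ 1 `height` alone suffices. At a
fixed scale only finitely many grids have small cells, and these have bounded diameter. In the other
grids a walk of small oscillation cannot reach a second column (or, if it starts on a row, a second
row), so it stays near its start (`dist_le_of_walk`). Entries and exits are cut vertices, so the
estimates in single grids combine to one for the chain (`near_of_walk`).

Lower bounds. The chain is connected along its spine and unbounded, so asdim ≥ 1. At a scale just
above `6 (j + 2)`, neighbouring crossings of the `j`-th grid are closer than the disjointness scale,
while the side length `(j + 1) (j + 2)` exceeds any fixed multiple of the scale for large `j`. A
cover with two colours would contradict the Lebesgue covering theorem for the square. Its discrete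
form (`exists_opposite_labels`) is proved by lifting a labelling by `ZMod 4` to the integers.

Planarity. Each grid is drawn in the integer lattice with a diagonal spoke at its entry and at its
exit. A Möbius map with its zero just beyond the tip of the entry spoke and its pole just beyond the
tip of the exit spoke puts the drawing into an annulus whose bounding circles it meets only in the
tips (`exists_placement`). Rotating and rescaling nests the annuli and makes consecutive tips
coincide (`exists_nested`). The radii at least double, so the drawing is locally finite, and a
locally finite drawing without crossings is an embedding of the 1-complex (`isPlanar_of_drawing`).
-/

namespace SimpleGraph

/-! ### Coloured covers from Lipschitz functions -/

section Cover

variable {V : Type*} {G : SimpleGraph V}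

/-- A function that changes by at most `1` along every edge. -/
def IsLipschitz (G : SimpleGraph V) (F : V → ℤ) : Prop :=
  ∀ u v, G.Adj u v → |F u - F v| ≤ 1

theorem IsLipschitz.abs_sub_le_length {F : V → ℤ} (hF : G.IsLipschitz F) {u v : V}
    (w : G.Walk u v) : |F u - F v| ≤ w.length := by
  induction w with
  | nil => simp
  | cons h w ih =>
    have := hF _ _ h
    rw [Walk.length_cons]
    push_cast
    rw [abs_le] at *
    constructor <;> linarith

theorem IsLipschitz.abs_sub_le_of_mem_support {F : V → ℤ} (hF : G.IsLipschitz F) {u v z : V}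
    (w : G.Walk u v) (hz : z ∈ w.support) : |F u - F z| ≤ w.length := by
  classical
  have h1 := hF.abs_sub_le_length (w.takeUntil z hz)
  have h2 := w.length_takeUntil_le_length hz
  exact h1.trans (by exact_mod_cast h2)

/-- There is an `(m, s)`-disjoint cover of `G` by sets of diameter at most `D`. -/
def HasCover (G : SimpleGraph V) (m : ℕ) (s : ℝ) (D : ℕ) : Prop :=
  letI := G.graphEMetric
  ∃ 𝒰 : Set (Set V), ⋃₀ 𝒰 = Set.univ ∧ IsColourDisjoint m s 𝒰 ∧
    ∀ U ∈ 𝒰, ∀ x ∈ U, ∀ y ∈ U, G.edist x y ≤ D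

/-- The vertices at which no `F l` is, in units of `R`, congruent to `i` modulo `k + 1`. -/
def colourSet {k : ℕ} (F : Fin k → V → ℤ) (R : ℕ) (i : Fin (k + 1)) : Set V :=
  {x | ∀ l, (F l x / R) % (k + 1) ≠ i}

/-- The left end of the interval of values of `F` that a vertex of `colourSet F R i` lies in. -/
def blockStart (k R : ℕ) (i : Fin (k + 1)) (a : ℤ) : ℤ :=
  (i + 1) * R + (k + 1) * R * ((a / R - i - 1) / (k + 1))

/-- Modulo `k + 1` the block number is `i + 1 + r` with `0 ≤ r ≤ k`, and `r = k` is the excluded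
residue `i`. The admissible values thus form intervals of length `k R` separated by gaps of length
`R`. -/
theorem blockStart_bounds {k R : ℕ} (hR : 0 < R) {i : Fin (k + 1)} {a : ℤ}
    (ha : (a / R) % (k + 1) ≠ i) :
    blockStart k R i a ≤ a ∧ a < blockStart k R i a + k * R := by
  have hi := i.2
  have hR' : (0 : ℤ) < R := by exact_mod_cast hR
  have h1 := Int.mul_ediv_add_emod a R
  have h2 := Int.emod_nonneg a hR'.ne'
  have h3 := Int.emod_lt_of_pos a hR'
  have hk : (0 : ℤ) < k + 1 := by positivity
  have h4 := Int.mul_ediv_add_emod (a / R - i - 1) (k + 1)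
  have h5 := Int.emod_nonneg (a / R - i - 1) hk.ne'
  have h6 := Int.emod_lt_of_pos (a / R - i - 1) hk
  unfold blockStart
  generalize hq : a / (R : ℤ) = q at *
  generalize hb : (q - i - 1) / ((k : ℤ) + 1) = b at *
  generalize hr : (q - i - 1) % ((k : ℤ) + 1) = r at *
  have hrk : r < k := by
    refine lt_of_le_of_ne (by omega) ?_
    rintro rfl
    apply ha
    have : q = (i : ℤ) + (k + 1) * (b + 1) := by linarith
    rw [this, Int.add_mul_emod_self_left]
    exact Int.emod_eq_of_lt (by positivity) (by exact_mod_cast hi)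
  have hq' : q = (k + 1) * b + r + i + 1 := by linarith
  have e : a = (i + 1) * R + (k + 1) * R * b + r * R + a % R := by
    rw [← h1, hq']; simp; ring
  constructor
  · nlinarith [mul_nonneg h5 hR'.le]
  · have : (r + 1) * (R : ℤ) ≤ k * R := by
      apply mul_le_mul_of_nonneg_right _ hR'.le
      omega
    linarith

/-- The intervals are half-open, so values in different ones differ by strictly more than the gap
`R`. -/
theorem blockStart_eq {k R : ℕ} (hR : 0 < R) {i : Fin (k + 1)} {a b : ℤ}
    (ha : (a / R) % (k + 1) ≠ i) (hb : (b / R) % (k + 1) ≠ i) (hab : |a - b| ≤ R) :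
    blockStart k R i a = blockStart k R i b := by
  have h1 := blockStart_bounds hR ha
  have h2 := blockStart_bounds hR hb
  unfold blockStart at *
  rw [abs_le] at hab
  have hR' : (0 : ℤ) < R := by exact_mod_cast hR
  generalize (a / (R : ℤ) - i - 1) / ((k : ℤ) + 1) = x at *
  generalize (b / (R : ℤ) - i - 1) / ((k : ℤ) + 1) = y at *
  have hk : (0 : ℤ) < (k + 1) * R := by positivity
  rcases lt_trichotomy x y with h | h | h
  · have : ((k : ℤ) + 1) * R * (x + 1) ≤ (k + 1) * R * y :=
      mul_le_mul_of_nonneg_left h hk.le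
    nlinarith
  · rw [h]
  · have : ((k : ℤ) + 1) * R * (y + 1) ≤ (k + 1) * R * x :=
      mul_le_mul_of_nonneg_left h hk.le
    nlinarith

/-- If `k` Lipschitz functions control the diameter of the connected sets on which each of them
varies little, then there are covers with `k + 1` colours. -/
theorem hasCover_of_lipschitz {k : ℕ} {F : Fin k → V → ℤ} (hF : ∀ l, G.IsLipschitz (F l))
    {R D : ℕ} (hR : 0 < R) {s : ℝ} (hs : s ≤ R)
    (hD : ∀ p q (w : G.Walk p q),
      (∀ l, ∀ u ∈ w.support, ∀ v ∈ w.support, F l u - F l v ≤ ((k + 2) * R : ℕ)) →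
      G.edist p q ≤ D) :
    G.HasCover (k + 1) s D := by
  let _ := G.graphEMetric
  -- The members of the cover are the classes of vertices of one colour joined by jumps shorter than
  -- `s`. The geodesics that realise the jumps may leave the colour class, but each `F l` leaves its
  -- interval by at most `R`; this is the margin in `key`, and it turns `k R` into `(k + 2) R`.
  let rel : Fin (k + 1) → V → V → Prop := fun i x y =>
    x ∈ colourSet F R i ∧ y ∈ colourSet F R i ∧ EDist.edist x y < ENNReal.ofReal s
  have key : ∀ i x y, x ∈ colourSet F R i → Relation.ReflTransGen (rel i) x y →
      y ∈ colourSet F R i ∧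
      (∀ l, blockStart k R i (F l y) = blockStart k R i (F l x)) ∧
      ∃ w : G.Walk x y, ∀ l, ∀ z ∈ w.support, blockStart k R i (F l x) - R ≤ F l z ∧
        F l z ≤ blockStart k R i (F l x) + (k + 1) * R := by
    intro i x y hx h
    have hR0 : (0 : ℤ) ≤ R := by positivity
    induction h with
    | refl =>
      refine ⟨hx, fun _ => rfl, Walk.nil, fun l z hz => ?_⟩
      have := blockStart_bounds hR (hx l)
      obtain rfl : z = x := by simpa using hz
      constructor <;> linarith
    | @tail y z _ hyz ih =>
      obtain ⟨hy, hb, w, hw⟩ := ih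
      obtain ⟨-, hz, hd⟩ := hyz
      have hd' : (G.edist y z : ℝ≥0∞) < (R : ℝ≥0∞) := by
        refine lt_of_lt_of_le hd ?_
        rw [← ENNReal.ofReal_natCast]
        exact ENNReal.ofReal_le_ofReal hs
      have hd2 : G.edist y z < (R : ℕ∞) := by
        rw [← ENat.toENNReal_lt]; simpa using hd'
      have hne : G.edist y z ≠ ⊤ := ne_top_of_lt hd2
      obtain ⟨w', hw'⟩ := exists_walk_of_edist_ne_top hne
      have hlen : w'.length ≤ R := by
        rw [← hw'] at hd2
        exact_mod_cast hd2.le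
      have hlen' : (w'.length : ℤ) ≤ R := by exact_mod_cast hlen
      refine ⟨hz, fun l => ?_, w.append w', fun l u hu => ?_⟩
      · rw [← hb l]
        refine (blockStart_eq hR (hy l) (hz l) ?_).symm
        exact ((hF l).abs_sub_le_length w').trans hlen'
      · rw [Walk.mem_support_append_iff] at hu
        rcases hu with hu | hu
        · exact hw l u hu
        · have h1 := ((hF l).abs_sub_le_of_mem_support w' hu).trans hlen'
          have h2 := blockStart_bounds hR (hy l)
          rw [hb l] at h2
          rw [abs_le] at h1
          constructor <;> linarith
  refine ⟨⋃ i, {U | ∃ x ∈ colourSet F R i, U = {y | Relation.ReflTransGen (rel i) x y}}, ?_,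
    ⟨_, rfl, ?_⟩, ?_⟩
  · refine Set.eq_univ_of_forall fun x => ?_
    -- Each `F l` forbids one colour, and `k` functions cannot forbid all `k + 1`.
    obtain ⟨i, hi⟩ : ∃ i : Fin (k + 1), x ∈ colourSet F R i := by
      by_contra! hcon
      have hk : (0 : ℤ) < k + 1 := by positivity
      have h1 : ∀ i : Fin (k + 1), ∃ l : Fin k, (F l x / R) % (k + 1) = i := by
        intro i
        have := hcon i
        simpa [colourSet] using this
      choose e he using h1
      have : Function.Injective e := by
        intro i j hij
        have h2 := he i
        rw [hij, he j] at h2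
        exact Fin.ext (by exact_mod_cast h2.symm)
      have := Fintype.card_le_of_injective e this
      simp at this
    exact ⟨_, Set.mem_iUnion.2 ⟨i, x, hi, rfl⟩, Relation.ReflTransGen.refl⟩
  · rintro i _ ⟨x, hx, rfl⟩ _ ⟨x', hx', rfl⟩ hne
    refine le_iInf₂ fun y hy => le_iInf₂ fun y' hy' => ?_
    by_contra! hlt
    apply hne
    have hsymm : ∀ u v, Relation.ReflTransGen (rel i) u v → Relation.ReflTransGen (rel i) v u :=
      fun u v h => by
        have : Std.Symm (rel i) := ⟨fun a b ⟨h1, h2, h3⟩ => ⟨h2, h1, by rwa [PseudoEMetricSpace.edist_comm]⟩⟩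
        exact (Relation.ReflTransGen.stdSymm).symm _ _ h
    have hyy : rel i y y' := ⟨(key i x y hx hy).1, (key i x' y' hx' hy').1, hlt⟩
    have hxx : Relation.ReflTransGen (rel i) x x' := (hy.tail hyy).trans (hsymm _ _ hy')
    ext z
    exact ⟨fun h => (hsymm _ _ hxx).trans h, fun h => hxx.trans h⟩
  · intro U hU
    obtain ⟨i, x, hx, rfl⟩ := Set.mem_iUnion.1 hU
    intro y hy z hz
    obtain ⟨-, -, w, hw⟩ := key i x y hx hy
    obtain ⟨-, -, w', hw'⟩ := key i x z hx hz
    refine hD y z (w.reverse.append w') fun l u hu v hv => ?_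
    have aux : ∀ u ∈ (w.reverse.append w').support, blockStart k R i (F l x) - R ≤ F l u ∧
        F l u ≤ blockStart k R i (F l x) + (k + 1) * R := by
      intro u hu
      rw [Walk.mem_support_append_iff, Walk.support_reverse, List.mem_reverse] at hu
      exact hu.elim (hw l u) (hw' l u)
    have h1 := aux u hu
    have h2 := aux v hv
    push_cast
    linarith

theorem HasCover.ediam_le {m : ℕ} {s : ℝ} {D : ℕ} (h : G.HasCover m s D) :
    letI := G.graphEMetric
    ∃ 𝒰 : Set (Set V), ⋃₀ 𝒰 = Set.univ ∧ IsColourDisjoint m s 𝒰 ∧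
      (⨆ U ∈ 𝒰, Metric.ediam U) ≤ D := by
  let _ := G.graphEMetric
  obtain ⟨𝒰, h1, h2, h3⟩ := h
  refine ⟨𝒰, h1, h2, iSup₂_le fun U hU => Metric.ediam_le fun x hx y hy => ?_⟩
  have := h3 U hU x hx y hy
  have h4 := ENat.toENNReal_le.2 this
  rw [ENat.toENNReal_coe] at h4
  exact h4

/-- The cover by the singletons. -/
theorem hasCover_singleton (G : SimpleGraph V) (m : ℕ) {s : ℝ} (hs : s ≤ 1) :
    G.HasCover (m + 1) s 0 := by
  let _ := G.graphEMetric
  refine ⟨{U | ∃ x, U = {x}}, ?_, ⟨fun _ => {U | ∃ x, U = {x}}, ?_, ?_⟩, ?_⟩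
  · exact Set.eq_univ_of_forall fun x => ⟨{x}, ⟨x, rfl⟩, rfl⟩
  · exact (Set.iUnion_const _).symm
  · rintro _ _ ⟨x, rfl⟩ _ ⟨y, rfl⟩ hne
    have hxy : x ≠ y := fun h => hne (by rw [h])
    simp only [Set.mem_singleton_iff, iInf_iInf_eq_left]
    have h1 : (1 : ℕ∞) ≤ G.edist x y := by
      rw [Order.one_le_iff_ne_zero]
      simpa using hxy
    have h2 := ENat.toENNReal_le.2 h1
    refine le_trans ?_ h2
    simpa using hs
  · rintro _ ⟨x, rfl⟩ y rfl z rfl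
    simp

theorem graphAsdim_le {k : ℕ} (h : ∀ R : ℕ, 0 < R → ∃ D, G.HasCover (k + 1) R D) :
    G.graphAsdim ≤ k := by
  refine sInf_le ⟨k, rfl, fun s hs => ?_⟩
  obtain ⟨D, hD⟩ := h ⌈s⌉₊ (Nat.ceil_pos.2 hs)
  let _ := G.graphEMetric
  obtain ⟨𝒰, h1, ⟨𝒱, h2, h2'⟩, h3⟩ := hD.ediam_le
  refine ⟨𝒰, h1, ⟨𝒱, h2, fun i U hU U' hU' hne => ?_⟩, h3.trans_lt (by simp)⟩
  exact (ENNReal.ofReal_le_ofReal (Nat.le_ceil s)).trans (h2' i U hU U' hU' hne)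

/-- Scales `s ≤ 1` are served by singletons. For `s > 1` rounding up costs at most a factor 2, since
`⌈s⌉ < s + 1 < 2 s`, and the extra `1` in `2 * C + 1` makes the bound strict. -/
theorem graphANdim_le {k C : ℕ}
    (h : ∀ R : ℕ, 0 < R → G.HasCover (k + 1) R (C * R)) : G.graphANdim ≤ k := by
  refine sInf_le ⟨k, rfl, 2 * C + 1, fun s hs => ?_⟩
  let _ := G.graphEMetric
  rcases le_or_gt s 1 with h1 | h1
  · obtain ⟨𝒰, h1, h2, h3⟩ := (hasCover_singleton G k h1).ediam_le
    refine ⟨𝒰, h1, h2, h3.trans_lt ?_⟩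
    simp only [Nat.cast_zero, ENNReal.ofReal_pos]
    positivity
  · obtain ⟨𝒰, h1, ⟨𝒱, h2, h2'⟩, h3⟩ := (h ⌈s⌉₊ (Nat.ceil_pos.2 hs)).ediam_le
    refine ⟨𝒰, h1, ⟨𝒱, h2, fun i U hU U' hU' hne => ?_⟩, h3.trans_lt ?_⟩
    · exact (ENNReal.ofReal_le_ofReal (Nat.le_ceil s)).trans (h2' i U hU U' hU' hne)
    · rw [← ENNReal.ofReal_natCast]
      refine (ENNReal.ofReal_lt_ofReal_iff (by positivity)).2 ?_
      have := Nat.ceil_lt_add_one hs.le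
      push_cast
      have hC : (0 : ℝ) ≤ C := by positivity
      nlinarith

end Cover

end SimpleGraph

namespace SimpleGraph

/-! ### The subdivided grid inside the integer lattice -/

section GridCoordinates

variable {n : ℕ}

/-- The position of a vertex of the subdivided grid in the plane, where the cells of the grid have
side length `n + 1`. -/
noncomputable def gridPos : SubdividedGridVertex n → ℤ × ℤ
  | Sum.inl v => ((n + 1) * (v.1 : ℕ), (n + 1) * (v.2 : ℕ))
  | Sum.inr (e, i) =>
      ((n + 1) * ((Quot.out e.1).1.1 : ℕ) +
          (i + 1) * (((Quot.out e.1).2.1 : ℕ) - ((Quot.out e.1).1.1 : ℕ)),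
        (n + 1) * ((Quot.out e.1).1.2 : ℕ) +
          (i + 1) * (((Quot.out e.1).2.2 : ℕ) - ((Quot.out e.1).1.2 : ℕ)))

/-- A unit step along one of the lines whose distance from the axes is a multiple of `N`. -/
def GridStep (N : ℤ) (p q : ℤ × ℤ) : Prop :=
  (p.2 = q.2 ∧ N ∣ p.2 ∧ |p.1 - q.1| = 1) ∨ (p.1 = q.1 ∧ N ∣ p.1 ∧ |p.2 - q.2| = 1)

theorem GridStep.symm {N : ℤ} {p q : ℤ × ℤ} (h : GridStep N p q) : GridStep N q p := by
  rcases h with ⟨h1, h2, h3⟩ | ⟨h1, h2, h3⟩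
  · exact Or.inl ⟨h1.symm, h1 ▸ h2, by rwa [abs_sub_comm]⟩
  · exact Or.inr ⟨h1.symm, h1 ▸ h2, by rwa [abs_sub_comm]⟩

theorem gridPos_subdividePoint (e : (squareGrid n).edgeSet) {i : ℕ} (hi : i ≤ n + 1) :
    gridPos ((squareGrid n).subdividePoint n e i) =
      (((n : ℤ) + 1) * ((Quot.out e.1).1.1 : ℕ) +
          i * (((Quot.out e.1).2.1 : ℕ) - ((Quot.out e.1).1.1 : ℕ) : ℤ),
        ((n : ℤ) + 1) * ((Quot.out e.1).1.2 : ℕ) +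
          i * (((Quot.out e.1).2.2 : ℕ) - ((Quot.out e.1).1.2 : ℕ) : ℤ)) := by
  unfold subdividePoint
  split_ifs with h0 h1
  · subst h0
    simp [gridPos]
  · simp only [gridPos]
    have : ((i - 1 : ℕ) : ℤ) + 1 = i := by omega
    rw [this]
  · obtain rfl : i = n + 1 := by omega
    simp only [gridPos]
    push_cast
    ext <;> simp only <;> ring

theorem squareGrid_adj_iff {u v : Fin (n + 1) × Fin (n + 1)} : (squareGrid n).Adj u v ↔
    (((u.1 : ℕ) + 1 = v.1 ∨ (v.1 : ℕ) + 1 = u.1) ∧ (u.2 : ℕ) = v.2) ∨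
    (((u.2 : ℕ) + 1 = v.2 ∨ (v.2 : ℕ) + 1 = u.2) ∧ (u.1 : ℕ) = v.1) := by
  simp only [squareGrid, boxProd_adj, pathGraph_adj, Fin.ext_iff]

theorem out_mk_eq (e : (squareGrid n).edgeSet) :
    s((Quot.out e.1).1, (Quot.out e.1).2) = e.1 := Quot.out_eq e.1

theorem squareGrid_adj_out (e : (squareGrid n).edgeSet) :
    (squareGrid n).Adj (Quot.out e.1).1 (Quot.out e.1).2 := by
  rw [← mem_edgeSet, out_mk_eq]
  exact e.2

/-- Removes the arbitrary orientation given by `Quot.out`: here `u` is always the left or lower end,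
and an edge oriented the other way has its offset `i + 1` replaced by `n + 1 - (i + 1) = n - i`. -/
theorem gridPos_inr (e : (squareGrid n).edgeSet) (i : Fin n) :
    ∃ u v : Fin (n + 1) × Fin (n + 1), ∃ t : ℕ, e.1 = s(u, v) ∧ 0 < t ∧ t < n + 1 ∧
      (((u.1 : ℕ) + 1 = v.1 ∧ (u.2 : ℕ) = v.2 ∧
          gridPos (Sum.inr (e, i)) = (((n : ℤ) + 1) * (u.1 : ℕ) + t, ((n : ℤ) + 1) * (u.2 : ℕ))) ∨
        ((u.2 : ℕ) + 1 = v.2 ∧ (u.1 : ℕ) = v.1 ∧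
          gridPos (Sum.inr (e, i)) = (((n : ℤ) + 1) * (u.1 : ℕ), ((n : ℤ) + 1) * (u.2 : ℕ) + t))) := by
  have hi := i.2
  have hs := out_mk_eq e
  simp only [gridPos]
  rcases squareGrid_adj_iff.1 (squareGrid_adj_out e) with ⟨h1 | h1, h2⟩ | ⟨h1 | h1, h2⟩
  · refine ⟨_, _, i + 1, hs.symm, by omega, by omega, Or.inl ⟨h1, h2, ?_⟩⟩
    rw [← h1, h2]; push_cast; ext <;> simp
  · refine ⟨_, _, n - i, hs.symm.trans Sym2.eq_swap, by omega, by omega,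
      Or.inl ⟨h1, h2.symm, ?_⟩⟩
    rw [← h1, h2, Nat.cast_sub hi.le]; push_cast; ext <;> simp; ring
  · refine ⟨_, _, i + 1, hs.symm, by omega, by omega, Or.inr ⟨h1, h2, ?_⟩⟩
    rw [← h1, h2]; push_cast; ext <;> simp
  · refine ⟨_, _, n - i, hs.symm.trans Sym2.eq_swap, by omega, by omega,
      Or.inr ⟨h1, h2.symm, ?_⟩⟩
    rw [← h1, h2, Nat.cast_sub hi.le]; push_cast; ext <;> simp; ring

theorem mul_add_inj {N a b : ℤ} {s t : ℤ} (hs : 0 ≤ s) (hsN : s < N) (ht : 0 ≤ t)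
    (htN : t < N) (h : N * a + s = N * b + t) : a = b ∧ s = t := by
  have h1 := congrArg (· / N) h
  have h2 := congrArg (· % N) h
  have hN : N ≠ 0 := by omega
  simp only [Int.mul_add_ediv_left _ _ hN, Int.mul_add_emod_self_left, Int.ediv_eq_zero_of_lt hs hsN,
    Int.ediv_eq_zero_of_lt ht htN, Int.emod_eq_of_lt hs hsN, Int.emod_eq_of_lt ht htN] at h1 h2
  exact ⟨by linarith, h2⟩

theorem mul_add_ne {N a b : ℤ} {s : ℤ} (hs : 0 < s) (hsN : s < N) : N * a + s ≠ N * b := by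
  intro h
  have := (mul_add_inj hs.le hsN le_rfl (hs.trans hsN) (h.trans (add_zero _).symm)).2
  omega

/-- An inner vertex has exactly one coordinate that is not a multiple of `n + 1`. This separates it
from the vertices of the grid and tells horizontal edges from vertical ones; division with remainder
then recovers the edge and the place on it. -/
theorem gridPos_injective : Function.Injective (gridPos (n := n)) := by
  have hN : (0 : ℤ) < n + 1 := by positivity
  have aux : ∀ v e i, gridPos (n := n) (Sum.inl v) ≠ gridPos (n := n) (Sum.inr (e, i)) := by
    intro v e i h
    obtain ⟨u, w, t, -, h0, h1, ⟨-, -, h2⟩ | ⟨-, -, h2⟩⟩ := gridPos_inr e i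
    · rw [h2] at h
      exact mul_add_ne (by omega) (by omega) (congrArg Prod.fst h).symm
    · rw [h2] at h
      exact mul_add_ne (by omega) (by omega) (congrArg Prod.snd h).symm
  rintro (v | ⟨e, i⟩) (v' | ⟨e', i'⟩) h
  · simp only [gridPos, Prod.mk.injEq, mul_eq_mul_left_iff, hN.ne', or_false, Nat.cast_inj] at h
    exact congrArg _ (Prod.ext (Fin.ext h.1) (Fin.ext h.2))
  · exact absurd h (aux _ _ _)
  · exact absurd h.symm (aux _ _ _)
  · obtain rfl : e = e' := by
      obtain ⟨u, v, t, he, h0, h1, hh⟩ := gridPos_inr e i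
      obtain ⟨u', v', t', he', h0', h1', hh'⟩ := gridPos_inr e' i'
      rcases hh with ⟨a1, a2, a3⟩ | ⟨a1, a2, a3⟩ <;> rcases hh' with ⟨b1, b2, b3⟩ | ⟨b1, b2, b3⟩ <;>
        rw [a3, b3, Prod.mk.injEq] at h
      · have h3 := mul_add_inj (by omega) (by omega) (by omega) (by omega) h.1
        have h4 := mul_left_cancel₀ hN.ne' h.2
        refine Subtype.ext ?_
        rw [he, he']
        congr 2 <;> refine Prod.ext (Fin.ext ?_) (Fin.ext ?_) <;> omega
      · exact absurd h.1 (mul_add_ne (by omega) (by omega))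
      · exact absurd h.1.symm (mul_add_ne (by omega) (by omega))
      · have h3 := mul_add_inj (by omega) (by omega) (by omega) (by omega) h.2
        have h4 := mul_left_cancel₀ hN.ne' h.1
        refine Subtype.ext ?_
        rw [he, he']
        congr 2 <;> refine Prod.ext (Fin.ext ?_) (Fin.ext ?_) <;> omega
    have : i = i' := by
      have h3 := squareGrid_adj_iff.1 (squareGrid_adj_out e)
      simp only [gridPos, Prod.mk.injEq, add_right_inj] at h
      rcases h3 with ⟨h1 | h1, h2⟩ | ⟨h1 | h1, h2⟩
      · have := h.1; rw [← h1] at this; simp at this; omega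
      · have := h.1; rw [← h1] at this; simp at this; omega
      · have := h.2; rw [← h1] at this; simp at this; omega
      · have := h.2; rw [← h1] at this; simp at this; omega
    rw [this]

theorem gridPos_bounds (v : SubdividedGridVertex n) :
    0 ≤ (gridPos v).1 ∧ (gridPos v).1 ≤ n * (n + 1) ∧ 0 ≤ (gridPos v).2 ∧
      (gridPos v).2 ≤ n * (n + 1) ∧ ((n + 1 : ℤ) ∣ (gridPos v).1 ∨ (n + 1 : ℤ) ∣ (gridPos v).2) := by
  have aux : ∀ x : ℕ, x ≤ n → ((n : ℤ) + 1) * x ≤ n * (n + 1) := fun x hx => by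
    have : (x : ℤ) ≤ n := by exact_mod_cast hx
    nlinarith
  have aux' : ∀ x t : ℕ, x < n → t < n + 1 → ((n : ℤ) + 1) * x + t ≤ n * (n + 1) :=
    fun x t hx ht => by
    have : (x : ℤ) + 1 ≤ n := by exact_mod_cast hx
    have : (t : ℤ) ≤ n + 1 := by exact_mod_cast ht.le
    nlinarith
  rcases v with v | ⟨e, i⟩
  · refine ⟨?_, aux _ (by omega), ?_, aux _ (by omega), Or.inl ⟨_, rfl⟩⟩ <;> simp only [gridPos] <;>
      positivity
  · obtain ⟨u, v, t, he, h0, h1, ⟨h2, h3, h4⟩ | ⟨h2, h3, h4⟩⟩ := gridPos_inr e i <;> rw [h4]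
    · exact ⟨by positivity, aux' _ _ (by omega) h1, by positivity, aux _ (by omega),
        Or.inr ⟨_, rfl⟩⟩
    · exact ⟨by positivity, aux _ (by omega), by positivity, aux' _ _ (by omega) h1,
        Or.inl ⟨_, rfl⟩⟩

theorem gridStep_of_adj {u v : SubdividedGridVertex n} (h : (subdividedGrid n).Adj u v) :
    GridStep (n + 1) (gridPos u) (gridPos v) := by
  have aux : ∀ e : (squareGrid n).edgeSet, ∀ i ≤ n,
      GridStep (n + 1) (gridPos ((squareGrid n).subdividePoint n e i))
        (gridPos ((squareGrid n).subdividePoint n e (i + 1))) := by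
    intro e i hi
    rw [gridPos_subdividePoint e (show i ≤ n + 1 by omega),
      gridPos_subdividePoint e (show i + 1 ≤ n + 1 by omega)]
    rcases squareGrid_adj_iff.1 (squareGrid_adj_out e) with ⟨h1 | h1, h2⟩ | ⟨h1 | h1, h2⟩
    · left; rw [← h1, h2]; simp
    · left; rw [← h1, h2]; simp
    · right; rw [← h1, h2]; simp
    · right; rw [← h1, h2]; simp
  rw [subdividedGrid, subdivide, fromRel_adj] at h
  rcases h with ⟨-, ⟨e, i, hi, rfl, rfl⟩ | ⟨e, i, hi, rfl, rfl⟩⟩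
  · exact aux e i hi
  · exact (aux e i hi).symm

/-- If the chosen orientation of the edge is the opposite one, the step from `t` to `t + 1` is step
number `n - t` run backwards. -/
theorem exists_adj_gridPos {u v : Fin (n + 1) × Fin (n + 1)} (huv : (squareGrid n).Adj u v) {t : ℕ}
    (ht : t ≤ n) : ∃ x y, (subdividedGrid n).Adj x y ∧
      gridPos x = (((n : ℤ) + 1) * (u.1 : ℕ) + t * ((v.1 : ℕ) - (u.1 : ℕ) : ℤ),
        ((n : ℤ) + 1) * (u.2 : ℕ) + t * ((v.2 : ℕ) - (u.2 : ℕ) : ℤ)) ∧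
      gridPos y = (((n : ℤ) + 1) * (u.1 : ℕ) + (t + 1) * ((v.1 : ℕ) - (u.1 : ℕ) : ℤ),
        ((n : ℤ) + 1) * (u.2 : ℕ) + (t + 1) * ((v.2 : ℕ) - (u.2 : ℕ) : ℤ)) := by
  let e : (squareGrid n).edgeSet := ⟨s(u, v), huv⟩
  have hadj : ∀ i ≤ n, (subdividedGrid n).Adj ((squareGrid n).subdividePoint n e i)
      ((squareGrid n).subdividePoint n e (i + 1)) := by
    intro i hi
    rw [subdividedGrid, subdivide, fromRel_adj]
    refine ⟨fun h => ?_, Or.inl ⟨e, i, hi, rfl, rfl⟩⟩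
    have h3 := congrArg gridPos h
    rw [gridPos_subdividePoint e (show i ≤ n + 1 by omega),
      gridPos_subdividePoint e (show i + 1 ≤ n + 1 by omega)] at h3
    simp only [Prod.mk.injEq, add_right_inj, Nat.cast_add, Nat.cast_one, add_mul, one_mul,
      left_eq_add] at h3
    rcases squareGrid_adj_iff.1 (squareGrid_adj_out e) with ⟨h1 | h1, h2⟩ | ⟨h1 | h1, h2⟩ <;> omega
  have hout : s((Quot.out e.1).1, (Quot.out e.1).2) = s(u, v) := out_mk_eq e
  rcases Sym2.eq_iff.1 hout with ⟨h1, h2⟩ | ⟨h1, h2⟩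
  · refine ⟨_, _, hadj t ht, ?_, ?_⟩
    · rw [gridPos_subdividePoint e (show t ≤ n + 1 by omega), h1, h2]
    · rw [gridPos_subdividePoint e (show t + 1 ≤ n + 1 by omega), h1, h2]
      push_cast
      rfl
  · refine ⟨_, _, (hadj (n - t) (by omega)).symm, ?_, ?_⟩
    · rw [gridPos_subdividePoint e (show n - t + 1 ≤ n + 1 by omega), h1, h2]
      push_cast [Nat.cast_sub ht]
      ext <;> simp only <;> ring
    · rw [gridPos_subdividePoint e (show n - t ≤ n + 1 by omega), h1, h2]
      push_cast [Nat.cast_sub ht]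
      ext <;> simp only <;> ring

theorem exists_gridPos_eq {X Y : ℤ} (hX : 0 ≤ X) (hX' : X ≤ n * (n + 1)) (hY : 0 ≤ Y)
    (hY' : Y ≤ n * (n + 1)) (h : (n + 1 : ℤ) ∣ X ∨ (n + 1 : ℤ) ∣ Y) :
    ∃ v : SubdividedGridVertex n, gridPos v = (X, Y) := by
  have hN : (0 : ℤ) < n + 1 := by positivity
  have divb : ∀ Z : ℤ, 0 ≤ Z → Z ≤ n * (n + 1) → ∃ k t : ℕ, Z = (n + 1) * k + t ∧ t ≤ n ∧ k ≤ n ∧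
      (k = n → t = 0) := by
    intro Z h0 h1
    refine ⟨(Z / (n + 1)).toNat, (Z % (n + 1)).toNat, ?_⟩
    have a1 := Int.mul_ediv_add_emod Z (n + 1)
    have a2 := Int.emod_nonneg Z hN.ne'
    have a3 := Int.emod_lt_of_pos Z hN
    have a4 : 0 ≤ Z / (n + 1) := Int.ediv_nonneg h0 hN.le
    have a5 : Z / (n + 1) ≤ n := by
      have := Int.ediv_le_ediv hN h1
      rwa [Int.mul_ediv_cancel (n : ℤ) hN.ne'] at this
    rw [Int.toNat_of_nonneg a4, Int.toNat_of_nonneg a2]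
    refine ⟨a1.symm, by omega, by omega, fun h => ?_⟩
    have : Z / (n + 1) = n := by omega
    rw [this] at a1
    have : Z % (n + 1) = 0 := by nlinarith
    omega
  have cross : ∀ k l : ℕ, k ≤ n → l ≤ n → ∃ v : SubdividedGridVertex n,
      gridPos v = (((n : ℤ) + 1) * k, ((n : ℤ) + 1) * l) := fun k l hk hl =>
    ⟨Sum.inl (⟨k, by omega⟩, ⟨l, by omega⟩), rfl⟩
  have mulb : ∀ Z : ℤ, 0 ≤ Z → Z ≤ n * (n + 1) → (n + 1 : ℤ) ∣ Z → ∃ k : ℕ, k ≤ n ∧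
      Z = (n + 1) * k := by
    rintro Z h0 h1 ⟨c, rfl⟩
    have c0 : 0 ≤ c := by by_contra! hc; nlinarith
    have c1 : c ≤ n := by by_contra! hc; nlinarith
    exact ⟨c.toNat, by omega, by rw [Int.toNat_of_nonneg c0]⟩
  rcases h with h | h
  · obtain ⟨k, hk, rfl⟩ := mulb X hX hX' h
    obtain ⟨l, t, rfl, ht, hl, hlt⟩ := divb Y hY hY'
    rcases hl.lt_or_eq with hl' | rfl
    · obtain ⟨x, y, -, hx, -⟩ := exists_adj_gridPos (n := n)
        (u := (⟨k, by omega⟩, ⟨l, by omega⟩)) (v := (⟨k, by omega⟩, ⟨l + 1, by omega⟩))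
        (squareGrid_adj_iff.2 (by simp)) ht
      refine ⟨x, ?_⟩
      rw [hx]; simp
    · obtain ⟨v, hv⟩ := cross k l hk le_rfl
      exact ⟨v, by rw [hv, hlt rfl]; simp⟩
  · obtain ⟨k, hk, rfl⟩ := mulb Y hY hY' h
    obtain ⟨l, t, rfl, ht, hl, hlt⟩ := divb X hX hX'
    rcases hl.lt_or_eq with hl' | rfl
    · obtain ⟨x, y, -, hx, -⟩ := exists_adj_gridPos (n := n)
        (u := (⟨l, by omega⟩, ⟨k, by omega⟩)) (v := (⟨l + 1, by omega⟩, ⟨k, by omega⟩))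
        (squareGrid_adj_iff.2 (by simp)) ht
      refine ⟨x, ?_⟩
      rw [hx]; simp
    · obtain ⟨v, hv⟩ := cross l k le_rfl hk
      exact ⟨v, by rw [hv, hlt rfl]; simp⟩

/-- With `gridStep_of_adj` and `exists_gridPos_eq` this identifies the subdivided grid with the
lattice points of a square that lie on lines spaced `n + 1` apart, joined by unit steps along these
lines. Later arguments use only this picture. -/
theorem adj_of_gridStep {u v : SubdividedGridVertex n}
    (h : GridStep (n + 1) (gridPos u) (gridPos v)) : (subdividedGrid n).Adj u v := by
  have hN : (0 : ℤ) < n + 1 := by positivity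
  wlog hle : (gridPos u).1 ≤ (gridPos v).1 ∧ (gridPos u).2 ≤ (gridPos v).2 generalizing u v
  · refine (this h.symm ?_).symm
    rcases h with ⟨h1, h2, h3⟩ | ⟨h1, h2, h3⟩ <;> rcases eq_or_eq_neg_of_abs_eq h3 with h4 | h4 <;>
      constructor <;> omega
  obtain ⟨a1, a2, a3, a4, -⟩ := gridPos_bounds u
  obtain ⟨b1, b2, b3, b4, -⟩ := gridPos_bounds v
  have divb : ∀ Z : ℤ, 0 ≤ Z → Z + 1 ≤ n * (n + 1) → ∃ k t : ℕ, Z = (n + 1) * k + t ∧ t ≤ n ∧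
      k < n := by
    intro Z h0 h1
    have a1 := Int.mul_ediv_add_emod Z (n + 1)
    have a2 := Int.emod_nonneg Z hN.ne'
    have a3 := Int.emod_lt_of_pos Z hN
    have a4 : 0 ≤ Z / (n + 1) := Int.ediv_nonneg h0 hN.le
    have a5 : Z / (n + 1) < n := Int.ediv_lt_of_lt_mul hN (by omega)
    refine ⟨(Z / (n + 1)).toNat, (Z % (n + 1)).toNat, ?_, by omega, by omega⟩
    rw [Int.toNat_of_nonneg a4, Int.toNat_of_nonneg a2, a1]
  have mulb : ∀ Z : ℤ, 0 ≤ Z → Z ≤ n * (n + 1) → (n + 1 : ℤ) ∣ Z → ∃ k : ℕ, k ≤ n ∧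
      Z = (n + 1) * k := by
    rintro Z h0 h1 ⟨c, rfl⟩
    have c0 : 0 ≤ c := by by_contra! hc; nlinarith
    have c1 : c ≤ n := by by_contra! hc; nlinarith
    exact ⟨c.toNat, by omega, by rw [Int.toNat_of_nonneg c0]⟩
  rcases h with ⟨h1, h2, h3⟩ | ⟨h1, h2, h3⟩
  · have h4 : (gridPos v).1 = (gridPos u).1 + 1 := by
      rcases eq_or_eq_neg_of_abs_eq h3 with h4 | h4 <;> omega
    obtain ⟨l, t, hl, ht, hl'⟩ := divb _ a1 (by omega)
    obtain ⟨k, hk, hk'⟩ := mulb _ a3 a4 h2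
    obtain ⟨x, y, hxy, hx, hy⟩ := exists_adj_gridPos (n := n)
        (u := (⟨l, by omega⟩, ⟨k, by omega⟩)) (v := (⟨l + 1, by omega⟩, ⟨k, by omega⟩))
        (squareGrid_adj_iff.2 (by simp)) ht
    convert hxy using 1
    · apply gridPos_injective; rw [hx]; ext <;> simp <;> linarith
    · apply gridPos_injective; rw [hy]; ext <;> simp <;> linarith
  · have h4 : (gridPos v).2 = (gridPos u).2 + 1 := by
      rcases eq_or_eq_neg_of_abs_eq h3 with h4 | h4 <;> omega
    obtain ⟨l, t, hl, ht, hl'⟩ := divb _ a3 (by omega)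
    obtain ⟨k, hk, hk'⟩ := mulb _ a1 a2 h2
    obtain ⟨x, y, hxy, hx, hy⟩ := exists_adj_gridPos (n := n)
        (u := (⟨k, by omega⟩, ⟨l, by omega⟩)) (v := (⟨k, by omega⟩, ⟨l + 1, by omega⟩))
        (squareGrid_adj_iff.2 (by simp)) ht
    convert hxy using 1
    · apply gridPos_injective; rw [hx]; ext <;> simp <;> linarith
    · apply gridPos_injective; rw [hy]; ext <;> simp <;> linarith

end GridCoordinates

end SimpleGraph

namespace SimpleGraph

/-! ### Walks of bounded length, and a criterion for positive asymptotic dimension -/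

section Near

variable {V : Type*} {G : SimpleGraph V}

/-- There is a walk of length at most `B` from `x` to `y`. -/
def Near (G : SimpleGraph V) (x y : V) (B : ℤ) : Prop := ∃ w : G.Walk x y, (w.length : ℤ) ≤ B

theorem Near.refl (x : V) : G.Near x x 0 := ⟨Walk.nil, by simp⟩

theorem Near.symm {x y : V} {B : ℤ} (h : G.Near x y B) : G.Near y x B := by
  obtain ⟨w, hw⟩ := h
  exact ⟨w.reverse, by simpa using hw⟩

theorem Near.trans {x y z : V} {B C : ℤ} (h : G.Near x y B) (h' : G.Near y z C) :
    G.Near x z (B + C) := by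
  obtain ⟨w, hw⟩ := h
  obtain ⟨w', hw'⟩ := h'
  exact ⟨w.append w', by rw [Walk.length_append]; push_cast; linarith⟩

theorem Near.mono {x y : V} {B C : ℤ} (h : G.Near x y B) (hBC : B ≤ C) : G.Near x y C := by
  obtain ⟨w, hw⟩ := h
  exact ⟨w, hw.trans hBC⟩

theorem Near.of_adj {x y : V} (h : G.Adj x y) : G.Near x y 1 := ⟨h.toWalk, by simp⟩

theorem Near.edist_le {x y : V} {B : ℕ} (h : G.Near x y B) : G.edist x y ≤ B := by
  obtain ⟨w, hw⟩ := h
  refine (Walk.edist_le w).trans ?_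
  exact_mod_cast hw

theorem Walk.induction_on_support {S Q : V → Prop} {x y : V} (w : G.Walk x y)
    (hS : ∀ z ∈ w.support, S z) (hstep : ∀ u v, G.Adj u v → S v → Q u → Q v) (hx : Q x) : Q y := by
  induction w with
  | nil => exact hx
  | cons h w ih =>
    refine ih (fun z hz => hS z (by simp [hz])) (hstep _ _ h (hS _ (by simp)) hx)

theorem Walk.exists_walk_of_mem_support {x y u v : V} (w : G.Walk x y) (hu : u ∈ w.support)
    (hv : v ∈ w.support) : ∃ w' : G.Walk u v, ∀ z ∈ w'.support, z ∈ w.support := by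
  classical
  refine ⟨(w.takeUntil u hu).reverse.append (w.takeUntil v hv), fun z hz => ?_⟩
  rw [Walk.mem_support_append_iff, Walk.support_reverse, List.mem_reverse] at hz
  exact hz.elim (fun h => w.support_takeUntil_subset_support hu h)
    fun h => w.support_takeUntil_subset_support hv h

/-- With one colour at scale `2` no edge can leave a member of the cover, so the member that
contains `x` contains its whole component. There `F` is unbounded, hence so is the diameter. -/
theorem one_le_graphAsdim {F : V → ℤ} (hF : G.IsLipschitz F) (x : V)
    (h : ∀ B : ℕ, ∃ y, G.Reachable x y ∧ (B : ℤ) ≤ F y) : 1 ≤ G.graphAsdim := by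
  let _ := G.graphEMetric
  refine le_sInf ?_
  rintro _ ⟨n, rfl, hn⟩
  rcases Nat.eq_zero_or_pos n with rfl | hpos
  swap
  · exact_mod_cast hpos
  exfalso
  obtain ⟨𝒰, hcov, ⟨𝒱, h𝒱, hdis⟩, hdiam⟩ := hn 2 two_pos
  have hmem : ∀ U ∈ 𝒰, U ∈ 𝒱 0 := by
    intro U hU
    rw [h𝒱] at hU
    obtain ⟨i, hi⟩ := Set.mem_iUnion.1 hU
    rwa [Subsingleton.elim (α := Fin 1) 0 i]
  have hx : x ∈ ⋃₀ 𝒰 := by rw [hcov]; trivial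
  obtain ⟨U, hU, hxU⟩ := hx
  have hall : ∀ y, G.Reachable x y → y ∈ U := by
    rintro y ⟨w⟩
    refine w.induction_on_support (S := fun _ => True) (Q := (· ∈ U)) (by simp) ?_ hxU
    intro u v huv _ hu
    have hv : v ∈ ⋃₀ 𝒰 := by rw [hcov]; trivial
    obtain ⟨U', hU', hvU'⟩ := hv
    by_contra hvU
    have h1 := hdis 0 U (hmem U hU) U' (hmem U' hU') (fun h => hvU (h ▸ hvU'))
    have h2 := h1.trans ((iInf₂_le u hu).trans (iInf₂_le v hvU'))
    have h3 : (G.edist u v : ℝ≥0∞) = 1 := by rw [edist_eq_one_iff_adj.2 huv]; simp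
    have h4 : ENNReal.ofReal 2 ≤ 1 := h2.trans h3.le
    rw [ENNReal.ofReal_le_one] at h4
    norm_num at h4
  have hfin : Metric.ediam U < ⊤ := (le_iSup₂ (f := fun U _ => Metric.ediam U) U hU).trans_lt hdiam
  obtain ⟨B, hB⟩ := ENNReal.exists_nat_gt hfin.ne
  obtain ⟨y, hxy, hy⟩ := h (B + (F x).natAbs)
  have h1 : (G.edist x y : ℝ≥0∞) < B := (Metric.edist_le_ediam_of_mem hxU (hall y hxy)).trans_lt hB
  have h2 : G.edist x y < (B : ℕ∞) := by rw [← ENat.toENNReal_lt]; simpa using h1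
  obtain ⟨w, hw⟩ := hxy.exists_walk_length_eq_edist
  rw [← hw] at h2
  have h3 : w.length < B := by exact_mod_cast h2
  have h4 := hF.abs_sub_le_length w
  push_cast at hy
  rw [abs_le] at h4
  have := le_abs_self (F x)
  omega

end Near

/-! ### Height, abscissa, distances and cut vertices in the chain -/

section GridChain

variable (a : ∀ j : ℕ, SubdividedGridVertex (j + 1)) (b : ∀ j : ℕ, SubdividedGridVertex (j + 2))

/-- The vertices of the chain of subdivided grids. -/
abbrev GridChainVertex : Type := (Σ j : ℕ, SubdividedGridVertex (j + 1)) ⊕ (Σ j : ℕ, Fin j)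

/-- The vertex by which the chain enters the `j`-th grid (an arbitrary one for `j = 0`). -/
def entry : ∀ j : ℕ, SubdividedGridVertex (j + 1)
  | 0 => Sum.inl (0, 0)
  | j + 1 => b j

/-- A vertex of the `j`-th grid as a vertex of the chain. -/
abbrev inGrid (j : ℕ) (z : SubdividedGridVertex (j + 1)) : GridChainVertex := Sum.inl ⟨j, z⟩

/-- The vertices of the link from the `j`-th grid to the next one. -/
noncomputable abbrev gridLink (j i : ℕ) : GridChainVertex :=
  linkPoint (W := fun j => SubdividedGridVertex (j + 1)) (fun j => j) a b j i

theorem gridLink_zero (j : ℕ) : gridLink a b j 0 = inGrid j (a j) := by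
  simp [linkPoint]

theorem gridLink_succ {j i : ℕ} (h : i < j) : gridLink a b j (i + 1) = Sum.inr ⟨j, ⟨i, h⟩⟩ := by
  simp [linkPoint, h]

theorem gridLink_last (j : ℕ) : gridLink a b j (j + 1) = inGrid (j + 1) (entry b (j + 1)) := by
  simp [linkPoint, entry]

theorem gridLink_cases {j i : ℕ} (h : i ≤ j + 1) :
    (i = 0 ∧ gridLink a b j i = inGrid j (a j)) ∨
    (∃ h : i - 1 < j, 0 < i ∧ gridLink a b j i = Sum.inr ⟨j, ⟨i - 1, h⟩⟩) ∨
    (i = j + 1 ∧ gridLink a b j i = inGrid (j + 1) (entry b (j + 1))) := by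
  rcases Nat.eq_zero_or_pos i with rfl | hi
  · exact Or.inl ⟨rfl, gridLink_zero a b j⟩
  · rcases h.eq_or_lt with rfl | hlt
    · exact Or.inr (Or.inr ⟨rfl, gridLink_last a b j⟩)
    · have h' : i - 1 < j := by omega
      refine Or.inr (Or.inl ⟨h', hi, ?_⟩)
      rw [← gridLink_succ a b h', Nat.sub_add_cancel hi]

theorem gridChain_adj {x y : GridChainVertex} : (gridChain a b).Adj x y ↔ x ≠ y ∧
    ((∃ j u v, (subdividedGrid (j + 1)).Adj u v ∧ x = inGrid j u ∧ y = inGrid j v) ∨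
      ∃ j, ∃ i ≤ j, (x = gridLink a b j i ∧ y = gridLink a b j (i + 1)) ∨
        (y = gridLink a b j i ∧ x = gridLink a b j (i + 1))) := by
  rw [gridChain, chain, fromRel_adj]
  refine and_congr_right fun _ => ⟨?_, ?_⟩
  · rintro ((⟨j, u, v, h, h1, h2⟩ | ⟨j, i, hi, h1, h2⟩) | (⟨j, u, v, h, h1, h2⟩ | ⟨j, i, hi, h1, h2⟩))
    · exact Or.inl ⟨j, u, v, h, h1, h2⟩
    · exact Or.inr ⟨j, i, hi, Or.inl ⟨h1, h2⟩⟩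
    · exact Or.inl ⟨j, v, u, h.symm, h2, h1⟩
    · exact Or.inr ⟨j, i, hi, Or.inr ⟨h1, h2⟩⟩
  · rintro (⟨j, u, v, h, h1, h2⟩ | ⟨j, i, hi, ⟨h1, h2⟩ | ⟨h1, h2⟩⟩)
    · exact Or.inl (Or.inl ⟨j, u, v, h, h1, h2⟩)
    · exact Or.inl (Or.inr ⟨j, i, hi, h1, h2⟩)
    · exact Or.inr (Or.inr ⟨j, i, hi, h1, h2⟩)

/-- `1` or `-1`, so that `direction x * x = |x|`. -/
def direction (x : ℤ) : ℤ := if 0 ≤ x then 1 else -1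

theorem direction_mul (x : ℤ) : direction x * x = |x| := by
  unfold direction
  split_ifs with h
  · rw [abs_of_nonneg h, one_mul]
  · rw [abs_of_neg (by omega)]; ring

theorem direction_eq (x : ℤ) : direction x = 1 ∨ direction x = -1 := by
  unfold direction
  split_ifs <;> simp

/-- The displacement in the `j`-th grid from the entry to the exit of the chain. -/
noncomputable def displacement (j : ℕ) : ℤ × ℤ := gridPos (a j) - gridPos (entry b j)

/-- The height of the entry to the `j`-th grid. -/
noncomputable def baseHeight : ℕ → ℤ
  | 0 => 0
  | j + 1 => baseHeight j + |(displacement a b j).1| + |(displacement a b j).2| + (j + 1)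

/-- The height of the points of the plane that contains the `j`-th grid. -/
noncomputable def gridHeight (j : ℕ) (p : ℤ × ℤ) : ℤ :=
  baseHeight a b j + direction (displacement a b j).1 * (p.1 - (gridPos (entry b j)).1) +
    direction (displacement a b j).2 * (p.2 - (gridPos (entry b j)).2)

/-- A function on the chain that increases along the spine. -/
noncomputable def height : GridChainVertex → ℤ
  | Sum.inl ⟨j, z⟩ => gridHeight a b j (gridPos z)
  | Sum.inr ⟨j, i⟩ => gridHeight a b j (gridPos (a j)) + (i + 1 : ℕ)

/-- The abscissa of the entry to the `j`-th grid. -/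
noncomputable def baseAbscissa : ℕ → ℤ
  | 0 => 0
  | j + 1 => baseAbscissa j + (displacement a b j).1

/-- The abscissa in the grids, constant on the links. -/
noncomputable def abscissa : GridChainVertex → ℤ
  | Sum.inl ⟨j, z⟩ => baseAbscissa a b j + ((gridPos z).1 - (gridPos (entry b j)).1)
  | Sum.inr ⟨j, _⟩ => baseAbscissa a b (j + 1)

theorem gridHeight_entry (j : ℕ) : gridHeight a b j (gridPos (entry b j)) = baseHeight a b j := by
  simp [gridHeight]

/-- This is the purpose of the signs in `gridHeight`: the gain from entry to exit is the whole
ℓ¹-distance, so no part of the spine is invisible to `height`. -/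
theorem gridHeight_exit (j : ℕ) : gridHeight a b j (gridPos (a j)) =
    baseHeight a b j + |(displacement a b j).1| + |(displacement a b j).2| := by
  rw [← direction_mul, ← direction_mul]
  rfl

/-- The formula persists at the far end because `baseHeight` adds the length `j + 1` of the link to
the height of the exit. -/
theorem height_gridLink {j i : ℕ} (h : i ≤ j + 1) :
    height a b (gridLink a b j i) = gridHeight a b j (gridPos (a j)) + i := by
  rcases gridLink_cases a b h with ⟨rfl, h1⟩ | ⟨h1, h2, h3⟩ | ⟨rfl, h1⟩
  · rw [h1]; simp [height]
  · rw [h3]; simp only [height]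
    rw [Nat.sub_add_cancel h2]
  · rw [h1]; simp only [height]
    rw [gridHeight_entry, gridHeight_exit, baseHeight]
    push_cast; ring

theorem abscissa_gridLink {j i : ℕ} (h : i ≤ j + 1) :
    abscissa a b (gridLink a b j i) = baseAbscissa a b (j + 1) := by
  rcases gridLink_cases a b h with ⟨rfl, h1⟩ | ⟨h1, h2, h3⟩ | ⟨rfl, h1⟩
  · rw [h1]; rfl
  · rw [h3]; rfl
  · rw [h1]; simp [abscissa]

theorem gridLink_adj {j i : ℕ} (h : i ≤ j) :
    (gridChain a b).Adj (gridLink a b j i) (gridLink a b j (i + 1)) := by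
  refine (gridChain_adj a b).2 ⟨fun he => ?_, Or.inr ⟨j, i, h, Or.inl ⟨rfl, rfl⟩⟩⟩
  have := congrArg (height a b) he
  rw [height_gridLink a b (by omega), height_gridLink a b (by omega)] at this
  push_cast at this
  omega

theorem inGrid_adj {j : ℕ} {u v : SubdividedGridVertex (j + 1)}
    (h : (subdividedGrid (j + 1)).Adj u v) : (gridChain a b).Adj (inGrid j u) (inGrid j v) :=
  (gridChain_adj a b).2 ⟨fun he => h.ne (by simpa using he), Or.inl ⟨j, u, v, h, rfl, rfl⟩⟩

theorem abs_gridHeight_sub_le (j : ℕ) (p q : ℤ × ℤ) :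
    |gridHeight a b j p - gridHeight a b j q| ≤ |p.1 - q.1| + |p.2 - q.2| := by
  have e : gridHeight a b j p - gridHeight a b j q = direction (displacement a b j).1 * (p.1 - q.1) +
    direction (displacement a b j).2 * (p.2 - q.2) := by unfold gridHeight; ring
  rw [e]
  refine (abs_add_le _ _).trans ?_
  rw [abs_mul, abs_mul]
  rcases direction_eq (displacement a b j).1 with h | h <;>
    rcases direction_eq (displacement a b j).2 with h' | h' <;> simp [h, h']

theorem gridStep_dist {N : ℤ} {p q : ℤ × ℤ} (h : GridStep N p q) :
    |p.1 - q.1| + |p.2 - q.2| = 1 := by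
  rcases h with ⟨h1, -, h2⟩ | ⟨h1, -, h2⟩ <;> rw [h1, h2] <;> simp

theorem height_isLipschitz : (gridChain a b).IsLipschitz (height a b) := by
  intro x y h
  rcases ((gridChain_adj a b).1 h).2 with ⟨j, u, v, huv, rfl, rfl⟩ |
    ⟨j, i, hi, ⟨rfl, rfl⟩ | ⟨rfl, rfl⟩⟩
  · exact (abs_gridHeight_sub_le a b j _ _).trans (gridStep_dist (gridStep_of_adj huv)).le
  · rw [height_gridLink a b (by omega), height_gridLink a b (by omega)]; simp
  · rw [height_gridLink a b (by omega), height_gridLink a b (by omega)]; simp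

theorem abscissa_isLipschitz : (gridChain a b).IsLipschitz (abscissa a b) := by
  intro x y h
  rcases ((gridChain_adj a b).1 h).2 with ⟨j, u, v, huv, rfl, rfl⟩ |
    ⟨j, i, hi, ⟨rfl, rfl⟩ | ⟨rfl, rfl⟩⟩
  · have h1 := gridStep_dist (gridStep_of_adj huv)
    have h2 := abs_nonneg ((gridPos u).2 - (gridPos v).2)
    simp only [abscissa, add_sub_add_left_eq_sub, sub_sub_sub_cancel_right]
    omega
  · rw [abscissa_gridLink a b (by omega), abscissa_gridLink a b (by omega)]; simp
  · rw [abscissa_gridLink a b (by omega), abscissa_gridLink a b (by omega)]; simp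

section Distances

theorem near_of_row {j : ℕ} {u v : SubdividedGridVertex (j + 1)}
    (h : (gridPos u).2 = (gridPos v).2) (hd : (j + 2 : ℤ) ∣ (gridPos u).2) :
    (gridChain a b).Near (inGrid j u) (inGrid j v) |(gridPos u).1 - (gridPos v).1| := by
  have aux : ∀ k : ℕ, ∀ u v : SubdividedGridVertex (j + 1), (gridPos u).2 = (gridPos v).2 →
      (j + 2 : ℤ) ∣ (gridPos u).2 → (gridPos v).1 = (gridPos u).1 + k →
      (gridChain a b).Near (inGrid j u) (inGrid j v) k := by
    intro k
    induction k with
    | zero =>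
      intro u v h1 h2 h3
      obtain rfl : u = v := gridPos_injective (Prod.ext (by simpa using h3.symm) h1)
      exact Near.refl _
    | succ k ih =>
      intro u v h1 h2 h3
      obtain ⟨a1, a2, a3, a4, -⟩ := gridPos_bounds u
      obtain ⟨b1, b2, b3, b4, -⟩ := gridPos_bounds v
      push_cast at h3 a2 a4 b2 b4
      have e : (j : ℤ) + 1 + 1 = j + 2 := by ring
      obtain ⟨z, hz⟩ := exists_gridPos_eq (n := j + 1) (X := (gridPos u).1 + 1) (Y := (gridPos u).2)
        (by omega) (by push_cast; omega) a3 (by push_cast; omega)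
        (Or.inr (by push_cast; rwa [e]))
      have hadj : (subdividedGrid (j + 1)).Adj u z := by
        refine adj_of_gridStep (Or.inl ⟨by rw [hz], by push_cast; rwa [e], by rw [hz]; simp⟩)
      have := (Near.of_adj (inGrid_adj a b hadj)).trans
        (ih z v (by rw [hz, h1]) (by rw [hz]; exact h2) (by rw [hz]; simp only; omega))
      exact this.mono (by push_cast; omega)
  rcases le_total (gridPos u).1 (gridPos v).1 with hle | hle
  · refine (aux (((gridPos v).1 - (gridPos u).1).toNat) u v h hd (by omega)).mono ?_
    rw [abs_sub_comm, abs_of_nonneg] <;> omega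
  · refine (aux (((gridPos u).1 - (gridPos v).1).toNat) v u h.symm (h ▸ hd) (by omega)).symm.mono ?_
    rw [abs_of_nonneg] <;> omega

theorem near_of_column {j : ℕ} {u v : SubdividedGridVertex (j + 1)}
    (h : (gridPos u).1 = (gridPos v).1) (hd : (j + 2 : ℤ) ∣ (gridPos u).1) :
    (gridChain a b).Near (inGrid j u) (inGrid j v) |(gridPos u).2 - (gridPos v).2| := by
  have aux : ∀ k : ℕ, ∀ u v : SubdividedGridVertex (j + 1), (gridPos u).1 = (gridPos v).1 →
      (j + 2 : ℤ) ∣ (gridPos u).1 → (gridPos v).2 = (gridPos u).2 + k →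
      (gridChain a b).Near (inGrid j u) (inGrid j v) k := by
    intro k
    induction k with
    | zero =>
      intro u v h1 h2 h3
      obtain rfl : u = v := gridPos_injective (Prod.ext h1 (by simpa using h3.symm))
      exact Near.refl _
    | succ k ih =>
      intro u v h1 h2 h3
      obtain ⟨a1, a2, a3, a4, -⟩ := gridPos_bounds u
      obtain ⟨b1, b2, b3, b4, -⟩ := gridPos_bounds v
      push_cast at h3 a2 a4 b2 b4
      have e : (j : ℤ) + 1 + 1 = j + 2 := by ring
      obtain ⟨z, hz⟩ := exists_gridPos_eq (n := j + 1) (X := (gridPos u).1) (Y := (gridPos u).2 + 1)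
        a1 (by push_cast; omega) (by omega) (by push_cast; omega)
        (Or.inl (by push_cast; rwa [e]))
      have hadj : (subdividedGrid (j + 1)).Adj u z := by
        refine adj_of_gridStep (Or.inr ⟨by rw [hz], by push_cast; rwa [e], by rw [hz]; simp⟩)
      have := (Near.of_adj (inGrid_adj a b hadj)).trans
        (ih z v (by rw [hz, h1]) (by rw [hz]; exact h2) (by rw [hz]; simp only; omega))
      exact this.mono (by push_cast; omega)
  rcases le_total (gridPos u).2 (gridPos v).2 with hle | hle
  · refine (aux (((gridPos v).2 - (gridPos u).2).toNat) u v h hd (by omega)).mono ?_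
    rw [abs_sub_comm, abs_of_nonneg] <;> omega
  · refine (aux (((gridPos u).2 - (gridPos v).2).toNat) v u h.symm (h ▸ hd) (by omega)).symm.mono ?_
    rw [abs_of_nonneg] <;> omega

theorem le_abs_sub_of_dvd {N x y : ℤ} (hx : N ∣ x) (hy : N ∣ y) (h : x ≠ y) : N ≤ |x - y| :=
  Int.le_of_dvd (abs_pos.2 (sub_ne_zero.2 h)) ((dvd_abs _ _).2 (dvd_sub hx hy))

theorem exists_multiple {N X M : ℤ} (hN : 0 < N) (hX : 0 ≤ X) (hX' : X ≤ M) :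
    ∃ c, N ∣ c ∧ 0 ≤ c ∧ c ≤ M ∧ |X - c| ≤ N := by
  have h1 := Int.mul_ediv_add_emod X N
  have h2 := Int.emod_nonneg X hN.ne'
  have h3 := Int.emod_lt_of_pos X hN
  refine ⟨N * (X / N), ⟨_, rfl⟩, mul_nonneg hN.le (Int.ediv_nonneg hX hN.le), by omega, ?_⟩
  rw [abs_le]; omega

/-- A point of a column and a point of a row are joined through the crossing of the two lines at
ℓ¹-cost. Two points of different columns need a detour to a row at distance at most `j + 2`, which
adds at most `2 (j + 2)`; as the columns are at least `j + 2` apart, this is at most twice the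
horizontal distance. Hence the factor 3. -/
theorem near_inGrid {j : ℕ} (u v : SubdividedGridVertex (j + 1)) :
    (gridChain a b).Near (inGrid j u) (inGrid j v)
      (3 * (|(gridPos u).1 - (gridPos v).1| + |(gridPos u).2 - (gridPos v).2|)) := by
  obtain ⟨a1, a2, a3, a4, a5⟩ := gridPos_bounds u
  obtain ⟨b1, b2, b3, b4, b5⟩ := gridPos_bounds v
  have e : ((j + 1 : ℕ) : ℤ) + 1 = j + 2 := by push_cast; ring
  have hN : (0 : ℤ) < j + 2 := by positivity
  have pt := fun X Y => exists_gridPos_eq (n := j + 1) (X := X) (Y := Y)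
  rw [e] at a2 a4 a5 b2 b4 b5 pt
  have n1 := abs_nonneg ((gridPos u).1 - (gridPos v).1)
  have n2 := abs_nonneg ((gridPos u).2 - (gridPos v).2)
  have mixed : ∀ u v : SubdividedGridVertex (j + 1), (j + 2 : ℤ) ∣ (gridPos u).1 →
      (j + 2 : ℤ) ∣ (gridPos v).2 → (gridChain a b).Near (inGrid j u) (inGrid j v)
        (|(gridPos u).1 - (gridPos v).1| + |(gridPos u).2 - (gridPos v).2|) := by
    intro u v hu hv
    obtain ⟨a1, a2, a3, a4, -⟩ := gridPos_bounds u
    obtain ⟨b1, b2, b3, b4, -⟩ := gridPos_bounds v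
    rw [e] at a2 a4 b2 b4
    obtain ⟨z, hz⟩ := pt (gridPos u).1 (gridPos v).2 a1 a2 b3 b4 (Or.inl hu)
    have h1 := near_of_column a b (u := u) (v := z) (by rw [hz]) hu
    have h2 := near_of_row a b (u := z) (v := v) (by rw [hz]) (by rw [hz]; exact hv)
    rw [hz] at h1 h2
    exact (h1.trans h2).mono (by simp only; omega)
  rcases a5 with hu | hu <;> rcases b5 with hv | hv
  · by_cases h : (gridPos u).1 = (gridPos v).1
    · exact (near_of_column a b h hu).mono (by omega)
    · have hlarge := le_abs_sub_of_dvd hu hv h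
      obtain ⟨c, hc, c0, c1, c2⟩ := exists_multiple hN a3 a4
      obtain ⟨z, hz⟩ := pt (gridPos u).1 c a1 a2 c0 c1 (Or.inl hu)
      have h1 := near_of_column a b (u := u) (v := z) (by rw [hz]) hu
      have h2 := (mixed v z hv (by rw [hz]; exact hc)).symm
      rw [hz] at h1 h2
      refine (h1.trans h2).mono ?_
      simp only at *
      rw [abs_sub_comm (gridPos v).1]
      have := abs_sub_le (gridPos v).2 (gridPos u).2 c
      rw [abs_sub_comm (gridPos v).2 (gridPos u).2] at this
      omega
  · exact (mixed u v hu hv).mono (by omega)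
  · refine (mixed v u hv hu).symm.mono ?_
    rw [abs_sub_comm (gridPos v).1, abs_sub_comm (gridPos v).2]
    omega
  · by_cases h : (gridPos u).2 = (gridPos v).2
    · exact (near_of_row a b h hu).mono (by omega)
    · have hlarge := le_abs_sub_of_dvd hu hv h
      obtain ⟨c, hc, c0, c1, c2⟩ := exists_multiple hN a1 a2
      obtain ⟨z, hz⟩ := pt c (gridPos u).2 c0 c1 a3 a4 (Or.inl hc)
      have h1 := near_of_row a b (u := u) (v := z) (by rw [hz]) hu
      have h2 := mixed z v (by rw [hz]; exact hc) hv
      rw [hz] at h1 h2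
      refine (h1.trans h2).mono ?_
      simp only at *
      have := abs_sub_le c (gridPos u).1 (gridPos v).1
      rw [abs_sub_comm c (gridPos u).1] at this
      omega

theorem near_gridLink {j i i' : ℕ} (h : i ≤ i') (h' : i' ≤ j + 1) :
    (gridChain a b).Near (gridLink a b j i) (gridLink a b j i')
      (height a b (gridLink a b j i') - height a b (gridLink a b j i)) := by
  induction i', h using Nat.le_induction with
  | base => simpa using Near.refl _
  | succ k hk ih =>
    refine ((ih (by omega)).trans (Near.of_adj (gridLink_adj a b (by omega)))).mono ?_
    rw [height_gridLink a b (by omega), height_gridLink a b (by omega),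
      height_gridLink a b (by omega)]
    push_cast
    omega

theorem near_entry_exit (j : ℕ) :
    (gridChain a b).Near (inGrid j (entry b j)) (inGrid j (a j))
      (3 * (height a b (inGrid j (a j)) - height a b (inGrid j (entry b j)))) := by
  refine (near_inGrid a b (a j) (entry b j)).symm.mono ?_
  simp only [height]
  rw [gridHeight_exit, gridHeight_entry]
  simp only [displacement, Prod.fst_sub, Prod.snd_sub]
  omega

/-- Along the spine every grid costs at most three times its gain in height, and every link at most
its gain. -/
theorem near_entry_entry {n m : ℕ} (h : n ≤ m) :
    (gridChain a b).Near (inGrid n (entry b n)) (inGrid m (entry b m))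
      (3 * (height a b (inGrid m (entry b m)) - height a b (inGrid n (entry b n)))) := by
  induction m, h using Nat.le_induction with
  | base => simpa using Near.refl _
  | succ k hk ih =>
    have h1 := near_gridLink a b (j := k) (i := 0) (Nat.zero_le _) le_rfl
    have h2 : height a b (gridLink a b k 0) ≤ height a b (gridLink a b k (k + 1)) := by
      rw [height_gridLink a b (by omega), height_gridLink a b le_rfl]; omega
    rw [gridLink_last, gridLink_zero] at h1 h2
    refine ((ih.trans (near_entry_exit a b k)).trans h1).mono ?_
    omega

end Distances

section Cuts

/-- The position in the chain: even for the grids and odd for the links. -/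
def station : GridChainVertex → ℕ
  | Sum.inl p => 2 * p.1
  | Sum.inr p => 2 * p.1 + 1

theorem station_gridLink {j i : ℕ} (h : i ≤ j + 1) :
    (i = 0 ∧ station (gridLink a b j i) = 2 * j) ∨
    (0 < i ∧ i ≤ j ∧ station (gridLink a b j i) = 2 * j + 1) ∨
    (i = j + 1 ∧ station (gridLink a b j i) = 2 * (j + 1)) := by
  rcases gridLink_cases a b h with ⟨h1, h⟩ | ⟨h1, h2, h⟩ | ⟨h1, h⟩
  · exact Or.inl ⟨h1, by rw [h]; rfl⟩
  · exact Or.inr (Or.inl ⟨h2, by omega, by rw [h]; rfl⟩)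
  · exact Or.inr (Or.inr ⟨h1, by rw [h]; rfl⟩)

/-- Edges of grids preserve the station, so the only edge from below `2 m` to `2 m` or above is the
last edge of the link into the `m`-th grid. -/
theorem entry_mem_support {x y : GridChainVertex} (w : (gridChain a b).Walk x y) {m : ℕ}
    (hx : station x < 2 * m) (hy : 2 * m ≤ station y) : inGrid m (entry b m) ∈ w.support := by
  obtain ⟨d, hd, h1, h2⟩ := w.exists_boundary_dart (station ⁻¹' Set.Iio (2 * m)) hx
    (by simpa using hy)
  have h3 := w.dart_snd_mem_support_of_mem_darts hd
  simp only [Set.mem_preimage, Set.mem_Iio, not_lt] at h1 h2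
  rcases ((gridChain_adj a b).1 d.adj).2 with ⟨j, u, v, -, e1, e2⟩ |
    ⟨j, i, hi, ⟨e1, e2⟩ | ⟨e1, e2⟩⟩
  · rw [e1] at h1; rw [e2] at h2
    simp only [station] at h1 h2
    omega
  · rw [e1] at h1; rw [e2] at h2
    have s1 := station_gridLink a b (j := j) (i := i) (by omega)
    have s2 := station_gridLink a b (j := j) (i := i + 1) (by omega)
    obtain ⟨rfl, rfl⟩ : i = j ∧ m = j + 1 := by omega
    rwa [e2, gridLink_last] at h3
  · rw [e1] at h2; rw [e2] at h1
    have s1 := station_gridLink a b (j := j) (i := i) (by omega)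
    have s2 := station_gridLink a b (j := j) (i := i + 1) (by omega)
    omega

/-- Likewise, the only edge that goes beyond station `2 m` is the first edge of the link out of the
`m`-th grid. -/
theorem exit_mem_support {x y : GridChainVertex} (w : (gridChain a b).Walk x y) {m : ℕ}
    (hx : station x ≤ 2 * m) (hy : 2 * m < station y) : inGrid m (a m) ∈ w.support := by
  obtain ⟨d, hd, h1, h2⟩ := w.exists_boundary_dart (station ⁻¹' Set.Iic (2 * m)) hx
    (by simpa using hy)
  have h3 := w.dart_fst_mem_support_of_mem_darts hd
  simp only [Set.mem_preimage, Set.mem_Iic, not_le] at h1 h2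
  rcases ((gridChain_adj a b).1 d.adj).2 with ⟨j, u, v, -, e1, e2⟩ |
    ⟨j, i, hi, ⟨e1, e2⟩ | ⟨e1, e2⟩⟩
  · rw [e1] at h1; rw [e2] at h2
    simp only [station] at h1 h2
    omega
  · rw [e1] at h1; rw [e2] at h2
    have s1 := station_gridLink a b (j := j) (i := i) (by omega)
    have s2 := station_gridLink a b (j := j) (i := i + 1) (by omega)
    obtain ⟨rfl, rfl⟩ : i = 0 ∧ m = j := by omega
    rwa [e1, gridLink_zero] at h3
  · rw [e1] at h2; rw [e2] at h1
    have s1 := station_gridLink a b (j := j) (i := i) (by omega)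
    have s2 := station_gridLink a b (j := j) (i := i + 1) (by omega)
    omega

end Cuts

end GridChain

end SimpleGraph

namespace SimpleGraph

/-! ### Upper bounds for both dimensions -/

section GridChainUpper

variable (a : ∀ j : ℕ, SubdividedGridVertex (j + 1)) (b : ∀ j : ℕ, SubdividedGridVertex (j + 2))

/-- The ends of a walk are close to each other if its height varies little and its points in any
single grid are close to each other. -/
theorem near_of_walk {L D : ℤ} (hD0 : 0 ≤ D) {x y : GridChainVertex} (w : (gridChain a b).Walk x y)
    (hL : ∀ u ∈ w.support, ∀ v ∈ w.support, height a b u - height a b v ≤ L)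
    (hD : ∀ n u v, inGrid n u ∈ w.support → inGrid n v ∈ w.support →
      (gridChain a b).Near (inGrid n u) (inGrid n v) D) :
    (gridChain a b).Near x y (2 * D + 3 * L) := by
  wlog hxy : station x ≤ station y generalizing x y
  · refine (this w.reverse (fun u hu v hv => hL u ?_ v ?_) (fun n u v hu hv => hD n u v ?_ ?_)
      (by omega)).symm
    all_goals first | simpa using hu | simpa using hv
  have hx := w.start_mem_support
  have hy := w.end_mem_support
  have hL0 : 0 ≤ L := by simpa using hL x hx x hx
  have mono : ∀ {j i i' : ℕ}, i ≤ i' → i' ≤ j + 1 →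
      height a b (gridLink a b j i) ≤ height a b (gridLink a b j i') := fun h h' => by
    rw [height_gridLink a b h', height_gridLink a b (h.trans h')]; omega
  rcases hxy.eq_or_lt with heq | hlt
  · rcases x with ⟨j, u⟩ | ⟨j, i⟩ <;> rcases y with ⟨m, v⟩ | ⟨m, i'⟩ <;> simp only [station] at heq
    · obtain rfl : j = m := by omega
      exact (hD j u v hx hy).mono (by omega)
    · omega
    · omega
    · obtain rfl : j = m := by omega
      have e := gridLink_succ a b i.2
      have e' := gridLink_succ a b i'.2
      rcases le_total (i : ℕ) i' with h | h
      · have h1 := near_gridLink a b (j := j) (i := i + 1) (i' := i' + 1) (by omega) (by omega)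
        rw [e, e'] at h1
        exact h1.mono (by linarith [hL _ hy _ hx])
      · have h1 := near_gridLink a b (j := j) (i := i' + 1) (i' := i + 1) (by omega) (by omega)
        rw [e, e'] at h1
        exact h1.symm.mono (by linarith [hL _ hx _ hy])
  -- The walk from `x` meets the spine at `gridLink a b j i`: the exit of the grid of `x`, or `x`
  -- itself if it lies on a link.
  · obtain ⟨j, i, hi, hsx, hmem, hnear⟩ : ∃ j i, i ≤ j ∧
        (station x = 2 * j ∧ i = 0 ∨ station x = 2 * j + 1) ∧
        gridLink a b j i ∈ w.support ∧ (gridChain a b).Near x (gridLink a b j i) D := by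
      rcases x with ⟨j, u⟩ | ⟨j, i⟩
      · have := exit_mem_support a b w (m := j) le_rfl hlt
        exact ⟨j, 0, by omega, Or.inl ⟨rfl, rfl⟩, by rwa [gridLink_zero],
          by rw [gridLink_zero]; exact hD j _ _ hx this⟩
      · refine ⟨j, i + 1, i.2, Or.inr rfl, ?_, ?_⟩
        · rwa [gridLink_succ a b i.2]
        · rw [gridLink_succ a b i.2]
          exact (Near.refl _).mono hD0
    -- At the other end the spine is left at `z`: the entry of the grid of `y`, or `y` itself if it
    -- lies on a link, in which case the spine also crosses the grid before that link.
    have hend : ∀ m, 2 * m ≤ station y → station x < 2 * m → (station y ≤ 2 * m + 1) →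
        ∃ z ∈ w.support, (gridChain a b).Near z y D ∧
          height a b (inGrid m (entry b m)) ≤ height a b z ∧
          (gridChain a b).Near (inGrid m (entry b m)) z
            (3 * (height a b z - height a b (inGrid m (entry b m)))) := by
      intro m hm hxm hm'
      have hent := entry_mem_support a b w hxm hm
      rcases y with ⟨m', v⟩ | ⟨m', i'⟩ <;> simp only [station] at hm hm'
      · obtain rfl : m = m' := by omega
        exact ⟨_, hent, hD m _ _ hent hy, le_rfl, (Near.refl _).mono (by omega)⟩
      · obtain rfl : m = m' := by omega
        have h1 := near_entry_exit a b m
        have h2 := near_gridLink a b (j := m) (i := 0) (i' := i' + 1) (by omega) (by omega)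
        have h3 := mono (j := m) (i := 0) (i' := i' + 1) (by omega) (by omega)
        rw [gridLink_zero] at h2 h3
        have h4 : height a b (inGrid m (entry b m)) ≤ height a b (inGrid m (a m)) := by
          simp only [height]
          rw [gridHeight_exit, gridHeight_entry]
          have := abs_nonneg (displacement a b m).1
          have := abs_nonneg (displacement a b m).2
          omega
        rw [gridLink_succ a b i'.2] at h2 h3
        exact ⟨_, hy, (Near.refl _).mono hD0, by linarith, (h1.trans h2).mono (by linarith)⟩
    -- Here `y` lies on the link that leaves the grid of `x`, so no further entry is passed.
    by_cases hsame : station y ≤ 2 * j + 1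
    · rcases y with ⟨m, v⟩ | ⟨m, i'⟩
      · have e : station (inGrid m v) = 2 * m := rfl
        simp only [inGrid] at e
        omega
      · have e : station (Sum.inr ⟨m, i'⟩) = 2 * m + 1 := rfl
        obtain rfl : j = m := by omega
        obtain rfl : i = 0 := by omega
        have h2 := near_gridLink a b (j := j) (i := 0) (i' := i' + 1) (by omega) (by omega)
        have h3 := hL _ hy _ hmem
        rw [gridLink_succ a b i'.2] at h2
        exact (hnear.trans h2).mono (by linarith)
    · obtain ⟨z, hz, hzy, hzh, hez⟩ := hend (station y / 2) (by omega) (by omega) (by omega)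
      have h1 := near_gridLink a b (j := j) (i := i) (i' := j + 1) (by omega) le_rfl
      have h2 := mono (j := j) (i := i) (i' := j + 1) (by omega) le_rfl
      rw [gridLink_last] at h1 h2
      have h3 := near_entry_entry a b (n := j + 1) (m := station y / 2) (by omega)
      have h4 := hL _ hz _ hmem
      exact ((((hnear.trans h1).trans h3).trans hez).trans hzy).mono (by omega)

/-- In a grid the ordinate is, up to signs and a constant, the height minus or plus the abscissa. An
oscillation of at most `L = 4 R` of both functions thus gives differences of at most `L` and `2 L`
in the coordinates, hence distance at most `9 L` in a grid, and `2 · 9 L + 3 L = 84 R` overall. -/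
theorem gridChain_graphANdim_le : (gridChain a b).graphANdim ≤ 2 := by
  refine graphANdim_le (k := 2) (C := 84) fun R hR => ?_
  refine hasCover_of_lipschitz (F := ![height a b, abscissa a b]) ?_ hR le_rfl ?_
  · intro l
    fin_cases l
    · exact height_isLipschitz a b
    · exact abscissa_isLipschitz a b
  · intro p q w hw
    have h0 := hw 0
    have h1 := hw 1
    simp only [Matrix.cons_val_zero, Matrix.cons_val_one] at h0 h1
    refine Near.edist_le ((near_of_walk a b (D := 9 * (((2 + 2) * R : ℕ) : ℤ)) (by positivity) w h0
      fun n u v hu hv => (near_inGrid a b u v).mono ?_).mono ?_)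
    · have a1 := h0 _ hu _ hv
      have a2 := h0 _ hv _ hu
      have a3 := h1 _ hu _ hv
      have a4 := h1 _ hv _ hu
      simp only [height, gridHeight, abscissa] at a1 a2 a3 a4
      generalize (((2 + 2) * R : ℕ) : ℤ) = L at *
      have hx : |(gridPos u).1 - (gridPos v).1| ≤ L := by rw [abs_le]; omega
      have hy : |(gridPos u).2 - (gridPos v).2| ≤ 2 * L := by
        rw [abs_le] at *
        rcases direction_eq (displacement a b n).1 with h | h <;>
          rcases direction_eq (displacement a b n).2 with h' | h' <;> rw [h, h'] at a1 a2 <;>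
          constructor <;> omega
      omega
    · push_cast
      omega

/-- The coordinates of the image of a vertex under the retraction onto the `n`-th grid. -/
noncomputable def retract (n : ℕ) (x : GridChainVertex) : ℤ × ℤ :=
  if station x < 2 * n then gridPos (entry b n)
  else Sum.elim (fun p => if p.1 = n then gridPos p.2 else gridPos (a n)) (fun _ => gridPos (a n)) x

theorem retract_inGrid (n : ℕ) (u : SubdividedGridVertex (n + 1)) :
    retract a b n (inGrid n u) = gridPos u := by
  simp [retract, station]

theorem retract_of_station_lt {n : ℕ} {x : GridChainVertex} (h : station x < 2 * n) :
    retract a b n x = gridPos (entry b n) := if_pos h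

theorem retract_of_lt_station {n : ℕ} {x : GridChainVertex} (h : 2 * n < station x) :
    retract a b n x = gridPos (a n) := by
  unfold retract
  rw [if_neg (by omega)]
  rcases x with ⟨j, u⟩ | ⟨j, i⟩
  · simp only [station] at h
    exact if_neg (show j ≠ n by omega)
  · rfl

theorem retract_gridLink {n j i : ℕ} (h : i ≤ j) :
    retract a b n (gridLink a b j i) = retract a b n (gridLink a b j (i + 1)) := by
  have s1 := station_gridLink a b (j := j) (i := i) (by omega)
  have s2 := station_gridLink a b (j := j) (i := i + 1) (by omega)
  rcases lt_trichotomy j n with hj | rfl | hj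
  · rw [retract_of_station_lt a b (by omega)]
    by_cases he : i = j ∧ n = j + 1
    · obtain ⟨rfl, rfl⟩ := he
      rw [gridLink_last, retract_inGrid]
    · rw [retract_of_station_lt a b (by omega)]
  · rw [retract_of_lt_station a b (x := gridLink a b j (i + 1)) (by omega)]
    by_cases he : i = 0
    · subst he
      rw [gridLink_zero, retract_inGrid]
    · rw [retract_of_lt_station a b (by omega)]
  · rw [retract_of_lt_station a b (by omega), retract_of_lt_station a b (by omega)]

/-- Before the grid the retraction is constantly the entry, after it the exit. Excursions of a walk
outside the grid therefore do not move the retracted point. -/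
theorem retract_adj {n : ℕ} {x y : GridChainVertex} (h : (gridChain a b).Adj x y) :
    retract a b n x = retract a b n y ∨ ∃ u v, x = inGrid n u ∧ y = inGrid n v ∧
      GridStep (n + 2) (gridPos u) (gridPos v) := by
  rcases ((gridChain_adj a b).1 h).2 with ⟨j, u, v, huv, rfl, rfl⟩ |
    ⟨j, i, hi, ⟨rfl, rfl⟩ | ⟨rfl, rfl⟩⟩
  · rcases lt_trichotomy j n with hj | rfl | hj
    · left
      rw [retract_of_station_lt a b (by simp only [station]; omega),
        retract_of_station_lt a b (by simp only [station]; omega)]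
    · refine Or.inr ⟨u, v, rfl, rfl, ?_⟩
      have := gridStep_of_adj huv
      push_cast at this
      rwa [add_assoc, one_add_one_eq_two] at this
    · left
      rw [retract_of_lt_station a b (by simp only [station]; omega),
        retract_of_lt_station a b (by simp only [station]; omega)]
  · exact Or.inl (retract_gridLink a b hi)
  · exact Or.inl (retract_gridLink a b hi).symm

theorem gridHeight_sub (j : ℕ) (p q : ℤ × ℤ) :
    gridHeight a b j p - gridHeight a b j q = direction (displacement a b j).1 * (p.1 - q.1) +
      direction (displacement a b j).2 * (p.2 - q.2) := by
  unfold gridHeight; ring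

/-- Along any horizontal or vertical line `gridHeight` is an isometry, because its coefficients are
`±1`. -/
theorem abs_sub_eq_of_snd {j : ℕ} {p q : ℤ × ℤ} (h : p.2 = q.2) :
    |p.1 - q.1| = |gridHeight a b j p - gridHeight a b j q| := by
  rw [gridHeight_sub, h, sub_self, mul_zero, add_zero, abs_mul]
  rcases direction_eq (displacement a b j).1 with h | h <;> simp [h]

theorem abs_sub_eq_of_fst {j : ℕ} {p q : ℤ × ℤ} (h : p.1 = q.1) :
    |p.2 - q.2| = |gridHeight a b j p - gridHeight a b j q| := by
  rw [gridHeight_sub, h, sub_self, mul_zero, zero_add, abs_mul]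
  rcases direction_eq (displacement a b j).2 with h | h <;> simp [h]

/-- A walk whose height varies by less than the side length of the cells of a grid stays, in that
grid, on the union of one row and one column. -/
theorem dist_le_of_walk {n : ℕ} {L A : ℤ} (hLn : L < n + 2)
    {u v : SubdividedGridVertex (n + 1)} (w : (gridChain a b).Walk (inGrid n u) (inGrid n v))
    (hw : ∀ z ∈ w.support, A ≤ height a b z ∧ height a b z ≤ A + L) :
    |(gridPos u).1 - (gridPos v).1| + |(gridPos u).2 - (gridPos v).2| ≤ 2 * L := by
  have close : ∀ {s t : ℤ}, A ≤ s ∧ s ≤ A + L → A ≤ t ∧ t ≤ A + L → |s - t| ≤ L := by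
    intro s t h1 h2; rw [abs_le]; omega
  have e : ((n + 1 : ℕ) : ℤ) + 1 = n + 2 := by push_cast; ring
  have hu := hw _ w.start_mem_support
  have hv := hw _ w.end_mem_support
  simp only [height] at hu hv
  have hdiv := (gridPos_bounds u).2.2.2.2
  rw [e] at hdiv
  let H := gridHeight a b n
  rcases hdiv with hdiv | hdiv
  · obtain ⟨c, hc⟩ : ∃ c, c = (gridPos u).1 := ⟨_, rfl⟩
    -- Invariant for a start on the column `x = c`: the retracted point is on this column, or on a
    -- row that crosses it at a height between `A` and `A + L`.
    have key := w.induction_on_support (S := fun z => A ≤ height a b z ∧ height a b z ≤ A + L)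
      (Q := fun z => ∃ p, p = retract a b n z ∧ (p.1 = c ∨ (n + 2 : ℤ) ∣ p.2 ∧
        A ≤ H (c, p.2) ∧ H (c, p.2) ≤ A + L) ∧ A ≤ H p ∧ H p ≤ A + L) hw ?_
      ⟨_, rfl, Or.inl (by rw [retract_inGrid, hc]), by rw [retract_inGrid]; exact hu⟩
    · obtain ⟨p, rfl, h1, h2⟩ := key
      rw [retract_inGrid] at h1 h2
      rcases h1 with h1 | ⟨-, h1⟩
      · rw [hc] at h1
        rw [h1, sub_self, abs_zero, abs_sub_eq_of_fst a b (j := n) h1.symm]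
        have := close hu hv
        have := abs_nonneg (gridHeight a b n (gridPos u) - gridHeight a b n (gridPos v))
        omega
      · have h3 := abs_sub_eq_of_fst a b (j := n) (p := gridPos u) (q := (c, (gridPos v).2)) hc.symm
        have h4 := abs_sub_eq_of_snd a b (j := n) (p := (c, (gridPos v).2)) (q := gridPos v) rfl
        have h5 := close hu h1
        have h6 := close h1 hv
        simp only [hc, H] at *
        omega
    · rintro x y hxy hy ⟨p, rfl, h1, h2⟩
      rcases retract_adj a b (n := n) hxy with h | ⟨u', v', rfl, rfl, h⟩
      · exact ⟨_, h, h1, h2⟩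
      · rw [retract_inGrid] at h1 h2 ⊢
        refine ⟨_, rfl, ?_, hy⟩
        rcases h with ⟨e1, d, -⟩ | ⟨e1, d, -⟩
        · right
          rw [← e1]
          refine ⟨d, ?_⟩
          rcases h1 with h1 | h1
          · rw [← h1]; exact h2
          · exact h1.2
        · rw [← e1]
          rcases h1 with h1 | h1
          · exact Or.inl h1
          · left
            -- Another column would be at least `n + 2` away along the row, but both points of the
            -- row have heights in an interval of length `L < n + 2`.
            by_contra hne
            have h3 := le_abs_sub_of_dvd d (hc ▸ hdiv) hne
            have h4 := abs_sub_eq_of_snd a b (j := n) (p := gridPos u') (q := (c, (gridPos u').2)) rfl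
            have h5 := close h2 h1.2
            simp only [H] at *
            omega
  -- The same with rows and columns exchanged.
  · obtain ⟨c, hc⟩ : ∃ c, c = (gridPos u).2 := ⟨_, rfl⟩
    have key := w.induction_on_support (S := fun z => A ≤ height a b z ∧ height a b z ≤ A + L)
      (Q := fun z => ∃ p, p = retract a b n z ∧ (p.2 = c ∨ (n + 2 : ℤ) ∣ p.1 ∧
        A ≤ H (p.1, c) ∧ H (p.1, c) ≤ A + L) ∧ A ≤ H p ∧ H p ≤ A + L) hw ?_
      ⟨_, rfl, Or.inl (by rw [retract_inGrid, hc]), by rw [retract_inGrid]; exact hu⟩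
    · obtain ⟨p, rfl, h1, h2⟩ := key
      rw [retract_inGrid] at h1 h2
      rcases h1 with h1 | ⟨-, h1⟩
      · rw [hc] at h1
        rw [h1, sub_self, abs_zero, abs_sub_eq_of_snd a b (j := n) h1.symm]
        have := close hu hv
        have := abs_nonneg (gridHeight a b n (gridPos u) - gridHeight a b n (gridPos v))
        omega
      · have h3 := abs_sub_eq_of_snd a b (j := n) (p := gridPos u) (q := ((gridPos v).1, c)) hc.symm
        have h4 := abs_sub_eq_of_fst a b (j := n) (p := ((gridPos v).1, c)) (q := gridPos v) rfl
        have h5 := close hu h1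
        have h6 := close h1 hv
        simp only [hc, H] at *
        omega
    · rintro x y hxy hy ⟨p, rfl, h1, h2⟩
      rcases retract_adj a b (n := n) hxy with h | ⟨u', v', rfl, rfl, h⟩
      · exact ⟨_, h, h1, h2⟩
      · rw [retract_inGrid] at h1 h2 ⊢
        refine ⟨_, rfl, ?_, hy⟩
        rcases h with ⟨e1, d, -⟩ | ⟨e1, d, -⟩
        · rw [← e1]
          rcases h1 with h1 | h1
          · exact Or.inl h1
          · left
            by_contra hne
            have h3 := le_abs_sub_of_dvd d (hc ▸ hdiv) hne
            have h4 := abs_sub_eq_of_fst a b (j := n) (p := gridPos u') (q := ((gridPos u').1, c)) rfl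
            have h5 := close h2 h1.2
            simp only [H] at *
            omega
        · right
          rw [← e1]
          refine ⟨d, ?_⟩
          rcases h1 with h1 | h1
          · rw [← h1]; exact h2
          · exact h1.2

/-- `L = 3 R` is the permitted oscillation of the height. In the grids with `n < L` each coordinate
is at most `(L + 2)²`; in the others `dist_le_of_walk` bounds the ℓ¹-distance by `2 L`. With the
factor 3 of `near_inGrid`, `D` covers both cases. -/
theorem gridChain_graphAsdim_le : (gridChain a b).graphAsdim ≤ 1 := by
  refine graphAsdim_le (k := 1) fun R hR => ?_
  let L : ℕ := (1 + 2) * R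
  let D : ℕ := 6 * ((L + 2) * (L + 2))
  refine ⟨2 * D + 3 * L, ?_⟩
  refine hasCover_of_lipschitz (F := ![height a b]) ?_ hR le_rfl ?_
  · intro l
    fin_cases l
    exact height_isLipschitz a b
  · intro p q w hw
    have h0 := hw 0
    simp only [Matrix.cons_val_fin_one] at h0
    refine Near.edist_le ((near_of_walk a b (D := D) (by positivity) w h0
      fun n u v hu hv => (near_inGrid a b u v).mono ?_).mono ?_)
    · by_cases hn : n < L
      · obtain ⟨a1, a2, a3, a4, -⟩ := gridPos_bounds u
        obtain ⟨b1, b2, b3, b4, -⟩ := gridPos_bounds v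
        have h1 : ((n + 1 : ℕ) : ℤ) * ((n + 1 : ℕ) + 1) ≤ ((L + 2) * (L + 2) : ℕ) := by
          have : (n : ℤ) < L := by exact_mod_cast hn
          push_cast
          nlinarith
        have h2 : |(gridPos u).1 - (gridPos v).1| ≤ ((L + 2) * (L + 2) : ℕ) := by
          rw [abs_le]; omega
        have h3 : |(gridPos u).2 - (gridPos v).2| ≤ ((L + 2) * (L + 2) : ℕ) := by
          rw [abs_le]; omega
        simp only [D]
        omega
      · obtain ⟨w', hw'⟩ := w.exists_walk_of_mem_support hu hv
        classical
        obtain ⟨z, hz, hmin⟩ := w.support.toFinset.exists_min_image (height a b)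
          ⟨_, List.mem_toFinset.2 hu⟩
        have h1 := dist_le_of_walk a b (L := L) (A := height a b z) (by omega) w' fun y hy => by
          refine ⟨hmin y (List.mem_toFinset.2 (hw' y hy)), ?_⟩
          have := h0 y (hw' y hy) z (List.mem_toFinset.1 hz)
          simp only [L]
          omega
        have h2 : (L : ℤ) ≤ ((L + 2) * (L + 2) : ℕ) := by
          push_cast; nlinarith
        simp only [D]
        omega
    · simp only [L]
      push_cast
      omega

theorem le_height_entry (n : ℕ) : (n : ℤ) ≤ height a b (inGrid n (entry b n)) := by
  simp only [height, gridHeight_entry]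
  induction n with
  | zero => simp [baseHeight]
  | succ n ih =>
    rw [baseHeight]
    have := abs_nonneg (displacement a b n).1
    have := abs_nonneg (displacement a b n).2
    push_cast
    omega

theorem gridChain_graphAsdim : (gridChain a b).graphAsdim = 1 := by
  refine le_antisymm (gridChain_graphAsdim_le a b)
    (one_le_graphAsdim (height_isLipschitz a b) (inGrid 0 (entry b 0)) fun B => ?_)
  obtain ⟨w, -⟩ := near_entry_entry a b (Nat.zero_le B)
  exact ⟨_, ⟨w⟩, le_height_entry a b B⟩

end GridChainUpper

end SimpleGraph

/-! ### A discrete Lebesgue covering theorem for the square -/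

section SquareLabelling

/-- The representative in `{-1, 0, 1}` of a residue class modulo `4` other than that of `2`. -/
def smallLift (x : ZMod 4) : ℤ := if x = 1 then 1 else if x = 3 then -1 else 0

theorem smallLift_cast : ∀ x : ZMod 4, x ≠ 2 → ((smallLift x : ℤ) : ZMod 4) = x := by decide

theorem abs_smallLift_le (x : ZMod 4) : |smallLift x| ≤ 1 := by
  unfold smallLift
  split_ifs <;> simp

/-- Excluding `2` as the sum rules out `1 + 1` and `(-1) + (-1)`, the only sums that leave `{-1, 0,
1}`. -/
theorem smallLift_triangle : ∀ x y : ZMod 4, x ≠ 2 ∧ y ≠ 2 ∧ x + y ≠ 2 →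
    smallLift x + smallLift y = smallLift (x + y) := by
  decide

/-- Both sides are the lift of the increment along the diagonal from `p` to `s`. -/
theorem smallLift_square {p q r s : ZMod 4} (h1 : q - p ≠ 2) (h2 : r - p ≠ 2) (h3 : s - p ≠ 2)
    (h4 : s - q ≠ 2) (h5 : s - r ≠ 2) :
    smallLift (q - p) + smallLift (s - q) = smallLift (r - p) + smallLift (s - r) := by
  have e1 : q - p + (s - q) = s - p := by ring
  have e2 : r - p + (s - r) = s - p := by ring
  rw [smallLift_triangle _ _ ⟨h1, h4, by rwa [e1]⟩, smallLift_triangle _ _ ⟨h2, h5, by rwa [e2]⟩,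
    e1, e2]

/-- A lift to the integers of a labelling of the plane grid by residue classes modulo `4`. -/
def labelLift (lab : ℕ → ℕ → ZMod 4) (i j : ℕ) : ℤ :=
  ((lab 0 0).val : ℤ) + ∑ k ∈ Finset.range i, smallLift (lab (k + 1) 0 - lab k 0) +
    ∑ k ∈ Finset.range j, smallLift (lab i (k + 1) - lab i k)

/-- An integer sequence with steps of size at most `1` cannot cross a residue class that it avoids.
-/
theorem mem_Ioo_of_steps {f : ℕ → ℤ} {n : ℕ} {r : ℤ} (hf : ∀ k < n, |f (k + 1) - f k| ≤ 1)
    (hr : ∀ k ≤ n, ((f k : ℤ) : ZMod 4) ≠ (r : ZMod 4)) (h0 : r < f 0 ∧ f 0 < r + 4) :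
    r < f n ∧ f n < r + 4 := by
  have key : ∀ k ≤ n, r < f k ∧ f k < r + 4 := by
    intro k
    induction k with
    | zero => exact fun _ => h0
    | succ k ih =>
      intro hk
      have h1 := ih (by omega)
      have h2 := hf k (by omega)
      have h3 := hr (k + 1) hk
      rw [abs_le] at h2
      have h4 : f (k + 1) ≠ r := fun h => h3 (by rw [h])
      have h5 : f (k + 1) ≠ r + 4 := fun h => h3 (by
        rw [h, Int.cast_add, show ((4 : ℤ) : ZMod 4) = 0 by decide, add_zero])
      omega
  exact key n le_rfl

/-- A discrete form of the Lebesgue covering theorem for the square: the sides of a square grid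
cannot be labelled by the sides of a square in such a way that they avoid the opposite sides,
unless some two neighbours have opposite labels. -/
theorem exists_opposite_labels (n : ℕ) (lab : ℕ → ℕ → ZMod 4)
    (hleft : ∀ j ≤ n, lab 0 j ≠ 2) (hbottom : ∀ i ≤ n, lab i 0 ≠ 3)
    (hright : ∀ j ≤ n, lab n j ≠ 0) (htop : ∀ i ≤ n, lab i n ≠ 1) :
    ∃ i j i' j', i ≤ n ∧ j ≤ n ∧ i' ≤ n ∧ j' ≤ n ∧ |(i : ℤ) - i'| ≤ 1 ∧ |(j : ℤ) - j'| ≤ 1 ∧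
      lab i' j' - lab i j = 2 := by
  by_contra! hcon
  have step1 : ∀ i j, i < n → j ≤ n → lab (i + 1) j - lab i j ≠ 2 := fun i j hi hj =>
    hcon i j (i + 1) j (by omega) hj hi hj (by simp) (by simp)
  have step2 : ∀ i j, i ≤ n → j < n → lab i (j + 1) - lab i j ≠ 2 := fun i j hi hj =>
    hcon i j i (j + 1) hi (by omega) hi hj (by simp) (by simp)
  have vert : ∀ i j, labelLift lab i (j + 1) - labelLift lab i j =
      smallLift (lab i (j + 1) - lab i j) := by
    intro i j
    simp only [labelLift, Finset.sum_range_succ]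
    ring
  -- The lift is defined along the bottom row and then up a column. The relation in each unit square
  -- moves a horizontal step up row by row, so the lift does not depend on the path.
  have horiz : ∀ i j, i < n → j ≤ n → labelLift lab (i + 1) j - labelLift lab i j =
      smallLift (lab (i + 1) j - lab i j) := by
    intro i j hi
    induction j with
    | zero => intro _; simp only [labelLift, Finset.sum_range_succ]; simp
    | succ j ih =>
      intro hj
      have h1 := ih (by omega)
      have h2 := vert i j
      have h3 := vert (i + 1) j
      have h4 := smallLift_square
        (step1 i j hi (by omega)) (step2 i j hi.le hj)
        (hcon i j (i + 1) (j + 1) hi.le (by omega) hi hj (by simp) (by simp))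
        (step2 (i + 1) j hi hj) (step1 i (j + 1) hi hj)
      linarith
  have cast0 : ∀ i, i ≤ n → ((labelLift lab i 0 : ℤ) : ZMod 4) = lab i 0 := by
    intro i
    induction i with
    | zero => intro _; simp [labelLift]
    | succ i ih =>
      intro hi
      have h1 := horiz i 0 hi (by omega)
      rw [sub_eq_iff_eq_add.1 h1, Int.cast_add, ih (by omega),
        smallLift_cast _ (step1 i 0 hi (by omega))]
      ring
  have cast : ∀ i j, i ≤ n → j ≤ n → ((labelLift lab i j : ℤ) : ZMod 4) = lab i j := by
    intro i j hi
    induction j with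
    | zero => exact fun _ => cast0 i hi
    | succ j ih =>
      intro hj
      have h1 := vert i j
      rw [sub_eq_iff_eq_add.1 h1, Int.cast_add, ih (by omega), smallLift_cast _ (step2 i j hi hj)]
      ring
  have c : ∀ i j, i ≤ n → j ≤ n → ∀ r : ℤ, lab i j ≠ (r : ZMod 4) →
      ((labelLift lab i j : ℤ) : ZMod 4) ≠ (r : ZMod 4) := fun i j hi hj r h => by
    rwa [cast i j hi hj]
  have hh : ∀ j ≤ n, ∀ k < n, |labelLift lab (k + 1) j - labelLift lab k j| ≤ 1 :=
    fun j hj k hk => by rw [horiz k j hk hj]; exact abs_smallLift_le _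
  have hv : ∀ i k, |labelLift lab i (k + 1) - labelLift lab i k| ≤ 1 :=
    fun i k => by rw [vert i k]; exact abs_smallLift_le _
  have n0 : ∀ i j, i ≤ n → j ≤ n → ∀ r : ℤ, lab i j ≠ (r : ZMod 4) → labelLift lab i j ≠ r :=
    fun i j hi hj r h h' => c i j hi hj r h (by rw [h'])
  have e00 : 0 ≤ labelLift lab 0 0 ∧ labelLift lab 0 0 < 4 := by
    have := (lab 0 0).val_lt
    simp only [labelLift, Finset.range_zero, Finset.sum_empty, add_zero]
    omega
  have e1 := n0 0 0 (by omega) (by omega) 2 (hleft 0 (by omega))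
  have e2 := n0 0 0 (by omega) (by omega) 3 (hbottom 0 (by omega))
  -- The lift at the corner `(0, 0)` is `0` or `1`. The forbidden residues then confine it to `(-2,
  -- 2)` on the left, `(-1, 3)` at the bottom, `(0, 4)` on the right and `(-3, 1)` at the top. The
  -- last two share no integer, yet both sides contain the corner `(n, n)`.
  have l := mem_Ioo_of_steps (f := fun k => labelLift lab 0 k) (n := n) (r := -2)
    (fun k _ => hv 0 k) (fun k hk => c 0 k (by omega) hk (-2) (by
      rw [show ((-2 : ℤ) : ZMod 4) = 2 by decide]; exact hleft k hk)) (by omega)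
  have b := mem_Ioo_of_steps (f := fun k => labelLift lab k 0) (n := n) (r := -1)
    (hh 0 (by omega)) (fun k hk => c k 0 hk (by omega) (-1) (by
      rw [show ((-1 : ℤ) : ZMod 4) = 3 by decide]; exact hbottom k hk)) (by omega)
  have e3 := n0 n 0 le_rfl (by omega) 0 (by simpa using hright 0 (by omega))
  have e4 := n0 0 n (by omega) le_rfl 1 (by simpa using htop 0 (by omega))
  have r := mem_Ioo_of_steps (f := fun k => labelLift lab n k) (n := n) (r := 0)
    (fun k _ => hv n k) (fun k hk => c n k le_rfl hk _ (by simpa using hright k hk))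
    (by omega)
  have t := mem_Ioo_of_steps (f := fun k => labelLift lab k n) (n := n) (r := -3)
    (hh n le_rfl) (fun k hk => c k n hk le_rfl _ (by
      rw [show ((-3 : ℤ) : ZMod 4) = 1 by decide]; exact htop k hk))
    (by omega)
  have e5 := n0 n n le_rfl le_rfl 1 (by simpa using htop n le_rfl)
  omega

end SquareLabelling

namespace SimpleGraph

/-! ### The lower bound for the Assouad–Nagata dimension -/

section GridChainLower

variable (a : ∀ j : ℕ, SubdividedGridVertex (j + 1)) (b : ∀ j : ℕ, SubdividedGridVertex (j + 2))

/-- The vertex in column `k` and row `l` of the grid that is subdivided to the `j`-th grid of the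
chain. -/
def crossing (j k l : ℕ) : GridChainVertex :=
  inGrid j (Sum.inl (Fin.ofNat _ k, Fin.ofNat _ l))

theorem gridPos_crossing {j k l : ℕ} (hk : k ≤ j + 1) (hl : l ≤ j + 1) :
    gridPos (n := j + 1) (Sum.inl (Fin.ofNat _ k, Fin.ofNat _ l)) =
      (((j : ℤ) + 2) * k, ((j : ℤ) + 2) * l) := by
  simp only [gridPos, Fin.ofNat, Nat.mod_eq_of_lt (Nat.lt_succ_of_le hk),
    Nat.mod_eq_of_lt (Nat.lt_succ_of_le hl)]
  push_cast
  ext <;> simp only <;> ring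

/-- At most one cell of side `j + 2` in each direction, times the factor 3 of `near_inGrid`. -/
theorem near_crossing {j k l k' l' : ℕ} (hk : k ≤ j + 1) (hl : l ≤ j + 1) (hk' : k' ≤ j + 1)
    (hl' : l' ≤ j + 1) (h : |(k : ℤ) - k'| ≤ 1) (h' : |(l : ℤ) - l'| ≤ 1) :
    (gridChain a b).Near (crossing j k l) (crossing j k' l') (6 * (j + 2)) := by
  refine (near_inGrid a b _ _).mono ?_
  rw [gridPos_crossing hk hl, gridPos_crossing hk' hl']
  simp only [← mul_sub, abs_mul]
  have : |(j : ℤ) + 2| = j + 2 := abs_of_nonneg (by positivity)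
  rw [this]
  nlinarith

/-- The abscissa bounds the horizontal displacement by the length; the vertical one is a combination
of height and abscissa, hence the factor 2. -/
theorem le_length_of_crossing {j k l k' l' : ℕ} (hk : k ≤ j + 1) (hl : l ≤ j + 1)
    (hk' : k' ≤ j + 1) (hl' : l' ≤ j + 1)
    (w : (gridChain a b).Walk (crossing j k l) (crossing j k' l')) :
    ((j : ℤ) + 2) * |(k : ℤ) - k'| ≤ 2 * w.length ∧
      ((j : ℤ) + 2) * |(l : ℤ) - l'| ≤ 2 * w.length := by
  have h1 := (abscissa_isLipschitz a b).abs_sub_le_length w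
  have h2 := (height_isLipschitz a b).abs_sub_le_length w
  generalize (w.length : ℤ) = d at *
  simp only [crossing, abscissa, height, gridPos_crossing hk hl, gridPos_crossing hk' hl',
    gridHeight_sub, ← mul_sub] at h1 h2
  rw [show baseAbscissa a b j + (((j : ℤ) + 2) * k - (gridPos (entry b j)).1) -
    (baseAbscissa a b j + (((j : ℤ) + 2) * k' - (gridPos (entry b j)).1)) =
    ((j : ℤ) + 2) * (k - k') by ring] at h1
  have e : ∀ x : ℤ, ((j : ℤ) + 2) * |x| = |((j : ℤ) + 2) * x| := fun x => by
    rw [abs_mul, abs_of_nonneg (show (0 : ℤ) ≤ j + 2 by positivity)]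
  rw [e, e]
  generalize ((j : ℤ) + 2) * (k - k') = X at *
  generalize ((j : ℤ) + 2) * (l - l') = Y at *
  rw [abs_le] at *
  rcases direction_eq (displacement a b j).1 with h | h <;>
    rcases direction_eq (displacement a b j).2 with h' | h' <;> rw [h, h'] at h2 <;>
    refine ⟨by omega, ?_⟩ <;> rw [abs_le] <;> omega

theorem two_le_gridChain_graphANdim : 2 ≤ (gridChain a b).graphANdim := by
  let _ := (gridChain a b).graphEMetric
  refine le_sInf ?_
  rintro _ ⟨m, rfl, c, hc⟩
  by_contra! hm
  have hm : m < 2 := by exact_mod_cast hm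
  -- Since `2 (6 (j + 2) + 1) ≤ 14 (j + 2)`, twice the diameter bound is then less than the side
  -- length `(j + 2) (j + 1)`; this is `long`.
  obtain ⟨j, hj⟩ := exists_nat_gt (14 * |c|)
  have hcj : 14 * c < j := lt_of_le_of_lt (by nlinarith [le_abs_self c]) hj
  obtain ⟨𝒰, hcov, ⟨𝒱, h𝒱, hdis⟩, hdiam⟩ := hc (6 * (j + 2) + 1) (by positivity)
  have hU : ∀ x, ∃ U, ∃ i, U ∈ 𝒱 i ∧ x ∈ U := by
    intro x
    have hx : x ∈ ⋃₀ 𝒰 := by rw [hcov]; trivial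
    obtain ⟨U, hU, hxU⟩ := hx
    rw [h𝒱] at hU
    obtain ⟨i, hi⟩ := Set.mem_iUnion.1 hU
    exact ⟨U, i, hi, hxU⟩
  choose U κ hUκ hxU using hU
  have short : ∀ x y z, x ∈ U z → y ∈ U z →
      ∃ w : (gridChain a b).Walk x y, (w.length : ℝ) < c * (6 * (j + 2) + 1) := by
    intro x y z hx hy
    have hz : U z ∈ 𝒰 := by rw [h𝒱]; exact Set.mem_iUnion.2 ⟨_, hUκ z⟩
    have h1 : ((gridChain a b).edist x y : ℝ≥0∞) < ENNReal.ofReal (c * (6 * (j + 2) + 1)) :=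
      ((Metric.edist_le_ediam_of_mem hx hy).trans
        (le_iSup₂ (f := fun U _ => Metric.ediam U) (U z) hz)).trans_lt hdiam
    have h2 : (gridChain a b).edist x y ≠ ⊤ := by
      intro h
      rw [h] at h1
      simp at h1
    obtain ⟨w, hw⟩ := exists_walk_of_edist_ne_top h2
    refine ⟨w, ?_⟩
    rw [← hw, ENat.toENNReal_coe, ← ENNReal.ofReal_natCast] at h1
    exact (ENNReal.ofReal_lt_ofReal_iff_of_nonneg (by positivity)).1 h1
  have long : ∀ {w : ℕ}, (w : ℝ) < c * (6 * (j + 2) + 1) → ¬ (((j : ℤ) + 2) * (j + 1) ≤ 2 * w) := by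
    intro w hw h
    have h' : ((j : ℝ) + 2) * (j + 1) ≤ 2 * w := by exact_mod_cast h
    nlinarith
  have same : ∀ x y B, (gridChain a b).Near x y B → B ≤ 6 * (j + 2) → κ x = κ y → U x = U y := by
    intro x y B hxy hB hκ
    by_contra hne
    obtain ⟨w, hw⟩ := hxy
    have h1 := hdis _ _ (hUκ x) _ (hκ ▸ hUκ y) hne
    have h2 : ENNReal.ofReal (6 * (j + 2) + 1) ≤ (gridChain a b).edist x y :=
      h1.trans ((iInf₂_le x (hxU x)).trans (iInf₂_le y (hxU y)))
    have h3 : ((gridChain a b).edist x y : ℝ≥0∞) ≤ (w.length : ℝ≥0∞) := by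
      rw [← ENat.toENNReal_coe, ENat.toENNReal_le]; exact Walk.edist_le w
    have h4 := h2.trans h3
    rw [← ENNReal.ofReal_natCast, ENNReal.ofReal_le_ofReal_iff (by positivity)] at h4
    have h5 : ((w.length : ℤ) : ℝ) ≤ ((6 * (j + 2) : ℤ) : ℝ) := by exact_mod_cast hw.trans hB
    push_cast at h5
    linarith
  classical
  let left : ℕ → ℕ → Prop := fun k l => ∃ l' ≤ j + 1, crossing j 0 l' ∈ U (crossing j k l)
  let bottom : ℕ → ℕ → Prop := fun k l => ∃ k' ≤ j + 1, crossing j k' 0 ∈ U (crossing j k l)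
  -- The first colour gets the labels of left and right, the other those of bottom and top,
  -- depending on whether the chosen member reaches the left or the bottom side. A member that does
  -- so is too small to reach the opposite side, which gives the four boundary conditions. Opposite
  -- labels force equal colours, hence for neighbours the same member; but the label depends only on
  -- the colour and the member.
  let lab : ℕ → ℕ → ZMod 4 := fun k l =>
    if (κ (crossing j k l) : ℕ) = 0 then (if left k l then 0 else 2)
    else (if bottom k l then 1 else 3)
  obtain ⟨k, l, k', l', hk, hl, hk', hl', h1, h2, h3⟩ := exists_opposite_labels (j + 1) lab
    (fun l hl h => by
      have : left 0 l := ⟨l, hl, hxU _⟩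
      simp only [lab, this, if_true] at h
      revert h
      split_ifs <;> decide)
    (fun k hk h => by
      have : bottom k 0 := ⟨k, hk, hxU _⟩
      simp only [lab, this, if_true] at h
      revert h
      split_ifs <;> decide)
    (fun l hl h => by
      have : ¬ left (j + 1) l := by
        rintro ⟨l', hl', hmem⟩
        obtain ⟨w, hw⟩ := short _ _ _ hmem (hxU _)
        have h1 := (le_length_of_crossing a b (by omega) hl' le_rfl hl w).1
        push_cast at h1
        rw [zero_sub, abs_neg, abs_of_nonneg (by positivity)] at h1
        exact long hw h1
      simp only [lab, this, if_false] at h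
      revert h
      split_ifs <;> decide)
    (fun k hk h => by
      have : ¬ bottom k (j + 1) := by
        rintro ⟨k', hk', hmem⟩
        obtain ⟨w, hw⟩ := short _ _ _ hmem (hxU _)
        have h1 := (le_length_of_crossing a b hk' (by omega) hk le_rfl w).2
        push_cast at h1
        rw [zero_sub, abs_neg, abs_of_nonneg (by positivity)] at h1
        exact long hw h1
      simp only [lab, this, if_false] at h
      revert h
      split_ifs <;> decide)
  have hnear := near_crossing a b hk hl hk' hl' h1 h2
  -- Labels of different colours differ in parity, so they are not opposite.
  have hκ : κ (crossing j k l) = κ (crossing j k' l') := by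
    have a1 := (κ (crossing j k l)).2
    have a2 := (κ (crossing j k' l')).2
    by_contra hne
    have hne' : (κ (crossing j k l) : ℕ) ≠ κ (crossing j k' l') := fun h => hne (Fin.ext h)
    simp only [lab] at h3
    by_cases z1 : (κ (crossing j k l) : ℕ) = 0
    · have z2 : (κ (crossing j k' l') : ℕ) ≠ 0 := by omega
      rw [if_pos z1, if_neg z2] at h3
      revert h3
      split_ifs <;> decide
    · have z2 : (κ (crossing j k' l') : ℕ) = 0 := by omega
      rw [if_neg z1, if_pos z2] at h3
      revert h3
      split_ifs <;> decide
  have hUU := same _ _ _ hnear le_rfl hκ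
  have : lab k l = lab k' l' := by
    simp only [lab, left, bottom, hUU, hκ]
  rw [this, sub_self] at h3
  revert h3
  decide

theorem gridChain_graphANdim : (gridChain a b).graphANdim = 2 :=
  le_antisymm (gridChain_graphANdim_le a b) (two_le_gridChain_graphANdim a b)

end GridChainLower

end SimpleGraph

namespace SimpleGraph

/-! ### From drawings in the plane to embeddings of the 1-complex -/

section Drawing

variable {V : Type*} {G : SimpleGraph V}

/-- A choice of arcs for the oriented edges of a graph that has an arc for every edge. -/
theorem exists_dart_arcs {X : Type*} [TopologicalSpace X] {pos : V → X} {cell : Sym2 V → Set X}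
    (harc : ∀ e ∈ G.edgeSet, ∃ u v, ∃ γ : unitInterval → X, e = s(u, v) ∧ Continuous γ ∧
      Function.Injective γ ∧ γ 0 = pos u ∧ γ 1 = pos v ∧ ∀ t, t ≠ 0 → t ≠ 1 → γ t ∈ cell e) :
    ∃ A : G.Dart → unitInterval → X, ∀ d, Continuous (A d) ∧ Function.Injective (A d) ∧
      A d 0 = pos d.fst ∧ (∀ t, A d.symm (unitInterval.symm t) = A d t) ∧
      ∀ t, t ≠ 0 → t ≠ 1 → A d t ∈ cell d.edge := by
  classical
  rcases isEmpty_or_nonempty V with hV | ⟨⟨v₀⟩⟩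
  · exact ⟨fun d => isEmptyElim d.fst, fun d => isEmptyElim d.fst⟩
  have : Nonempty V := ⟨v₀⟩
  have : Nonempty X := ⟨pos v₀⟩
  choose! u v γ h using harc
  refine ⟨fun d => if u d.edge = d.fst then γ d.edge else γ d.edge ∘ unitInterval.symm,
    fun d => ?_⟩
  obtain ⟨he, hc, hi, h0, h1, hcell⟩ := h d.edge d.edge_mem
  have hne := d.adj.ne
  have hcell' : ∀ t, t ≠ 0 → t ≠ 1 → γ d.edge (unitInterval.symm t) ∈ cell d.edge := by
    intro t ht ht'
    refine hcell _ (fun h => ht' ?_) fun h => ht ?_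
    · rw [← unitInterval.symm_symm t, h, unitInterval.symm_zero]
    · rw [← unitInterval.symm_symm t, h, unitInterval.symm_one]
  have hsymm : d.symm.edge = d.edge := d.edge_symm
  have hd : s(d.fst, d.snd) = s(u d.edge, v d.edge) := he
  rcases Sym2.eq_iff.1 hd with ⟨e1, e2⟩ | ⟨e1, e2⟩
  · have hn : ¬ u d.symm.edge = d.symm.fst := by
      rw [hsymm, ← e1]; exact hne
    simp only [if_pos e1.symm, if_neg hn]
    refine ⟨hc, hi, by rw [h0, ← e1], fun t => ?_, hcell⟩
    simp [hsymm]
  · have hn : ¬ u d.edge = d.fst := by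
      rw [← e2]; exact hne.symm
    have hp : u d.symm.edge = d.symm.fst := by
      rw [hsymm, ← e2]; rfl
    simp only [if_neg hn, if_pos hp]
    refine ⟨hc.comp unitInterval.continuous_symm,
      hi.comp unitInterval.symm_bijective.injective, ?_, fun t => ?_, hcell'⟩
    · simp [h1, e1]
    · simp [hsymm]

/-- A locally finite drawing in the plane without crossings shows that a graph is planar. -/
theorem isPlanar_of_drawing {pos : V → ℂ} {cell : Sym2 V → Set ℂ} (hpos : Function.Injective pos)
    (harc : ∀ e ∈ G.edgeSet, ∃ u v, ∃ γ : unitInterval → ℂ, e = s(u, v) ∧ Continuous γ ∧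
      Function.Injective γ ∧ γ 0 = pos u ∧ γ 1 = pos v ∧ ∀ t, t ≠ 0 → t ≠ 1 → γ t ∈ cell e)
    (hcell : ∀ e e' z, z ∈ cell e → z ∈ cell e' → e = e')
    (hvert : ∀ e v, pos v ∉ cell e)
    (hfinV : ∀ R : ℝ, ∃ S : Set V, S.Finite ∧ ∀ v ∉ S, R < ‖pos v‖)
    (hfinE : ∀ R : ℝ, ∃ S : Set (Sym2 V), S.Finite ∧ ∀ e ∈ G.edgeSet, e ∉ S →
      (∀ z ∈ cell e, R < ‖z‖) ∧ ∀ v ∈ e, R < ‖pos v‖) :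
    G.IsPlanar := by
  obtain ⟨A, hA⟩ := exists_dart_arcs harc
  have hA0 : ∀ d, A d 0 = pos d.fst := fun d => (hA d).2.2.1
  have hAs : ∀ d t, A d.symm (unitInterval.symm t) = A d t := fun d => (hA d).2.2.2.1
  have hA1 : ∀ d, A d 1 = pos d.snd := by
    intro d
    rw [← hAs d 1, unitInterval.symm_one, hA0]
    rfl
  have hAc : ∀ d t, t ≠ 0 → t ≠ 1 → A d t ∈ cell d.edge := fun d => (hA d).2.2.2.2
  let f₀ : V ⊕ (G.Dart × unitInterval) → ℂ := Sum.elim pos fun p => A p.1 p.2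
  have hrel : ∀ x y, RealizationRel G x y → f₀ x = f₀ y := by
    rintro _ _ (d | d | ⟨d, t⟩)
    · exact hA0 d
    · exact hA1 d
    · exact (hAs d t).symm
  let f : G.Realization → ℂ := Quot.lift f₀ hrel
  have hf : Continuous f := by
    let _ : TopologicalSpace V := ⊥
    let _ : TopologicalSpace G.Dart := ⊥
    have : DiscreteTopology V := ⟨rfl⟩
    have : DiscreteTopology G.Dart := ⟨rfl⟩
    refine continuous_coinduced_dom.2 ?_
    change Continuous f₀
    refine continuous_sum_dom.2 ⟨continuous_of_discreteTopology, ?_⟩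
    exact continuous_prod_of_discrete_left.2 fun d => (hA d).1
  have hends : ∀ d t, (∃ v, (Quot.mk G.RealizationRel (Sum.inr (d, t)) : G.Realization) =
      Quot.mk G.RealizationRel (Sum.inl v)) ∨ (t ≠ 0 ∧ t ≠ 1) := by
    intro d t
    by_cases h0 : t = 0
    · subst h0
      exact Or.inl ⟨_, Quot.sound (RealizationRel.source d)⟩
    · by_cases h1 : t = 1
      · subst h1
        exact Or.inl ⟨_, Quot.sound (RealizationRel.target d)⟩
      · exact Or.inr ⟨h0, h1⟩
  have hvv : ∀ v v', f (Quot.mk _ (Sum.inl v)) = f (Quot.mk _ (Sum.inl v')) →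
      (Quot.mk G.RealizationRel (Sum.inl v) : G.Realization) = Quot.mk _ (Sum.inl v') := by
    intro v v' h
    rw [hpos h]
  have hve : ∀ v d t, t ≠ 0 ∧ t ≠ 1 →
      f (Quot.mk _ (Sum.inl v)) ≠ f (Quot.mk _ (Sum.inr (d, t))) := by
    intro v d t ht h
    have h' : pos v = A d t := h
    exact hvert d.edge v (h' ▸ hAc d t ht.1 ht.2)
  have hinj : Function.Injective f := by
    rintro ⟨v | ⟨d, t⟩⟩ ⟨v' | ⟨d', t'⟩⟩ h
    · exact hvv _ _ h
    · rcases hends d' t' with ⟨w, hw⟩ | ht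
      · rw [hw] at h ⊢
        exact hvv _ _ h
      · exact absurd h (hve _ _ _ ht)
    · rcases hends d t with ⟨w, hw⟩ | ht
      · rw [hw] at h ⊢
        exact hvv _ _ h
      · exact absurd h.symm (hve _ _ _ ht)
    · rcases hends d t with ⟨w, hw⟩ | ht
      · rw [hw] at h ⊢
        rcases hends d' t' with ⟨w', hw'⟩ | ht'
        · rw [hw'] at h ⊢
          exact hvv _ _ h
        · exact absurd h (hve _ _ _ ht')
      · rcases hends d' t' with ⟨w', hw'⟩ | ht'
        · rw [hw'] at h ⊢
          exact absurd h.symm (hve _ _ _ ht)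
        · have h' : A d t = A d' t' := h
          have he := hcell _ _ _ (hAc d t ht.1 ht.2) (h' ▸ hAc d' t' ht'.1 ht'.2)
          rcases dart_edge_eq_iff d d' |>.1 he with rfl | rfl
          · rw [(hA d).2.1 h']
          · rw [← hAs d' t'] at h'
            rw [(hA d'.symm).2.1 h']
            exact (Quot.sound (RealizationRel.flip d' t')).symm
  -- Continuity and injectivity do not suffice for an embedding. The image of a closed set is the
  -- union of its parts on the vertices and the arcs, which are compact; by local finiteness of the
  -- drawing the union is closed.
  have hclosed : IsClosedMap f := by
    intro C hC
    let K : V ⊕ G.Dart → Set ℂ := Sum.elim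
      (fun v => {z | z = pos v ∧ (Quot.mk _ (Sum.inl v) : G.Realization) ∈ C})
      (fun d => A d '' {t | (Quot.mk _ (Sum.inr (d, t)) : G.Realization) ∈ C})
    have hK : f '' C = ⋃ i, K i := by
      ext z
      constructor
      · rintro ⟨⟨v | ⟨d, t⟩⟩, hx, rfl⟩
        · exact Set.mem_iUnion.2 ⟨Sum.inl v, rfl, hx⟩
        · exact Set.mem_iUnion.2 ⟨Sum.inr d, t, hx, rfl⟩
      · intro hz
        obtain ⟨v | d, h⟩ := Set.mem_iUnion.1 hz
        · obtain ⟨rfl, h⟩ := h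
          exact ⟨_, h, rfl⟩
        · obtain ⟨t, h, rfl⟩ := h
          exact ⟨_, h, rfl⟩
    rw [hK]
    refine LocallyFinite.isClosed_iUnion ?_ ?_
    · intro z
      refine ⟨Metric.ball z 1, Metric.ball_mem_nhds z one_pos, ?_⟩
      have hball : ∀ y ∈ Metric.ball z 1, ‖y‖ ≤ ‖z‖ + 1 := by
        intro y hy
        rw [Metric.mem_ball, dist_eq_norm] at hy
        have := norm_le_norm_add_norm_sub' y z
        linarith
      obtain ⟨S, hS, hS'⟩ := hfinV (‖z‖ + 1)
      obtain ⟨T, hT, hT'⟩ := hfinE (‖z‖ + 1)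
      have hfib : (Dart.edge (G := G) ⁻¹' T).Finite := by
        refine hT.preimage' fun e _ => ?_
        by_cases h : ∃ d : G.Dart, d.edge = e
        · obtain ⟨d, rfl⟩ := h
          refine (Set.toFinite {d, d.symm}).subset fun d' hd' => ?_
          exact (dart_edge_eq_iff d' d).1 hd'
        · convert Set.finite_empty
          ext d
          simpa using fun hd => h ⟨d, hd⟩
      refine ((hS.image Sum.inl).union (hfib.image Sum.inr)).subset ?_
      rintro (v | d) ⟨y, hy, hyz⟩
      · left
        refine ⟨v, ?_, rfl⟩
        by_contra hv
        obtain ⟨rfl, -⟩ := hy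
        exact absurd (hball _ hyz) (not_le.2 (hS' v hv))
      · right
        refine ⟨d, ?_, rfl⟩
        by_contra hd
        obtain ⟨t, -, rfl⟩ := hy
        have hd' := hT' d.edge d.edge_mem hd
        have hmem1 : d.fst ∈ d.edge := Sym2.mem_mk_left _ _
        have hmem2 : d.snd ∈ d.edge := Sym2.mem_mk_right _ _
        by_cases h0 : t = 0
        · rw [h0, hA0] at hyz
          exact absurd (hball _ hyz) (not_le.2 (hd'.2 _ hmem1))
        · by_cases h1 : t = 1
          · rw [h1, hA1] at hyz
            exact absurd (hball _ hyz) (not_le.2 (hd'.2 _ hmem2))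
          · exact absurd (hball _ hyz) (not_le.2 (hd'.1 _ (hAc d t h0 h1)))
    · rintro (v | d)
      · by_cases h : (Quot.mk _ (Sum.inl v) : G.Realization) ∈ C
        · convert isClosed_singleton (x := pos v)
          ext z
          simp [K, h]
        · convert isClosed_empty
          ext z
          simp [K, h]
      · refine (IsClosed.isCompact ?_).image (hA d).1 |>.isClosed
        let _ : TopologicalSpace V := ⊥
        let _ : TopologicalSpace G.Dart := ⊥
        have h1 : Continuous (Quot.mk G.RealizationRel : _ → G.Realization) :=
          continuous_coinduced_rng
        exact hC.preimage (h1.comp (continuous_inr.comp (Continuous.prodMk_right d)))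
  have hemb := (Topology.IsClosedEmbedding.of_continuous_injective_isClosedMap hf hinj
    hclosed).isEmbedding
  exact ⟨_, Complex.orthonormalBasisOneI.repr.toHomeomorph.isEmbedding.comp hemb⟩

end Drawing

end SimpleGraph

/-! ### Möbius placement in annuli, and nesting of the annuli -/

section Placement

open Set

/-- The quotient of the distances to `p` and `q` tends to `0` at `p`, and on `K` it is bounded away
from `0`. The inequality is cross-multiplied because `K` may contain `q`. -/
theorem exists_near_pole {K : Set ℂ} (hK : IsCompact K) {p q : ℂ} (hp : p ∉ K) (hpq : p ≠ q) :
    ∃ δ > 0, ∀ u, ‖u - p‖ < δ → 2 * ‖u - p‖ < ‖u - q‖ ∧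
      ∀ z ∈ K, ‖u - p‖ * ‖z - q‖ < ‖z - p‖ * ‖u - q‖ := by
  have hpq' : 0 < ‖p - q‖ := norm_pos_iff.2 (sub_ne_zero.2 hpq)
  obtain ⟨M, hM⟩ := hK.isBounded.exists_norm_le
  obtain ⟨η, hη, hη'⟩ : ∃ η > 0, ∀ z ∈ K, η ≤ ‖z - p‖ := by
    obtain ⟨η, hη, h⟩ := Metric.isOpen_iff.1 hK.isClosed.isOpen_compl p hp
    refine ⟨η, hη, fun z hz => ?_⟩
    by_contra! hlt
    exact h (by rwa [Metric.mem_ball, dist_eq_norm]) hz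
  have hM' : 0 < |M| + ‖q‖ + 1 := by positivity
  refine ⟨min (‖p - q‖ / 4) (η * ‖p - q‖ / (4 * (|M| + ‖q‖ + 1))), by positivity, fun u hu => ?_⟩
  obtain ⟨h1, h2⟩ := lt_min_iff.1 hu
  have h3 : ‖p - q‖ ≤ ‖u - p‖ + ‖u - q‖ := by
    rw [norm_sub_rev u p]
    simpa using norm_add_le (p - u) (u - q)
  refine ⟨by linarith, fun z hz => ?_⟩
  have h4 : ‖z - q‖ ≤ |M| + ‖q‖ + 1 := by
    have := norm_sub_le z q
    have := hM z hz
    have := le_abs_self M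
    linarith
  calc ‖u - p‖ * ‖z - q‖ ≤ ‖u - p‖ * (|M| + ‖q‖ + 1) := by gcongr
    _ ≤ η * ‖p - q‖ / 4 := by
        rw [lt_div_iff₀ (by positivity)] at h2
        linarith
    _ < η * ‖u - q‖ := by nlinarith
    _ ≤ ‖z - p‖ * ‖u - q‖ := by gcongr; exact hη' z hz

/-- Moving outwards on a ray from `p` by some length adds exactly that length to the distance from
`p` and at most that length to the distance from `q`; a fraction below `1` grows strictly under
this. -/
theorem cross_lt_of_segment {p q w : ℂ} (hw : w ≠ 0) {s t : ℝ} (hs : 0 ≤ s) (hst : s < t)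
    (h : ‖p + s * w - p‖ < ‖p + s * w - q‖) :
    ‖p + s * w - p‖ * ‖p + t * w - q‖ < ‖p + t * w - p‖ * ‖p + s * w - q‖ := by
  have hw' : 0 < ‖w‖ := norm_pos_iff.2 hw
  have e : ∀ r : ℝ, 0 ≤ r → ‖p + r * w - p‖ = r * ‖w‖ := fun r hr => by
    rw [add_sub_cancel_left, norm_mul, Complex.norm_real, Real.norm_of_nonneg hr]
  rw [e s hs] at h ⊢
  rw [e t (hs.trans hst.le)]
  have h1 : ‖p + t * w - q‖ ≤ ‖p + s * w - q‖ + (t - s) * ‖w‖ := by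
    have : p + t * w - q = (p + s * w - q) + ((t - s : ℝ) : ℂ) * w := by push_cast; ring
    rw [this]
    refine (norm_add_le _ _).trans (le_of_eq ?_)
    rw [norm_mul, Complex.norm_real, Real.norm_of_nonneg (by linarith)]
  have h2 : s * ‖w‖ * ‖p + t * w - q‖ ≤ s * ‖w‖ * (‖p + s * w - q‖ + (t - s) * ‖w‖) := by gcongr
  have h3 : 0 < (t - s) * ‖w‖ * (‖p + s * w - q‖ - s * ‖w‖) := by
    have : 0 < t - s := by linarith
    have : 0 < ‖p + s * w - q‖ - s * ‖w‖ := by linarith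
    positivity
  nlinarith

/-- A set with a spoke at `a` in the direction of `w` and a spoke at `b` in the opposite
direction. -/
def spoked (K : Set ℂ) (a b w : ℂ) (σ τ : ℝ) : Set ℂ :=
  K ∪ {z | ∃ t : ℝ, 0 ≤ t ∧ t ≤ τ ∧ z = a + t * w} ∪ {z | ∃ t : ℝ, 0 ≤ t ∧ t ≤ σ ∧ z = b - t * w}

/-- A compact set with two short spokes can be moved into an annulus that it touches only in the
ends of the spokes. -/
theorem exists_placement {K : Set ℂ} (hK : IsCompact K) {a b w : ℂ} (hw : w ≠ 0)
    (hab : ∀ t : ℝ, 0 ≤ t → t ≤ 1 → a + t * w ≠ b - w ∧ a + w ≠ b - t * w)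
    (haK : a + w ∉ K) (hbK : b - w ∉ K) :
    ∃ σ τ : ℝ, ∃ Ψ : ℂ → ℂ, 0 < σ ∧ σ < 1 ∧ 0 < τ ∧ τ < 1 ∧
      ContinuousOn Ψ (spoked K a b w σ τ) ∧ InjOn Ψ (spoked K a b w σ τ) ∧ Ψ (b - σ * w) ≠ 0 ∧
      2 * ‖Ψ (b - σ * w)‖ ≤ ‖Ψ (a + τ * w)‖ ∧
      ∀ z ∈ spoked K a b w σ τ, (z ≠ b - σ * w → ‖Ψ (b - σ * w)‖ < ‖Ψ z‖) ∧
        (z ≠ a + τ * w → ‖Ψ z‖ < ‖Ψ (a + τ * w)‖) := by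
  have hpq : b - w ≠ a + w := by
    have := (hab 1 zero_le_one le_rfl).1
    rw [Complex.ofReal_one, one_mul] at this
    exact this.symm
  have hseg : ∀ c v : ℂ, IsCompact {z | ∃ t : ℝ, 0 ≤ t ∧ t ≤ 1 ∧ z = c + t * v} := by
    intro c v
    have h1 : IsCompact ((fun t : ℝ => c + t * v) '' Icc (0 : ℝ) 1) :=
      isCompact_Icc.image (by fun_prop)
    convert h1 using 1
    ext z
    constructor
    · rintro ⟨t, h0, h1, rfl⟩
      exact ⟨t, ⟨h0, h1⟩, rfl⟩
    · rintro ⟨t, ⟨h0, h1⟩, rfl⟩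
      exact ⟨t, h0, h1, rfl⟩
  have hw' : 0 < ‖w‖ := norm_pos_iff.2 hw
  have small : ∀ δ : ℝ, 0 < δ → ∃ s : ℝ, 0 < s ∧ s < 1 ∧ s * ‖w‖ < δ := by
    intro δ hδ
    refine ⟨min (1 / 2) (δ / (2 * ‖w‖)), by positivity, ?_, ?_⟩
    · exact (min_le_left _ _).trans_lt (by norm_num)
    · calc min (1 / 2) (δ / (2 * ‖w‖)) * ‖w‖ ≤ δ / (2 * ‖w‖) * ‖w‖ := by
            gcongr; exact min_le_right _ _
        _ = δ / 2 := by field_simp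
        _ < δ := by linarith
  -- The map will be `(z - (b - w)) / (z - (a + w))`. The spokes point at its zero and its pole and
  -- are cut off shortly before, at `1 - s` and `1 - s'`, so that their tips are the unique points
  -- of least and greatest modulus.
  obtain ⟨δ, hδ, hδ'⟩ := exists_near_pole (hK.union (hseg a w)) (p := b - w) (q := a + w) (by
    rintro (h | ⟨t, h0, h1, h⟩)
    · exact hbK h
    · exact (hab t h0 (by linarith)).1 h.symm) hpq
  obtain ⟨δ', hδ0', hδ''⟩ := exists_near_pole (hK.union (hseg b (-w))) (p := a + w) (q := b - w) (by
    rintro (h | ⟨t, h0, h1, h⟩)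
    · exact haK h
    · exact (hab t h0 (by linarith)).2 (h.trans (by ring))) hpq.symm
  obtain ⟨s, hs0, hs1, hsw⟩ := small δ hδ
  obtain ⟨s', hs0', hs1', hsw'⟩ := small δ' hδ0'
  have nrm : ∀ r : ℝ, 0 < r → ‖((r : ℝ) : ℂ) * w‖ = r * ‖w‖ := fun r hr => by
    rw [norm_mul, Complex.norm_real, Real.norm_of_nonneg hr.le]
  have ex : b - ((1 - s : ℝ) : ℂ) * w = (b - w) + s * w := by push_cast; ring
  have ey : a + ((1 - s' : ℝ) : ℂ) * w = (a + w) + s' * (-w) := by push_cast; ring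
  obtain ⟨hx1, hx2⟩ := hδ' ((b - w) + s * w) (by rwa [add_sub_cancel_left, nrm s hs0])
  obtain ⟨hy1, hy2⟩ := hδ'' ((a + w) + s' * (-w)) (by
    rwa [add_sub_cancel_left, mul_neg, norm_neg, nrm s' hs0'])
  rw [← ex] at hx1 hx2
  rw [← ey] at hy1 hy2
  have hx0 : 0 < ‖b - ((1 - s : ℝ) : ℂ) * w - (b - w)‖ := by
    rw [ex, add_sub_cancel_left, nrm s hs0]; positivity
  have hy0 : 0 < ‖a + ((1 - s' : ℝ) : ℂ) * w - (a + w)‖ := by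
    rw [ey, add_sub_cancel_left, mul_neg, norm_neg, nrm s' hs0']; positivity
  generalize hx : b - ((1 - s : ℝ) : ℂ) * w = x at *
  generalize hy : a + ((1 - s' : ℝ) : ℂ) * w = y at *
  have hcross : ∀ z ∈ spoked K a b w (1 - s) (1 - s'),
      (z ≠ x → ‖x - (b - w)‖ * ‖z - (a + w)‖ < ‖z - (b - w)‖ * ‖x - (a + w)‖) ∧
      (z ≠ y → ‖y - (a + w)‖ * ‖z - (b - w)‖ < ‖z - (a + w)‖ * ‖y - (b - w)‖) := by
    rintro z ((hz | ⟨t, h0, h1, rfl⟩) | ⟨t, h0, h1, rfl⟩)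
    · exact ⟨fun _ => hx2 z (Or.inl hz), fun _ => hy2 z (Or.inl hz)⟩
    · refine ⟨fun _ => hx2 _ (Or.inr ⟨t, h0, by linarith, rfl⟩), fun hne => ?_⟩
      have hlt : t < 1 - s' := lt_of_le_of_ne h1 fun h => hne (by rw [h, hy])
      have e1 : a + t * w = (a + w) + ((1 - t : ℝ) : ℂ) * (-w) := by push_cast; ring
      rw [e1, ey]
      exact cross_lt_of_segment (neg_ne_zero.2 hw) hs0'.le (by linarith) (by
        rw [← ey]; linarith)
    · refine ⟨fun hne => ?_, fun _ => hy2 _ (Or.inr ⟨t, h0, by linarith, by ring⟩)⟩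
      have hlt : t < 1 - s := lt_of_le_of_ne h1 fun h => hne (by rw [h, hx])
      have e1 : b - t * w = (b - w) + ((1 - t : ℝ) : ℂ) * w := by push_cast; ring
      rw [e1, ex]
      exact cross_lt_of_segment hw hs0.le (by linarith) (by rw [← ex]; linarith)
  have hq : ∀ z ∈ spoked K a b w (1 - s) (1 - s'), z - (a + w) ≠ 0 := by
    rintro z ((hz | ⟨t, h0, h1, rfl⟩) | ⟨t, h0, h1, rfl⟩) h
    · exact haK (sub_eq_zero.1 h ▸ hz)
    · have : ((t - 1 : ℝ) : ℂ) * w = 0 := by rw [← h]; push_cast; ring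
      rcases mul_eq_zero.1 this with h' | h'
      · have : t - 1 = 0 := by exact_mod_cast h'
        linarith
      · exact hw h'
    · exact (hab t h0 (by linarith)).2 (sub_eq_zero.1 h).symm
  have hxD : x ∈ spoked K a b w (1 - s) (1 - s') := Or.inr ⟨1 - s, by linarith, le_rfl, hx.symm⟩
  have hyD : y ∈ spoked K a b w (1 - s) (1 - s') :=
    Or.inl (Or.inr ⟨1 - s', by linarith, le_rfl, hy.symm⟩)
  refine ⟨1 - s, 1 - s', fun z => (z - (b - w)) / (z - (a + w)), by linarith, by linarith,
    by linarith, by linarith, ?_, ?_, ?_, ?_, ?_⟩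
  · exact (continuousOn_id.sub continuousOn_const).div (continuousOn_id.sub continuousOn_const) hq
  · intro z hz z' hz' h
    have h' := (div_eq_div_iff (hq z hz) (hq z' hz')).1 h
    have : (z - z') * ((b - w) - (a + w)) = 0 := by linear_combination h'
    rcases mul_eq_zero.1 this with h' | h'
    · exact sub_eq_zero.1 h'
    · exact absurd (sub_eq_zero.1 h') hpq
  · rw [hx]
    exact div_ne_zero (norm_pos_iff.1 hx0) (hq x hxD)
  · rw [hx, hy]
    simp only [norm_div]
    have h1 : ‖x - (b - w)‖ / ‖x - (a + w)‖ ≤ 1 / 2 := by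
      rw [div_le_div_iff₀ (norm_pos_iff.2 (hq x hxD)) two_pos]
      linarith
    have h2 : 1 ≤ ‖y - (b - w)‖ / ‖y - (a + w)‖ := by
      rw [one_le_div (norm_pos_iff.2 (hq y hyD))]
      linarith
    linarith
  · intro z hz
    rw [hx, hy]
    simp only [norm_div]
    have hz0 := norm_pos_iff.2 (hq z hz)
    refine ⟨fun hne => ?_, fun hne => ?_⟩
    · rw [div_lt_div_iff₀ (norm_pos_iff.2 (hq x hxD)) hz0]
      exact (hcross z hz).1 hne
    · rw [div_lt_div_iff₀ hz0 (norm_pos_iff.2 (hq y hyD)), mul_comm,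
        mul_comm ‖y - (b - w)‖]
      exact (hcross z hz).2 hne

/-- Sets in annuli can be rescaled so that the annuli are nested and consecutive sets touch. -/
theorem exists_nested {D : ℕ → Set ℂ} {x y : ℕ → ℂ} {Ψ : ℕ → ℂ → ℂ}
    (hc : ∀ j, ContinuousOn (Ψ j) (D j)) (hi : ∀ j, InjOn (Ψ j) (D j))
    (h0 : ∀ j, Ψ j (x j) ≠ 0) (h2 : ∀ j, 2 * ‖Ψ j (x j)‖ ≤ ‖Ψ j (y j)‖)
    (hmin : ∀ j, ∀ z ∈ D j, z ≠ x j → ‖Ψ j (x j)‖ < ‖Ψ j z‖)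
    (hmax : ∀ j, ∀ z ∈ D j, z ≠ y j → ‖Ψ j z‖ < ‖Ψ j (y j)‖) :
    ∃ Φ : ℕ → ℂ → ℂ, (∀ j, ContinuousOn (Φ j) (D j)) ∧ (∀ j, Φ j (y j) = Φ (j + 1) (x (j + 1))) ∧
      (∀ B : ℝ, ∃ J, ∀ j ≥ J, ∀ z ∈ D j, B < ‖Φ j z‖) ∧
      ∀ j k, ∀ z ∈ D j, ∀ z' ∈ D k, Φ j z = Φ k z' → (j = k ∧ z = z') ∨
        (k = j + 1 ∧ z = y j ∧ z' = x k) ∨ (j = k + 1 ∧ z = x j ∧ z' = y k) := by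
  -- The factors are complex: they rotate as well as scale, so that the outer tip of one set lands
  -- exactly on the inner tip of the next.
  let c : ℕ → ℂ := fun j => Nat.rec 1 (fun j c => c * Ψ j (y j) / Ψ (j + 1) (x (j + 1))) j
  have hcs : ∀ j, c (j + 1) = c j * Ψ j (y j) / Ψ (j + 1) (x (j + 1)) := fun j => rfl
  have hy0 : ∀ j, Ψ j (y j) ≠ 0 := by
    intro j h
    have h1 := h2 j
    rw [h, norm_zero] at h1
    exact h0 j (norm_eq_zero.1 (le_antisymm (by linarith) (norm_nonneg _)))
  have hc0 : ∀ j, c j ≠ 0 := by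
    intro j
    induction j with
    | zero => exact one_ne_zero
    | succ j ih => rw [hcs]; exact div_ne_zero (mul_ne_zero ih (hy0 j)) (h0 _)
  let Φ : ℕ → ℂ → ℂ := fun j z => c j * Ψ j z
  have hglue : ∀ j, Φ j (y j) = Φ (j + 1) (x (j + 1)) := by
    intro j
    simp only [Φ, hcs]
    rw [div_mul_cancel₀ _ (h0 (j + 1))]
  have hΦ : ∀ j z, ‖Φ j z‖ = ‖c j‖ * ‖Ψ j z‖ := fun j z => norm_mul _ _
  have hcp : ∀ j, 0 < ‖c j‖ := fun j => norm_pos_iff.2 (hc0 j)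
  let r : ℕ → ℝ := fun j => ‖Φ j (x j)‖
  have hr0 : ∀ j, 0 < r j := fun j => norm_pos_iff.2 (mul_ne_zero (hc0 j) (h0 j))
  have hr1 : ∀ j, ‖Φ j (y j)‖ = r (j + 1) := fun j => by rw [hglue]
  have hr2 : ∀ j, 2 * r j ≤ r (j + 1) := by
    intro j
    rw [← hr1]
    simp only [r, hΦ]
    nlinarith [h2 j, hcp j]
  have hmono : StrictMono r := strictMono_nat_of_lt_succ fun j => by linarith [hr2 j, hr0 j]
  have hlow : ∀ j, ∀ z ∈ D j, r j ≤ ‖Φ j z‖ ∧ (z ≠ x j → r j < ‖Φ j z‖) := by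
    intro j z hz
    have hlt : z ≠ x j → r j < ‖Φ j z‖ := fun h => by
      simp only [r, hΦ]
      exact mul_lt_mul_of_pos_left (hmin j z hz h) (hcp j)
    refine ⟨?_, hlt⟩
    by_cases h : z = x j
    · rw [h]
    · exact (hlt h).le
  have hup : ∀ j, ∀ z ∈ D j, ‖Φ j z‖ ≤ r (j + 1) ∧ (z ≠ y j → ‖Φ j z‖ < r (j + 1)) := by
    intro j z hz
    have hlt : z ≠ y j → ‖Φ j z‖ < r (j + 1) := fun h => by
      rw [← hr1, hΦ, hΦ]
      exact mul_lt_mul_of_pos_left (hmax j z hz h) (hcp j)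
    refine ⟨?_, hlt⟩
    by_cases h : z = y j
    · rw [h, hr1]
    · exact (hlt h).le
  have hlt : ∀ j k, j < k → ∀ z ∈ D j, ∀ z' ∈ D k, Φ j z = Φ k z' →
      k = j + 1 ∧ z = y j ∧ z' = x k := by
    intro j k hjk z hz z' hz' h
    have h1 := hup j z hz
    have h2 := hlow k z' hz'
    rw [h] at h1
    have h3 : r (j + 1) ≤ r k := hmono.monotone (Nat.succ_le_of_lt hjk)
    refine ⟨?_, ?_, ?_⟩
    · by_contra hne
      have : r (j + 1) < r k := hmono (show j + 1 < k by omega)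
      linarith
    · by_contra hne
      linarith [h1.2 hne]
    · by_contra hne
      linarith [h2.2 hne]
  refine ⟨Φ, fun j => continuousOn_const.mul (hc j), hglue, ?_, ?_⟩
  · intro B
    have hgrow : ∀ j : ℕ, (j : ℝ) * r 0 ≤ r j := by
      intro j
      induction j with
      | zero => simpa using (hr0 0).le
      | succ j ih =>
        have h1 := hr2 j
        have h2 : r 0 ≤ r j := hmono.monotone (Nat.zero_le j)
        push_cast
        nlinarith
    obtain ⟨J, hJ⟩ := exists_nat_gt (B / r 0)
    refine ⟨J, fun j hj z hz => ?_⟩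
    rw [div_lt_iff₀ (hr0 0)] at hJ
    have h1 : (J : ℝ) ≤ j := by exact_mod_cast hj
    have h2 := hr0 0
    have h3 := hgrow j
    have h4 := (hlow j z hz).1
    nlinarith
  · intro j k z hz z' hz' h
    rcases lt_trichotomy j k with hjk | rfl | hjk
    · exact Or.inr (Or.inl (hlt j k hjk z hz z' hz' h))
    · exact Or.inl ⟨rfl, hi j hz hz' (mul_left_cancel₀ (hc0 j) h)⟩
    · obtain ⟨h1, h2, h3⟩ := hlt k j hjk z' hz' z hz h.symm
      exact Or.inr (Or.inr ⟨h1, h3, h2⟩)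

end Placement

/-! ### Drawing lattice sets in a chain, and unit segments of the lattice -/

section ChainDrawing

open Set

/-- A point of the plane one of whose coordinates is an integer. -/
def HasIntCoord (z : ℂ) : Prop := (∃ n : ℤ, z.re = n) ∨ ∃ n : ℤ, z.im = n

/-- A point with integer coordinates as a complex number. -/
def latticePoint (p : ℤ × ℤ) : ℂ := ⟨p.1, p.2⟩

/-- The direction of the spokes. -/
noncomputable def spokeDir : ℂ := ⟨1 / 3, 1 / 3⟩

theorem spokeDir_ne_zero : spokeDir ≠ 0 := by
  intro h
  have := congrArg Complex.re h
  norm_num [spokeDir] at this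

theorem re_mul_spokeDir (t : ℝ) : ((t : ℂ) * spokeDir).re = t / 3 := by
  simp [spokeDir]; ring

theorem im_mul_spokeDir (t : ℝ) : ((t : ℂ) * spokeDir).im = t / 3 := by
  simp [spokeDir]; ring

theorem eq_zero_of_int {t : ℝ} (h0 : 0 ≤ t) (h1 : t < 1) (n : ℤ) (h : t = n) : t = 0 := by
  have h2 : n < 1 := by exact_mod_cast h ▸ h1
  have h3 : 0 ≤ n := by exact_mod_cast h ▸ h0
  rw [h, show n = 0 by omega, Int.cast_zero]

/-- Otherwise `q - p` would be a lattice vector with both coordinates equal to `(s + t) / 3`,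
strictly between `0` and `1`. The slope `1 / 3` in `spokeDir` lets spokes from opposite corners of a
cell end before they meet. -/
theorem eq_zero_of_spoke_eq {p q : ℤ × ℤ} {s t : ℝ} (hs : 0 ≤ s) (ht : 0 ≤ t) (hst : s + t < 3)
    (h : latticePoint p + s * spokeDir = latticePoint q - t * spokeDir) : s = 0 ∧ t = 0 := by
  have h1 := congrArg Complex.re h
  simp only [Complex.add_re, Complex.sub_re, re_mul_spokeDir, latticePoint] at h1
  have h2 := eq_zero_of_int (t := (s + t) / 3) (by positivity) (by linarith) (q.1 - p.1)
    (by push_cast; linarith)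
  constructor <;> linarith

theorem spoke_injective {z : ℂ} {s t : ℝ} (h : z + s * spokeDir = z + t * spokeDir) : s = t := by
  have h1 := mul_right_cancel₀ spokeDir_ne_zero (add_left_cancel h)
  exact_mod_cast h1

theorem spoke_injective' {z : ℂ} {s t : ℝ} (h : z - s * spokeDir = z - t * spokeDir) : s = t := by
  have h1 := mul_right_cancel₀ spokeDir_ne_zero (sub_right_injective h)
  exact_mod_cast h1

/-- Past its base the spoke runs in the interior of a cell, where no coordinate is an integer. -/
theorem HasIntCoord.eq_zero_of_add {p : ℤ × ℤ} {s : ℝ} (hs : 0 ≤ s) (hs' : s ≤ 1)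
    (h : HasIntCoord (latticePoint p + s * spokeDir)) : s = 0 := by
  rcases h with ⟨n, h⟩ | ⟨n, h⟩
  · simp only [Complex.add_re, re_mul_spokeDir, latticePoint] at h
    have := eq_zero_of_int (t := s / 3) (by positivity) (by linarith) (n - p.1)
      (by push_cast; linarith)
    linarith
  · simp only [Complex.add_im, im_mul_spokeDir, latticePoint] at h
    have := eq_zero_of_int (t := s / 3) (by positivity) (by linarith) (n - p.2)
      (by push_cast; linarith)
    linarith

theorem HasIntCoord.eq_zero_of_sub {p : ℤ × ℤ} {s : ℝ} (hs : 0 ≤ s) (hs' : s ≤ 1)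
    (h : HasIntCoord (latticePoint p - s * spokeDir)) : s = 0 := by
  rcases h with ⟨n, h⟩ | ⟨n, h⟩
  · simp only [Complex.sub_re, re_mul_spokeDir, latticePoint] at h
    have := eq_zero_of_int (t := s / 3) (by positivity) (by linarith) (p.1 - n)
      (by push_cast; linarith)
    linarith
  · simp only [Complex.sub_im, im_mul_spokeDir, latticePoint] at h
    have := eq_zero_of_int (t := s / 3) (by positivity) (by linarith) (p.2 - n)
      (by push_cast; linarith)
    linarith

/-- The concatenation of two paths parametrized by `[0, 1]`, constant outside `[0, 1]`. -/
noncomputable def joinPaths (f g : ℝ → ℂ) (t : ℝ) : ℂ :=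
  if t ≤ 1 / 2 then f (max 0 (min 1 (2 * t))) else g (max 0 (min 1 (2 - 2 * t)))

theorem joinPaths_left {f g : ℝ → ℂ} {t : ℝ} (h0 : 0 ≤ t) (h : t ≤ 1 / 2) :
    joinPaths f g t = f (2 * t) := by
  rw [joinPaths, if_pos h, min_eq_right (by linarith), max_eq_right (by linarith)]

theorem joinPaths_right {f g : ℝ → ℂ} {t : ℝ} (h0 : t ≤ 1) (h : 1 / 2 < t) :
    joinPaths f g t = g (2 - 2 * t) := by
  rw [joinPaths, if_neg (by linarith), min_eq_right (by linarith), max_eq_right (by linarith)]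

theorem continuous_joinPaths {f g : ℝ → ℂ} (hf : ContinuousOn f (Icc 0 1))
    (hg : ContinuousOn g (Icc 0 1)) (h : f 1 = g 1) : Continuous (joinPaths f g) := by
  have hmem : ∀ x : ℝ, max 0 (min 1 x) ∈ Icc (0 : ℝ) 1 := fun x =>
    ⟨le_max_left _ _, max_le zero_le_one (min_le_left _ _)⟩
  refine Continuous.if_le ?_ ?_ continuous_id continuous_const ?_
  · exact hf.comp_continuous (by fun_prop) fun t => hmem _
  · exact hg.comp_continuous (by fun_prop) fun t => hmem _
  · rintro t rfl
    norm_num [h]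

/-- Compact subsets of the integer grid lines can be placed disjointly in the plane and joined in
a chain by disjoint arcs. -/
theorem exists_chain_drawing {K : ℕ → Set ℂ} (hK : ∀ j, IsCompact (K j))
    (hint : ∀ j, ∀ z ∈ K j, HasIntCoord z) (p q : ℕ → ℤ × ℤ) :
    ∃ Φ : ℕ → ℂ → ℂ, ∃ c : ℕ → ℝ → ℂ, (∀ j, ContinuousOn (Φ j) (K j)) ∧
      (∀ j k, ∀ z ∈ K j, ∀ z' ∈ K k, Φ j z = Φ k z' → j = k ∧ z = z') ∧
      (∀ j, Continuous (c j)) ∧ (∀ j, c j 0 = Φ j (latticePoint (p j))) ∧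
      (∀ j, c j 1 = Φ (j + 1) (latticePoint (q (j + 1)))) ∧
      (∀ j k, ∀ t ∈ Ioo (0 : ℝ) 1, ∀ t' ∈ Icc (0 : ℝ) 1, c j t = c k t' → j = k ∧ t = t') ∧
      (∀ j k, ∀ t ∈ Ioo (0 : ℝ) 1, ∀ z ∈ K k, c j t ≠ Φ k z) ∧
      (∀ B : ℝ, ∃ J, ∀ j ≥ J, (∀ z ∈ K j, B < ‖Φ j z‖) ∧ ∀ t ∈ Icc (0 : ℝ) 1, B < ‖c j t‖) := by
  have hplace := fun j => exists_placement (hK j) (a := latticePoint (p j))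
    (b := latticePoint (q j)) spokeDir_ne_zero ?_ ?_ ?_
  rotate_left
  · intro t h0 h1
    constructor
    · intro h
      have := eq_zero_of_spoke_eq (s := t) (t := 1) h0 zero_le_one (by linarith)
        (by rwa [Complex.ofReal_one, one_mul])
      exact one_ne_zero this.2
    · intro h
      have := eq_zero_of_spoke_eq (s := 1) (t := t) zero_le_one h0 (by linarith)
        (by rwa [Complex.ofReal_one, one_mul])
      exact one_ne_zero this.1
  · intro h
    refine one_ne_zero (HasIntCoord.eq_zero_of_add (p := p j) (s := 1) zero_le_one le_rfl ?_)
    rw [Complex.ofReal_one, one_mul]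
    exact hint j _ h
  · intro h
    refine one_ne_zero (HasIntCoord.eq_zero_of_sub (p := q j) (s := 1) zero_le_one le_rfl ?_)
    rw [Complex.ofReal_one, one_mul]
    exact hint j _ h
  choose σ τ Ψ hσ hσ' hτ hτ' hΨc hΨi hΨ0 hΨ2 hΨm using hplace
  obtain ⟨Φ, hc, hglue, hfar, hcol⟩ := exists_nested hΨc hΨi hΨ0 hΨ2
    (fun j z hz => (hΨm j z hz).1) (fun j z hz => (hΨm j z hz).2)
  let α : ℕ → ℝ → ℂ := fun j s => latticePoint (p j) + (s * τ j : ℝ) * spokeDir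
  let β : ℕ → ℝ → ℂ := fun j s => latticePoint (q j) - (s * σ j : ℝ) * spokeDir
  have hα1 : ∀ j, α j 1 = latticePoint (p j) + τ j * spokeDir := fun j => by simp [α]
  have hβ1 : ∀ j, β j 1 = latticePoint (q j) - σ j * spokeDir := fun j => by simp [β]
  have hKD : ∀ j, ∀ z ∈ K j, z ∈ spoked (K j) (latticePoint (p j)) (latticePoint (q j)) spokeDir
    (σ j) (τ j) := fun j z hz => Or.inl (Or.inl hz)
  have hαD : ∀ j, ∀ s ∈ Icc (0 : ℝ) 1, α j s ∈ spoked (K j) (latticePoint (p j))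
      (latticePoint (q j)) spokeDir (σ j) (τ j) := fun j s hs =>
    Or.inl (Or.inr ⟨_, mul_nonneg hs.1 (hτ j).le, by nlinarith [hs.2, hτ j], rfl⟩)
  have hβD : ∀ j, ∀ s ∈ Icc (0 : ℝ) 1, β j s ∈ spoked (K j) (latticePoint (p j))
      (latticePoint (q j)) spokeDir (σ j) (τ j) := fun j s hs =>
    Or.inr ⟨_, mul_nonneg hs.1 (hσ j).le, by nlinarith [hs.2, hσ j], rfl⟩
  have one_mem : (1 : ℝ) ∈ Icc (0 : ℝ) 1 := ⟨zero_le_one, le_rfl⟩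
  have αα : ∀ j s t, α j s = α j t → s = t := fun j s t h =>
    mul_right_cancel₀ (hτ j).ne' (spoke_injective h)
  have ββ : ∀ j s t, β j s = β j t → s = t := fun j s t h =>
    mul_right_cancel₀ (hσ j).ne' (spoke_injective' h)
  have αβ : ∀ j, ∀ s ∈ Icc (0 : ℝ) 1, ∀ t ∈ Icc (0 : ℝ) 1, α j s = β j t → s = 0 ∧ t = 0 := by
    intro j s hs t ht h
    have h1 : s * τ j ≤ 1 := by nlinarith [hs.1, hs.2, hτ j, hτ' j]
    have h2 : t * σ j ≤ 1 := by nlinarith [ht.1, ht.2, hσ j, hσ' j]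
    have := eq_zero_of_spoke_eq (mul_nonneg hs.1 (hτ j).le) (mul_nonneg ht.1 (hσ j).le)
      (by linarith) h
    exact ⟨(mul_eq_zero.1 this.1).resolve_right (hτ j).ne',
      (mul_eq_zero.1 this.2).resolve_right (hσ j).ne'⟩
  have αK : ∀ j, ∀ s ∈ Icc (0 : ℝ) 1, α j s ∈ K j → s = 0 := by
    intro j s hs h
    have h1 : s * τ j ≤ 1 := by nlinarith [hs.1, hs.2, hτ j, hτ' j]
    have := HasIntCoord.eq_zero_of_add (mul_nonneg hs.1 (hτ j).le) h1 (hint j _ h)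
    exact (mul_eq_zero.1 this).resolve_right (hτ j).ne'
  have βK : ∀ j, ∀ s ∈ Icc (0 : ℝ) 1, β j s ∈ K j → s = 0 := by
    intro j s hs h
    have h1 : s * σ j ≤ 1 := by nlinarith [hs.1, hs.2, hσ j, hσ' j]
    have := HasIntCoord.eq_zero_of_sub (mul_nonneg hs.1 (hσ j).le) h1 (hint j _ h)
    exact (mul_eq_zero.1 this).resolve_right (hσ j).ne'
  simp only [← hα1, ← hβ1] at hglue hcol
  -- The exit spoke of the `j`-th set from base to tip, then the entry spoke of the next set from
  -- tip to base.
  let c : ℕ → ℝ → ℂ := fun j => joinPaths (fun s => Φ j (α j s)) (fun s => Φ (j + 1) (β (j + 1) s))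
  have hcases : ∀ j, ∀ t ∈ Icc (0 : ℝ) 1,
      (2 * t ∈ Icc (0 : ℝ) 1 ∧ c j t = Φ j (α j (2 * t))) ∨
      (2 - 2 * t ∈ Icc (0 : ℝ) 1 ∧ c j t = Φ (j + 1) (β (j + 1) (2 - 2 * t))) := by
    intro j t ht
    rcases le_or_gt t (1 / 2) with h | h
    · exact Or.inl ⟨⟨by linarith [ht.1], by linarith⟩, joinPaths_left ht.1 h⟩
    · exact Or.inr ⟨⟨by linarith [ht.2], by linarith⟩, joinPaths_right ht.2 h⟩
  refine ⟨Φ, c, fun j => (hc j).mono (hKD j), ?_, ?_, ?_, ?_, ?_, ?_, ?_⟩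
  · intro j k z hz z' hz' h
    rcases hcol j k z (hKD j z hz) z' (hKD k z' hz') h with h | ⟨-, rfl, -⟩ | ⟨-, -, rfl⟩
    · exact h
    · exact absurd (αK j 1 one_mem hz) one_ne_zero
    · exact absurd (αK k 1 one_mem hz') one_ne_zero
  · intro j
    refine continuous_joinPaths ?_ ?_ (hglue j)
    · exact (hc j).comp (by fun_prop) (hαD j)
    · exact (hc (j + 1)).comp (by fun_prop) (hβD (j + 1))
  · intro j
    simp only [c]
    rw [joinPaths_left le_rfl (by norm_num)]
    simp [α]
  · intro j
    simp only [c]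
    rw [joinPaths_right le_rfl (by norm_num)]
    simp [β]
  · intro j k t ht t' ht' h
    rcases hcases j t ⟨ht.1.le, ht.2.le⟩ with ⟨hm, e⟩ | ⟨hm, e⟩ <;>
      rcases hcases k t' ht' with ⟨hm', e'⟩ | ⟨hm', e'⟩ <;> rw [e, e'] at h
    · rcases hcol _ _ _ (hαD j _ hm) _ (hαD k _ hm') h with ⟨rfl, h1⟩ | ⟨-, -, h1⟩ | ⟨-, h1, -⟩
      · exact ⟨rfl, by linarith [αα _ _ _ h1]⟩
      · exact absurd (αβ _ _ hm' _ one_mem h1).2 one_ne_zero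
      · exact absurd (αβ _ _ hm _ one_mem h1).2 one_ne_zero
    · rcases hcol _ _ _ (hαD j _ hm) _ (hβD _ _ hm') h with ⟨rfl, h1⟩ | ⟨hjk, h1, h2⟩ | ⟨-, h1, -⟩
      · linarith [(αβ _ _ hm _ hm' h1).1, ht.1]
      -- The common tip of the two spokes: both parameters are `1 / 2`.
      · exact ⟨by omega, by linarith [αα _ _ _ h1, ββ _ _ _ h2]⟩
      · exact absurd (αβ _ _ hm _ one_mem h1).2 one_ne_zero
    · rcases hcol _ _ _ (hβD _ _ hm) _ (hαD k _ hm') h with ⟨rfl, h1⟩ | ⟨-, h1, -⟩ | ⟨hjk, h1, h2⟩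
      · linarith [(αβ _ _ hm' _ hm h1.symm).2, ht.2]
      · exact absurd (αβ _ _ one_mem _ hm h1.symm).1 one_ne_zero
      · exact ⟨by omega, by linarith [ββ _ _ _ h1, αα _ _ _ h2]⟩
    · rcases hcol _ _ _ (hβD _ _ hm) _ (hβD _ _ hm') h with ⟨hjk, h1⟩ | ⟨-, h1, -⟩ | ⟨-, -, h1⟩
      · obtain rfl : j = k := by omega
        exact ⟨rfl, by linarith [ββ _ _ _ h1]⟩
      · exact absurd (αβ _ _ one_mem _ hm h1.symm).1 one_ne_zero
      · exact absurd (αβ _ _ one_mem _ hm' h1.symm).1 one_ne_zero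
  · intro j k t ht z hz h
    rcases hcases j t ⟨ht.1.le, ht.2.le⟩ with ⟨hm, e⟩ | ⟨hm, e⟩ <;> rw [e] at h
    · rcases hcol _ _ _ (hαD j _ hm) _ (hKD k z hz) h with ⟨rfl, rfl⟩ | ⟨-, -, rfl⟩ | ⟨-, -, rfl⟩
      · linarith [αK _ _ hm hz, ht.1]
      · exact absurd (βK _ _ one_mem hz) one_ne_zero
      · exact absurd (αK _ _ one_mem hz) one_ne_zero
    · rcases hcol _ _ _ (hβD _ _ hm) _ (hKD k z hz) h with ⟨rfl, rfl⟩ | ⟨-, -, rfl⟩ | ⟨-, -, rfl⟩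
      · linarith [βK _ _ hm hz, ht.2]
      · exact absurd (βK _ _ one_mem hz) one_ne_zero
      · exact absurd (αK _ _ one_mem hz) one_ne_zero
  · intro B
    obtain ⟨J, hJ⟩ := hfar B
    refine ⟨J, fun j hj => ⟨fun z hz => hJ j hj z (hKD j z hz), fun t ht => ?_⟩⟩
    rcases hcases j t ht with ⟨hm, e⟩ | ⟨hm, e⟩ <;> rw [e]
    · exact hJ j hj _ (hαD j _ hm)
    · exact hJ (j + 1) (by omega) _ (hβD (j + 1) _ hm)

theorem hasIntCoord_of_mem_segment {p q : ℤ × ℤ} (h : |p.1 - q.1| + |p.2 - q.2| ≤ 1) {z : ℂ}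
    (hz : z ∈ segment ℝ (latticePoint p) (latticePoint q)) : HasIntCoord z := by
  obtain ⟨x, y, -, -, hxy, rfl⟩ := hz
  have h1 := abs_nonneg (p.1 - q.1)
  have h2 := abs_nonneg (p.2 - q.2)
  have h3 : p.1 = q.1 ∨ p.2 = q.2 := by
    by_contra! hcon
    have := abs_pos.2 (sub_ne_zero.2 hcon.1)
    have := abs_pos.2 (sub_ne_zero.2 hcon.2)
    omega
  rcases h3 with h3 | h3
  · refine Or.inl ⟨p.1, ?_⟩
    simp [latticePoint, ← h3, ← add_mul, hxy]
  · refine Or.inr ⟨p.2, ?_⟩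
    simp [latticePoint, ← h3, ← add_mul, hxy]

theorem exists_of_mem_openSegment {p q : ℤ × ℤ} (h : |p.1 - q.1| + |p.2 - q.2| = 1) {z : ℂ}
    (hz : z ∈ openSegment ℝ (latticePoint p) (latticePoint q)) :
    ∃ m n : ℤ, ∃ t : ℝ, 0 < t ∧ t < 1 ∧
      ((s(p, q) = s((m, n), (m + 1, n)) ∧ z.re = m + t ∧ z.im = n) ∨
        (s(p, q) = s((m, n), (m, n + 1)) ∧ z.re = m ∧ z.im = n + t)) := by
  obtain ⟨x, y, hx, hy, hxy, rfl⟩ := hz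
  obtain ⟨p1, p2⟩ := p
  obtain ⟨q1, q2⟩ := q
  simp only at h
  have hx' : x = 1 - y := by linarith
  have hcases : (q1 = p1 + 1 ∧ q2 = p2) ∨ (p1 = q1 + 1 ∧ q2 = p2) ∨ (q1 = p1 ∧ q2 = p2 + 1) ∨
      (q1 = p1 ∧ p2 = q2 + 1) := by
    rcases abs_cases (p1 - q1) with h1 | h1 <;> rcases abs_cases (p2 - q2) with h2 | h2 <;> omega
  rcases hcases with ⟨rfl, rfl⟩ | ⟨rfl, rfl⟩ | ⟨rfl, rfl⟩ | ⟨rfl, rfl⟩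
  · refine ⟨p1, _, y, hy, by linarith, Or.inl ⟨rfl, ?_, ?_⟩⟩ <;> simp [latticePoint, hx'] <;> ring
  · refine ⟨q1, _, x, hx, by linarith, Or.inl ⟨Sym2.eq_swap, ?_, ?_⟩⟩ <;>
      simp [latticePoint, hx'] <;> ring
  · refine ⟨_, p2, y, hy, by linarith, Or.inr ⟨rfl, ?_, ?_⟩⟩ <;> simp [latticePoint, hx'] <;> ring
  · refine ⟨_, q2, x, hx, by linarith, Or.inr ⟨Sym2.eq_swap, ?_, ?_⟩⟩ <;>
      simp [latticePoint, hx'] <;> ring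

theorem int_add_ne {m n : ℤ} {t : ℝ} (h0 : 0 < t) (h1 : t < 1) : (m : ℝ) + t ≠ n := by
  intro h
  have := eq_zero_of_int h0.le h1 (n - m) (by push_cast; linarith)
  linarith

theorem int_add_inj {m n : ℤ} {s t : ℝ} (hs : 0 < s) (hs' : s < 1) (ht : 0 < t) (ht' : t < 1)
    (h : (m : ℝ) + s = n + t) : m = n := by
  have h1 : (m : ℝ) < n + 1 := by linarith
  have h2 : (n : ℝ) < m + 1 := by linarith
  have h1' : m < n + 1 := by exact_mod_cast h1
  have h2' : n < m + 1 := by exact_mod_cast h2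
  omega

theorem latticePoint_notMem_openSegment {p q r : ℤ × ℤ} (h : |p.1 - q.1| + |p.2 - q.2| = 1) :
    latticePoint r ∉ openSegment ℝ (latticePoint p) (latticePoint q) := by
  intro hz
  obtain ⟨m, n, t, h0, h1, ⟨-, h2, -⟩ | ⟨-, -, h2⟩⟩ := exists_of_mem_openSegment h hz
  · exact int_add_ne h0 h1 h2.symm
  · exact int_add_ne h0 h1 h2.symm

/-- The coordinate of `z` that is not an integer tells the direction of the segment; the integer
parts give its left or lower end. -/
theorem eq_of_mem_openSegment {p q p' q' : ℤ × ℤ} (h : |p.1 - q.1| + |p.2 - q.2| = 1)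
    (h' : |p'.1 - q'.1| + |p'.2 - q'.2| = 1) {z : ℂ}
    (hz : z ∈ openSegment ℝ (latticePoint p) (latticePoint q))
    (hz' : z ∈ openSegment ℝ (latticePoint p') (latticePoint q')) : s(p, q) = s(p', q') := by
  obtain ⟨m, n, t, h0, h1, ⟨e1, e2, e3⟩ | ⟨e1, e2, e3⟩⟩ := exists_of_mem_openSegment h hz <;>
    obtain ⟨m', n', t', h0', h1', ⟨e1', e2', e3'⟩ | ⟨e1', e2', e3'⟩⟩ :=
      exists_of_mem_openSegment h' hz'
  · obtain rfl := int_add_inj h0 h1 h0' h1' (e2.symm.trans e2')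
    obtain rfl : n = n' := by exact_mod_cast e3.symm.trans e3'
    rw [e1, e1']
  · exact absurd (e2.symm.trans e2') (int_add_ne h0 h1)
  · exact absurd (e2'.symm.trans e2) (int_add_ne h0' h1')
  · obtain rfl := int_add_inj h0 h1 h0' h1' (e3.symm.trans e3')
    obtain rfl : m = m' := by exact_mod_cast e2.symm.trans e2'
    rw [e1, e1']

theorem latticePoint_injective : Function.Injective latticePoint := by
  intro p q h
  have h1 : (p.1 : ℝ) = q.1 := congrArg Complex.re h
  have h2 : (p.2 : ℝ) = q.2 := congrArg Complex.im h
  exact Prod.ext (by exact_mod_cast h1) (by exact_mod_cast h2)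

end ChainDrawing

namespace SimpleGraph

/-! ### Planarity of chains of lattice graphs -/

section ChainPlanar

open Set

variable {W : ℕ → Type*}

/-- The `m j` inner vertices cut the arc at the multiples of `1 / (m j + 1)`. -/
theorem apply_linkPoint {X : Type*} {m : ℕ → ℕ} {a : ∀ j, W j} {b : ∀ j, W (j + 1)}
    {f : (Σ j, W j) → X} {c : ℕ → ℝ → X} (h0 : ∀ j, c j 0 = f ⟨j, a j⟩)
    (h1 : ∀ j, c j 1 = f ⟨j + 1, b j⟩) {j i : ℕ} (hi : i ≤ m j + 1) :
    Sum.elim f (fun p : Σ j, Fin (m j) => c p.1 (((p.2 : ℕ) + 1) / ((m p.1 : ℝ) + 1)))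
      (linkPoint m a b j i) = c j (i / ((m j : ℝ) + 1)) := by
  unfold linkPoint
  split_ifs with hz hlt
  · subst hz
    simp [h0]
  · simp only [Sum.elim_inr]
    have : ((i - 1 : ℕ) : ℝ) + 1 = i := by
      have : i - 1 + 1 = i := by omega
      exact_mod_cast this
    rw [this]
  · obtain rfl : i = m j + 1 := by omega
    simp only [Sum.elim_inl]
    rw [← h1]
    congr 1
    push_cast
    exact (div_self (by positivity)).symm

/-- A chain of finite graphs that embed in the square lattice is planar. -/
theorem chain_isPlanar [∀ j, Finite (W j)] (G : ∀ j, SimpleGraph (W j)) (m : ℕ → ℕ)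
    (a : ∀ j, W j) (b : ∀ j, W (j + 1)) (P : ∀ j, W j → ℤ × ℤ)
    (hP : ∀ j, Function.Injective (P j))
    (hstep : ∀ j u v, (G j).Adj u v → |(P j u).1 - (P j v).1| + |(P j u).2 - (P j v).2| = 1) :
    (chain G m a b).IsPlanar := by
  let L : ∀ j, W j → ℂ := fun j u => latticePoint (P j u)
  -- The degenerate pairs `p.1 = p.2` put isolated vertices into the set.
  let K : ℕ → Set ℂ := fun j =>
    ⋃ p : {p : W j × W j // p.1 = p.2 ∨ (G j).Adj p.1 p.2}, segment ℝ (L j p.1.1) (L j p.1.2)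
  have hK : ∀ j, IsCompact (K j) := fun j => isCompact_iUnion fun p => by
    rw [segment_eq_image]
    exact isCompact_Icc.image (by fun_prop)
  have hint : ∀ j, ∀ z ∈ K j, HasIntCoord z := by
    intro j z hz
    obtain ⟨⟨⟨u, v⟩, huv⟩, hz⟩ := mem_iUnion.1 hz
    refine hasIntCoord_of_mem_segment ?_ hz
    rcases huv with h | huv
    · simp [show u = v from h]
    · exact (hstep j u v huv).le
  have hLK : ∀ j u, L j u ∈ K j := fun j u =>
    mem_iUnion.2 ⟨⟨(u, u), Or.inl rfl⟩, left_mem_segment ℝ _ _⟩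
  have hsK : ∀ j u v, (G j).Adj u v → ∀ z ∈ segment ℝ (L j u) (L j v), z ∈ K j :=
    fun j u v huv z hz => mem_iUnion.2 ⟨⟨(u, v), Or.inr huv⟩, hz⟩
  have hoK : ∀ j u v, (G j).Adj u v → ∀ z ∈ openSegment ℝ (L j u) (L j v), z ∈ K j :=
    fun j u v huv z hz => hsK j u v huv z (openSegment_subset_segment ℝ _ _ hz)
  -- The value `0` is a dummy entry for the first graph: no link ends there.
  obtain ⟨Φ, c, hΦc, hΦ, hcc, hc0, hc1, hccol, hcΦ, hfar⟩ := exists_chain_drawing hK hint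
    (fun j => P j (a j)) (fun j => Nat.casesOn j 0 fun j => P (j + 1) (b j))
  have hM : ∀ j, (0 : ℝ) < m j + 1 := fun j => by positivity
  let pos : (Σ j, W j) ⊕ (Σ j, Fin (m j)) → ℂ := Sum.elim (fun p => Φ p.1 (L p.1 p.2))
    fun p => c p.1 (((p.2 : ℕ) + 1) / ((m p.1 : ℝ) + 1))
  have hlink : ∀ {j i : ℕ}, i ≤ m j + 1 → pos (linkPoint m a b j i) = c j (i / ((m j : ℝ) + 1)) :=
    fun hi => apply_linkPoint (f := fun p => Φ p.1 (L p.1 p.2)) hc0 hc1 hi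
  have hIoo : ∀ j (i : Fin (m j)), ((i : ℕ) + 1) / ((m j : ℝ) + 1) ∈ Ioo (0 : ℝ) 1 := by
    intro j i
    have : ((i : ℕ) : ℝ) < m j := by exact_mod_cast i.2
    refine ⟨by positivity, ?_⟩
    rw [div_lt_one (hM j)]
    linarith
  have hIcc : ∀ j i, i ≤ m j → ∀ t ∈ Icc (0 : ℝ) 1, (i + t) / ((m j : ℝ) + 1) ∈ Icc (0 : ℝ) 1 := by
    intro j i hi t ht
    have : (i : ℝ) ≤ m j := by exact_mod_cast hi
    refine ⟨div_nonneg (by linarith [ht.1, Nat.cast_nonneg (α := ℝ) i]) (hM j).le, ?_⟩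
    rw [div_le_one (hM j)]
    linarith [ht.2]
  have hIoo' : ∀ j i, i ≤ m j → ∀ t ∈ Ioo (0 : ℝ) 1,
      (i + t) / ((m j : ℝ) + 1) ∈ Ioo (0 : ℝ) 1 := by
    intro j i hi t ht
    have : (i : ℝ) ≤ m j := by exact_mod_cast hi
    refine ⟨div_pos (by linarith [ht.1, Nat.cast_nonneg (α := ℝ) i]) (hM j), ?_⟩
    rw [div_lt_one (hM j)]
    linarith [ht.2]
  -- `hccol` wants one parameter in the open interval. Only the two ends of the arc remain, and they
  -- lie in different sets.
  have hcinj : ∀ j, InjOn (c j) (Icc 0 1) := by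
    intro j t ht t' ht' h
    by_cases h1 : t ∈ Ioo (0 : ℝ) 1
    · exact (hccol j j t h1 t' ht' h).2
    · by_cases h2 : t' ∈ Ioo (0 : ℝ) 1
      · exact (hccol j j t' h2 t ht h.symm).2.symm
      · have hends : ∀ s ∈ Icc (0 : ℝ) 1, s ∉ Ioo (0 : ℝ) 1 → s = 0 ∨ s = 1 := by
          intro s hs hs'
          by_contra! hcon
          exact hs' ⟨lt_of_le_of_ne hs.1 hcon.1.symm, lt_of_le_of_ne hs.2 hcon.2⟩
        have hne : c j 0 ≠ c j 1 := by
          intro h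
          rw [hc0, hc1] at h
          have := (hΦ _ _ _ (hLK j (a j)) _ (hLK (j + 1) (b j)) h).1
          omega
        rcases hends t ht h1 with rfl | rfl <;> rcases hends t' ht' h2 with rfl | rfl
        · rfl
        · exact absurd h hne
        · exact absurd h.symm hne
        · rfl
  let cell : Sym2 ((Σ j, W j) ⊕ (Σ j, Fin (m j))) → Set ℂ := fun e =>
    {z | (∃ j u v, (G j).Adj u v ∧ e = s(Sum.inl ⟨j, u⟩, Sum.inl ⟨j, v⟩) ∧
        ∃ y ∈ openSegment ℝ (L j u) (L j v), z = Φ j y) ∨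
      ∃ j i, i ≤ m j ∧ e = s(linkPoint m a b j i, linkPoint m a b j (i + 1)) ∧
        ∃ t ∈ Ioo (0 : ℝ) 1, z = c j ((i + t) / ((m j : ℝ) + 1))}
  have hedge : ∀ e ∈ (chain G m a b).edgeSet,
      (∃ j u v, (G j).Adj u v ∧ e = s(Sum.inl ⟨j, u⟩, Sum.inl ⟨j, v⟩)) ∨
      ∃ j i, i ≤ m j ∧ e = s(linkPoint m a b j i, linkPoint m a b j (i + 1)) := by
    intro e
    induction e with
    | _ x y =>
      intro h
      rw [mem_edgeSet, chain, fromRel_adj] at h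
      rcases h with ⟨-, (⟨j, u, v, h, rfl, rfl⟩ | ⟨j, i, hi, rfl, rfl⟩) |
        (⟨j, u, v, h, rfl, rfl⟩ | ⟨j, i, hi, rfl, rfl⟩)⟩
      · exact Or.inl ⟨j, u, v, h, rfl⟩
      · exact Or.inr ⟨j, i, hi, rfl⟩
      · exact Or.inl ⟨j, u, v, h, Sym2.eq_swap⟩
      · exact Or.inr ⟨j, i, hi, Sym2.eq_swap⟩
  refine isPlanar_of_drawing (pos := pos) (cell := cell) ?_ ?_ ?_ ?_ ?_ ?_
  · rintro (⟨j, u⟩ | ⟨j, i⟩) (⟨k, v⟩ | ⟨k, i'⟩) h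
    · obtain ⟨rfl, h2⟩ := hΦ j k _ (hLK j u) _ (hLK k v) h
      rw [hP j (latticePoint_injective h2)]
    · exact absurd h.symm (hcΦ k j _ (hIoo k i') _ (hLK j u))
    · exact absurd h (hcΦ j k _ (hIoo j i) _ (hLK k v))
    · obtain ⟨rfl, h2⟩ := hccol j k _ (hIoo j i) _ (Ioo_subset_Icc_self (hIoo k i')) h
      rw [div_left_inj' (hM j).ne', add_left_inj] at h2
      have : i = i' := Fin.ext (by exact_mod_cast h2)
      rw [this]
  · intro e he
    rcases hedge e he with ⟨j, u, v, huv, rfl⟩ | ⟨j, i, hi, rfl⟩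
    · have hseg : ∀ t : unitInterval, AffineMap.lineMap (L j u) (L j v) (t : ℝ) ∈
          segment ℝ (L j u) (L j v) := fun t => by
        rw [segment_eq_image_lineMap]
        exact ⟨t, t.2, rfl⟩
      refine ⟨Sum.inl ⟨j, u⟩, Sum.inl ⟨j, v⟩,
        fun t => Φ j (AffineMap.lineMap (L j u) (L j v) (t : ℝ)), rfl, ?_, ?_, ?_, ?_, ?_⟩
      · refine (hΦc j).comp_continuous ?_ fun t => hsK j u v huv _ (hseg t)
        exact AffineMap.lineMap_continuous.comp continuous_subtype_val
      · intro t t' h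
        have h1 := (hΦ j j _ (hsK j u v huv _ (hseg t)) _ (hsK j u v huv _ (hseg t')) h).2
        have hne : L j u ≠ L j v := fun h => huv.ne (hP j (latticePoint_injective h))
        exact Subtype.ext (AffineMap.lineMap_injective ℝ hne h1)
      · simp [pos]
      · simp [pos]
      · intro t h0 h1
        refine Or.inl ⟨j, u, v, huv, rfl, _, ?_, rfl⟩
        rw [openSegment_eq_image_lineMap]
        exact ⟨t, ⟨unitInterval.pos_iff_ne_zero.2 h0, unitInterval.lt_one_iff_ne_one.2 h1⟩, rfl⟩
    · refine ⟨_, _, fun t => c j ((i + (t : ℝ)) / ((m j : ℝ) + 1)), rfl, ?_, ?_, ?_, ?_, ?_⟩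
      · exact (hcc j).comp (by fun_prop)
      · intro t t' h
        have h1 := hcinj j (hIcc j i hi t t.2) (hIcc j i hi t' t'.2) h
        rw [div_left_inj' (hM j).ne'] at h1
        exact Subtype.ext (add_left_cancel h1)
      · rw [hlink (by omega)]
        simp
      · rw [hlink (by omega)]
        simp
      · intro t h0 h1
        exact Or.inr ⟨j, i, hi, rfl, t,
          ⟨unitInterval.pos_iff_ne_zero.2 h0, unitInterval.lt_one_iff_ne_one.2 h1⟩, rfl⟩
  · rintro e e' z (⟨j, u, v, huv, rfl, y, hy, rfl⟩ | ⟨j, i, hi, rfl, t, ht, rfl⟩)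
      (⟨k, u', v', huv', rfl, y', hy', h⟩ | ⟨k, i', hi', rfl, t', ht', h⟩)
    · obtain ⟨rfl, rfl⟩ := hΦ j k _ (hoK j u v huv y hy) _ (hoK k u' v' huv' y' hy') h
      have h1 := eq_of_mem_openSegment (hstep j u v huv) (hstep j u' v' huv') hy hy'
      have h2 : s(u, v) = s(u', v') := Sym2.map.injective (hP j) h1
      exact congrArg (Sym2.map fun x => (Sum.inl ⟨j, x⟩ : (Σ j, W j) ⊕ (Σ j, Fin (m j)))) h2
    · exact absurd h.symm (hcΦ k j _ (hIoo' k i' hi' t' ht') _ (hoK j u v huv y hy))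
    · exact absurd h (hcΦ j k _ (hIoo' j i hi t ht) _ (hoK k u' v' huv' y' hy'))
    · obtain ⟨rfl, h1⟩ := hccol j k _ (hIoo' j i hi t ht) _
        (Ioo_subset_Icc_self (hIoo' k i' hi' t' ht')) h
      rw [div_left_inj' (hM j).ne'] at h1
      have : (i : ℤ) = i' := int_add_inj ht.1 ht.2 ht'.1 ht'.2 (by exact_mod_cast h1)
      obtain rfl : i = i' := by exact_mod_cast this
      rfl
  · rintro e (⟨k, x⟩ | ⟨k, i'⟩) (⟨j, u, v, huv, rfl, y, hy, h⟩ | ⟨j, i, hi, rfl, t, ht, h⟩)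
    · obtain ⟨rfl, rfl⟩ := hΦ k j _ (hLK k x) _ (hoK j u v huv y hy) h
      exact latticePoint_notMem_openSegment (hstep k u v huv) hy
    · exact hcΦ j k _ (hIoo' j i hi t ht) _ (hLK k x) h.symm
    · exact hcΦ k j _ (hIoo k i') _ (hoK j u v huv y hy) h
    · obtain ⟨rfl, h1⟩ := hccol k j _ (hIoo k i') _ (Ioo_subset_Icc_self (hIoo' j i hi t ht)) h
      rw [div_left_inj' (hM k).ne'] at h1
      refine int_add_ne (m := i) (n := i' + 1) ht.1 ht.2 ?_
      push_cast
      exact h1.symm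
  · intro B
    obtain ⟨J, hJ⟩ := hfar B
    refine ⟨⋃ j ∈ Iio J, (range fun u : W j => Sum.inl ⟨j, u⟩) ∪
      range fun i : Fin (m j) => Sum.inr ⟨j, i⟩, ?_, ?_⟩
    · exact (finite_Iio J).biUnion fun j _ => (finite_range _).union (finite_range _)
    · rintro (⟨j, u⟩ | ⟨j, i⟩) hv
      · have hj : J ≤ j := by
          by_contra! hlt
          exact hv (mem_iUnion₂.2 ⟨j, hlt, Or.inl ⟨u, rfl⟩⟩)
        exact (hJ j hj).1 _ (hLK j u)
      · have hj : J ≤ j := by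
          by_contra! hlt
          exact hv (mem_iUnion₂.2 ⟨j, hlt, Or.inr ⟨i, rfl⟩⟩)
        exact (hJ j hj).2 _ (Ioo_subset_Icc_self (hIoo j i))
  · intro B
    obtain ⟨J, hJ⟩ := hfar B
    refine ⟨⋃ j ∈ Iio J, (range fun p : W j × W j => s(Sum.inl ⟨j, p.1⟩, Sum.inl ⟨j, p.2⟩)) ∪
      range fun i : Fin (m j + 1) => s(linkPoint m a b j i, linkPoint m a b j (i + 1)), ?_, ?_⟩
    · exact (finite_Iio J).biUnion fun j _ => (finite_range _).union (finite_range _)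
    · intro e he heS
      have hgrid : ∀ j u v, e = s(Sum.inl ⟨j, u⟩, Sum.inl ⟨j, v⟩) → J ≤ j := by
        rintro j u v rfl
        by_contra! hlt
        exact heS (mem_iUnion₂.2 ⟨j, hlt, Or.inl ⟨(u, v), rfl⟩⟩)
      have hlnk : ∀ j i, i ≤ m j → e = s(linkPoint m a b j i, linkPoint m a b j (i + 1)) →
          J ≤ j := by
        rintro j i hi rfl
        by_contra! hlt
        exact heS (mem_iUnion₂.2 ⟨j, hlt, Or.inr ⟨⟨i, by omega⟩, rfl⟩⟩)
      constructor
      · rintro z (⟨j, u, v, huv, h, y, hy, rfl⟩ | ⟨j, i, hi, h, t, ht, rfl⟩)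
        · exact (hJ j (hgrid j u v h)).1 _ (hoK j u v huv y hy)
        · exact (hJ j (hlnk j i hi h)).2 _ (Ioo_subset_Icc_self (hIoo' j i hi t ht))
      · intro x hx
        rcases hedge e he with ⟨j, u, v, huv, h⟩ | ⟨j, i, hi, h⟩
        · have hj := hgrid j u v h
          rw [h, Sym2.mem_iff] at hx
          rcases hx with rfl | rfl
          · exact (hJ j hj).1 _ (hLK j u)
          · exact (hJ j hj).1 _ (hLK j v)
        · have hj := hlnk j i hi h
          rw [h, Sym2.mem_iff] at hx
          rcases hx with rfl | rfl
          · rw [hlink (by omega)]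
            have := hIcc j i hi 0 ⟨le_rfl, zero_le_one⟩
            rw [add_zero] at this
            exact (hJ j hj).2 _ this
          · rw [hlink (by omega)]
            have := hIcc j i hi 1 ⟨zero_le_one, le_rfl⟩
            push_cast
            exact (hJ j hj).2 _ this

theorem gridChain_isPlanar (a : ∀ j : ℕ, SubdividedGridVertex (j + 1))
    (b : ∀ j : ℕ, SubdividedGridVertex (j + 2)) : (gridChain a b).IsPlanar :=
  chain_isPlanar (W := fun j => SubdividedGridVertex (j + 1)) _ _ _ _ (fun _ => gridPos)
    (fun _ => gridPos_injective) fun _ _ _ h => gridStep_dist (gridStep_of_adj h)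

end ChainPlanar

end SimpleGraph
theorem mainTheorem7 :
    (∀ (a : ∀ j : ℕ, SimpleGraph.SubdividedGridVertex (j + 1))
        (b : ∀ j : ℕ, SimpleGraph.SubdividedGridVertex (j + 2)),
      (SimpleGraph.gridChain a b).IsPlanar ∧
      (SimpleGraph.gridChain a b).graphAsdim = 1 ∧
      (SimpleGraph.gridChain a b).graphANdim = 2) ∧
    (∃ (V : Type) (G : SimpleGraph V), G.IsPlanar ∧ G.graphAsdim ≠ G.graphANdim) := by
  have key : ∀ (a : ∀ j : ℕ, SimpleGraph.SubdividedGridVertex (j + 1))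
      (b : ∀ j : ℕ, SimpleGraph.SubdividedGridVertex (j + 2)),
      (SimpleGraph.gridChain a b).IsPlanar ∧
      (SimpleGraph.gridChain a b).graphAsdim = 1 ∧
      (SimpleGraph.gridChain a b).graphANdim = 2 := fun a b =>
    ⟨SimpleGraph.gridChain_isPlanar a b, SimpleGraph.gridChain_graphAsdim a b,
      SimpleGraph.gridChain_graphANdim a b⟩
  refine ⟨key, _, SimpleGraph.gridChain (fun _ => Sum.inl (0, 0)) fun _ => Sum.inl (0, 0),
    (key _ _).1, ?_⟩
  rw [(key _ _).2.1, (key _ _).2.2]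
  decide
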